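/- Identify $\mathbb C^n$ with $\mathbb R^{2n}$, write $|\cdot|$ for the Euclidean norm, and let $D$ be an infinitely smooth origin-symmetric convex body in $\mathbb R^{2n}$ (compact, convex, with non-empty interior, $D=-D$, with Minkowski functional $\|\cdot\|_D$ of class $C^\infty$ on $\mathbb R^{2n}\setminus\{0\}$). Let $H$ be a $(2n-2)$-dimensional linear subspace of $\mathbb R^{2n}$, let $\{e_1,e_2\}$ be an orthonormal basis of $H^\perp$, and for $p\ge 0$ put $$A_{D,H,p}(u)=\int_{D\cap H_u}|x|^{-p}\,dx,\qquad H_u=\{x\in\mathbb R^{2n}:\langle x,e_1\rangle=u_1,\ \langle x,e_2\rangle=u_2\},\qquad u\in\mathbb R^2 .$$ The action $\bigl\langle |u|^{-q-2}/\Gamma(-q/2),\,A_{D,H,p}\bigr\rangle$ is understood by regularization: it is the value at $q$ of the unique function that is analytic on (a neighbourhood of) the half-plane $\{z\in\mathbb C:\operatorname{Re} z\le 2n-p-3\}$ and equals the absolutely convergent integral $\frac1{\Gamma(-z/2)}\int_{\mathbb R^2}|u|^{-z-2}A_{D,H,p}(u)\,du$ when also $\operatorname{Re} z<0$. The Fourier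 transform $f^\wedge$ of a distribution $f$ is given by $\langle f^\wedge,\varphi\rangle=\langle f,\hat\varphi\rangle$ for Schwartz functions $\varphi$, with $\hat\varphi(\xi)=\int\varphi(x)e^{-i\langle x,\xi\rangle}dx$. (1) Let $-2<q<2n-2$ and $0\le p\le 2n-q-3$. Then the regularized action exists, the Fourier transform of the locally integrable function $\|x\|_D^{-2n+q+p+2}|x|^{-p}$ is a locally integrable function that is continuous on $\mathbb R^{2n}\setminus\{0\}$, and $$\Bigl\langle \frac{|u|^{-q-2}}{\Gamma(-q/2)},A_{D,H,p}\Bigr\rangle=\frac{2^{-q-2}}{\pi\,\Gamma\bigl(\frac{q+2}{2}\bigr)(2n-q-p-2)}\int_{S^{2n-1}\cap H^\perp}\bigl(\|x\|_D^{-2n+q+p+2}|x|^{-p}\bigr)^\wedge(\theta)\,d\theta .$$ (2) Let $d\ge 0$ be an integer with $d<n-1$ and let $0\le p\le 2n-2d-3$. Then $A_{D,H,p}$ is $2d$ times continuously differentiable near the origin, and, with $\Delta=\partial_{u_1}^2+\partial_{u_2}^2$, $$\Delta^d A_{D,H,p}(0)=\frac{(-1)^d}{4\pi^2(2n-2d-p-2)}\int_{S^{2n-1}\cap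 H^\perp}\bigl(\|x\|_D^{-2n+2d+p+2}|x|^{-p}\bigr)^\wedge(\theta)\,d\theta .$$ -/

import Mathlib

open MeasureTheory Module
open scoped SchwartzMap ContDiff Laplacian

noncomputable section

namespace BusemannPetty

/-- Euclidean space `ℝ^N`. -/
abbrev Euc (N : ℕ) : Type := EuclideanSpace ℝ (Fin N)

/-- A body is infinitely smooth if its Minkowski functional is `C^∞` on the unit sphere.  Since the
functional is positively homogeneous of degree one, this says that it is `C^∞` off the origin. -/
def IsInfinitelySmooth {N : ℕ} (D : ConvexBody (Euc N)) : Prop :=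
  ContDiffOn ℝ ∞ (gauge (D : Set (Euc N))) {0}ᶜ

/-- The point `u₁ e₁ + u₂ e₂` of `Hᗮ`, as a vector of `ℝ^N`. -/
def planePoint {N : ℕ} {H : Submodule ℝ (Euc N)} (e : OrthonormalBasis (Fin 2) ℝ Hᗮ)
    (u : Euc 2) : Euc N :=
  u 0 • (e 0 : Euc N) + u 1 • (e 1 : Euc N)

/-- The weighted parallel section function
`A_{D,H,p}(u) = ∫_{D ∩ H_u} |x|^{-p} dx`, where `H_u = {x : ⟪x, e₁⟫ = u₁, ⟪x, e₂⟫ = u₂}`.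
The affine subspace `H_u = H + u₁ e₁ + u₂ e₂` is parametrised by `H`, which carries its Lebesgue
measure as a Euclidean space. -/
def sectionFun {N : ℕ} (D : ConvexBody (Euc N)) (H : Submodule ℝ (Euc N))
    (e : OrthonormalBasis (Fin 2) ℝ Hᗮ) (p : ℝ) (u : Euc 2) : ℝ :=
  ∫ h : H in {h : H | (h : Euc N) + planePoint e u ∈ D},
    ‖(h : Euc N) + planePoint e u‖ ^ (-p)

/-- `G` is the function `z ↦ ⟨|u|^{-z-2} / Γ(-z/2), A⟩` on the half-plane `Re z ≤ b`, the action of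
the distribution `|u|^{-z-2} / Γ(-z/2)` on `A : ℝ² → ℝ` regularised by analytic continuation in `z`:
`G` is analytic on the closed half-plane, and for `Re z < 0` it is given by the
(absolutely convergent) integral `Γ(-z/2)⁻¹ ∫_{ℝ²} |u|^{-z-2} A(u) du`.
By the identity theorem these properties determine `G` on the half-plane. -/
structure IsRegularizedAction (A : Euc 2 → ℝ) (b : ℝ) (G : ℂ → ℂ) : Prop where
  analytic : AnalyticOnNhd ℂ G {z : ℂ | z.re ≤ b}
  integrable : ∀ z : ℂ, z.re ≤ b → z.re < 0 →
    Integrable (fun u : Euc 2 => (‖u‖ : ℂ) ^ (-z - 2) * (A u : ℂ))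
  eq_integral : ∀ z : ℂ, z.re ≤ b → z.re < 0 →
    G z = (Complex.Gamma (-z / 2))⁻¹ * ∫ u : Euc 2, (‖u‖ : ℂ) ^ (-z - 2) * (A u : ℂ)

/-- The Fourier transform of a test function, `φ^(ξ) = ∫ φ(x) e^{-i⟪x, ξ⟫} dx`. -/
def testFourier {N : ℕ} (φ : 𝓢(Euc N, ℂ)) (ξ : Euc N) : ℂ :=
  ∫ x : Euc N, Complex.exp (-(inner ℝ x ξ : ℝ) * Complex.I) * φ x

/-- The Fourier transform of the distribution `f` is the function `F`, which is continuous off the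
origin: `⟨f^, φ⟩ = ⟨f, φ^⟩ = ∫ f φ^` equals `∫ F φ` for every Schwartz function `φ`, all these
integrals being absolutely convergent.  These properties determine `F` off the origin. -/
structure IsFourierTransform {N : ℕ} (f : Euc N → ℝ) (F : Euc N → ℂ) : Prop where
  continuousOn : ContinuousOn F {0}ᶜ
  integrable_left : ∀ φ : 𝓢(Euc N, ℂ), Integrable (fun x => (f x : ℂ) * testFourier φ x)
  integrable_right : ∀ φ : 𝓢(Euc N, ℂ), Integrable (fun x => F x * φ x)
  eq : ∀ φ : 𝓢(Euc N, ℂ), ∫ x, (f x : ℂ) * testFourier φ x = ∫ x, F x * φ x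

/-- The function `‖x‖_D^{-s} |x|^{-p}`. -/
def normPower {N : ℕ} (D : ConvexBody (Euc N)) (s p : ℝ) (x : Euc N) : ℝ :=
  gauge (D : Set (Euc N)) x ^ (-s) * ‖x‖ ^ (-p)

/-- The integral of `F` over the unit circle of `Hᗮ` with respect to arc length. -/
def circleInt {N : ℕ} {H : Submodule ℝ (Euc N)} (e : OrthonormalBasis (Fin 2) ℝ Hᗮ)
    (F : Euc N → ℂ) : ℂ :=
  ∫ t in (0 : ℝ)..(2 * Real.pi), F (planePoint e !₂[Real.cos t, Real.sin t])

end BusemannPetty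

end

/-! Let g be the gauge of D, m = 2n - 2 the dimension of H, and s = 2n - q - p - 2 = m - p - q. The
function g^{-s}|x|^{-p} is a superposition of dilates of a single test function: take a bump κ on
[1, 2] with ∫ κ(t) dt/t = 1, put η(t) = κ(t) t^{-s} and ψ = η(g)|x|^{-p}; then g(x)^{-s}|x|^{-p} = ∫
r^{s+p-1} ψ(rx) dr over r > 0. Parseval's formula, dilate by dilate, shows that the Fourier
transform is the same kind of integral of ψ^, with exponent 2n - (s + p) = q + 2
(`isFourierTransform_radial`). Its integral over the circle of H^⊥ is therefore, in polar
coordinates, the plane integral of |u|^q ψ^(u), and on H^⊥ the function ψ^ is the planar Fourier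
transform of the section integral S of ψ (`circleInt_eq_integral`).

It remains to pass from S to A. The layer-cake formula gives S(u) = -∫ η'(t) t^{m-p} A(u/t) dt
(`sectionInt_weight_eq`), so a functional that is homogeneous under dilations takes on S its value
on A times a moment of η. For the functionals of both parts (q = 2d in the second) that moment is -∫
η'(t) t^s dt, which equals s after one integration by parts (`cutoffMoment_cutPow`). This is the
factor 2n - q - p - 2 in the denominators.

Part (1): S is a test function, so the planar formula for the Fourier transform of |u|^z
(`integral_norm_cpow_mul_eq`, by comparison with a Gaussian) evaluates |u|^{-z-2}/Γ(-z/2) on S for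
-2 < Re z < 0. The Fourier side is analytic for all Re z > -2. The identity theorem carries the
relation to z = q (`IsRegularizedAction.cutoffMoment_mul_eq`), and division by the moment constructs
the continuation (`exists_isRegularizedAction`). No smoothness of A is needed.

Part (2): A is C^{2d} near 0 (`contDiffAt_gaugeSection`). Away from x = 0 the density is smooth, and
polar coordinates with a smooth distance to the boundary apply; near x = 0 the section integral
solves a refinement equation under u ↦ 2u. Then Δ^d S(0) = s Δ^d A(0), because all dilates agree at
0, and Fourier inversion in the plane finishes the proof. -/

noncomputable section

namespace BusemannPetty

/-! ### Fourier transform of homogeneous functions through Mellin integrals. -/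

section Fourier

variable {V : Type*} [NormedAddCommGroup V] [InnerProductSpace ℝ V] [FiniteDimensional ℝ V]
  [MeasurableSpace V] [BorelSpace V]

/-- The Fourier transform `∫ f(x) e^{-i⟪x, ξ⟫} dx` of a function on a Euclidean space. -/
def angFourier (f : V → ℂ) (ξ : V) : ℂ :=
  ∫ x : V, Complex.exp (-(inner ℝ x ξ : ℝ) * Complex.I) * f x

lemma norm_cexp_neg_mul_I (t : ℝ) : ‖Complex.exp (-(t : ℂ) * Complex.I)‖ = 1 := by
  rw [← Complex.ofReal_neg, Complex.norm_exp_ofReal_mul_I]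

lemma angFourier_eq_fourier (f : V → ℂ) (ξ : V) :
    angFourier f ξ = FourierTransform.fourier f ((2 * Real.pi)⁻¹ • ξ) := by
  rw [angFourier, Real.fourier_eq']
  refine integral_congr_ae (.of_forall fun x => ?_)
  simp only [inner_smul_right, smul_eq_mul]
  congr 2
  have : (Real.pi : ℂ) ≠ 0 := by exact_mod_cast Real.pi_ne_zero
  push_cast
  field_simp

/-- The Fourier transform of a Schwartz function, as a Schwartz function. -/
def schwartzFourier (f : 𝓢(V, ℂ)) : 𝓢(V, ℂ) :=
  SchwartzMap.compCLMOfContinuousLinearEquiv ℝ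
    (ContinuousLinearEquiv.smulLeft
      (Units.mk0 ((2 * Real.pi)⁻¹ : ℝ) (by positivity)) : V ≃L[ℝ] V)
    (FourierTransform.fourier f)

lemma schwartzFourier_apply (f : 𝓢(V, ℂ)) (ξ : V) : schwartzFourier f ξ = angFourier f ξ := by
  rw [angFourier_eq_fourier]
  rw [← SchwartzMap.fourier_coe]
  rfl

lemma coe_schwartzFourier (f : 𝓢(V, ℂ)) : ⇑(schwartzFourier f) = angFourier f :=
  funext (schwartzFourier_apply f)

/-- Continuous, bounded and integrable. -/
structure IsTame (f : V → ℂ) : Prop where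
  continuous : Continuous f
  integrable : Integrable f
  bounded : ∃ C, ∀ x, ‖f x‖ ≤ C

lemma isTame_schwartz (f : 𝓢(V, ℂ)) : IsTame f where
  continuous := f.continuous
  integrable := f.integrable
  bounded := by
    obtain ⟨C, _, hC⟩ := f.decay 0 0
    exact ⟨C, fun x => by simpa using hC x⟩

lemma IsTame.comp_smul {f : V → ℂ} (hf : IsTame f) {r : ℝ} (hr : r ≠ 0) :
    IsTame fun x => f (r • x) where
  continuous := hf.continuous.comp (continuous_const_smul r)
  integrable := hf.integrable.comp_smul hr
  bounded := hf.bounded.imp fun _ h _ => h _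

lemma IsTame.integrable_mul {f g : V → ℂ} (hf : IsTame f) (hg : IsTame g) :
    Integrable fun x => f x * g x := by
  obtain ⟨C, hC⟩ := hf.bounded
  exact hg.integrable.bdd_mul hf.continuous.aestronglyMeasurable (.of_forall hC)

/-- The Fourier transform is self-adjoint. -/
lemma integral_mul_angFourier {f g : V → ℂ} (hf : IsTame f) (hg : IsTame g) :
    ∫ x, f x * angFourier g x = ∫ x, angFourier f x * g x := by
  have hint : Integrable (fun z : V × V =>
      Complex.exp (-(inner ℝ z.2 z.1 : ℝ) * Complex.I) * (f z.1 * g z.2)) := by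
    refine (hf.integrable.mul_prod hg.integrable).bdd_mul (c := 1) ?_ ?_
    · exact Continuous.aestronglyMeasurable (by fun_prop)
    · exact .of_forall fun z => (norm_cexp_neg_mul_I _).le
  have := integral_integral_swap (f := fun x y : V =>
      Complex.exp (-(inner ℝ y x : ℝ) * Complex.I) * (f x * g y)) hint
  refine Eq.trans ?_ (this.trans ?_)
  · refine integral_congr_ae (.of_forall fun x => ?_)
    simp only [angFourier]
    rw [← integral_const_mul]
    refine integral_congr_ae (.of_forall fun y => ?_)
    ring_nf
  · refine integral_congr_ae (.of_forall fun y => ?_)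
    simp only [angFourier]
    rw [← integral_mul_const]
    refine integral_congr_ae (.of_forall fun x => ?_)
    simp only [real_inner_comm x y]
    ring_nf

lemma angFourier_comp_smul (f : V → ℂ) {r : ℝ} (hr : 0 < r) (ξ : V) :
    angFourier (fun x => f (r • x)) ξ =
      ((r : ℂ) ^ (finrank ℝ V))⁻¹ * angFourier f (r⁻¹ • ξ) := by
  have := Measure.integral_comp_smul_of_nonneg (volume : Measure V) (fun x : V =>
    Complex.exp (-(inner ℝ x (r⁻¹ • ξ) : ℝ) * Complex.I) * f x) r (hR := hr.le)
  simp only [angFourier]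
  rw [show ((r : ℂ) ^ (finrank ℝ V))⁻¹ = (((r ^ finrank ℝ V)⁻¹ : ℝ) : ℂ) by push_cast; rfl,
    ← Complex.real_smul, ← this]
  refine integral_congr_ae (.of_forall fun x => ?_)
  simp only [inner_smul_left, inner_smul_right, RCLike.conj_to_real]
  rw [← mul_assoc, inv_mul_cancel₀ hr.ne', one_mul]

/-- The integral `∫_0^∞ r^{a-1} f(r x) dr`, homogeneous of degree `-a` in `x`. -/
def radial (f : V → ℂ) (a : ℂ) (x : V) : ℂ := mellin (fun r : ℝ => f (r • x)) a

/-- For r ≤ 1 the inner integral is bounded because f is bounded and g integrable; for r > 1 the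
roles are exchanged and the substitution x = ry gains a factor r^{-dim}. These two regimes are what
the two bounds on Re a serve. -/
lemma integrable_radial_prod {f g : V → ℂ} (hf : IsTame f) (hg : IsTame g) {a : ℂ}
    (ha : 0 < a.re) (ha' : a.re < finrank ℝ V) :
    Integrable (fun z : ℝ × V => (z.1 : ℂ) ^ (a - 1) * (f (z.1 • z.2) * g z.2))
      ((volume.restrict (Set.Ioi 0)).prod volume) := by
  have hm : AEStronglyMeasurable (fun z : ℝ × V => (z.1 : ℂ) ^ (a - 1) * (f (z.1 • z.2) * g z.2))
      ((volume.restrict (Set.Ioi 0)).prod volume) := by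
    refine AEStronglyMeasurable.mul ?_ ?_
    · refine Measurable.aestronglyMeasurable ?_
      exact (Complex.measurable_ofReal.comp measurable_fst).pow_const _
    · have := hf.continuous; have := hg.continuous
      exact Continuous.aestronglyMeasurable (by fun_prop)
  obtain ⟨Cf, hCf⟩ := hf.bounded
  obtain ⟨Cg, hCg⟩ := hg.bounded
  rw [integrable_prod_iff hm]
  constructor
  · filter_upwards [ae_restrict_mem measurableSet_Ioi] with r hr
    exact ((hf.comp_smul (ne_of_gt hr)).integrable_mul hg).const_mul _
  have hm2 := hm.norm.integral_prod_right'
  have hnorm : ∀ r : ℝ, 0 < r → ∀ y : V, ‖(r : ℂ) ^ (a - 1) * (f (r • y) * g y)‖ =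
      r ^ (a.re - 1) * (‖f (r • y)‖ * ‖g y‖) := by
    intro r hr y
    rw [norm_mul, norm_mul, Complex.norm_cpow_eq_rpow_re_of_pos hr]; simp
  have hsplit : Set.Ioi (0 : ℝ) = Set.Ioc 0 1 ∪ Set.Ioi 1 := by
    rw [Set.Ioc_union_Ioi_eq_Ioi zero_le_one]
  have h1 : IntegrableOn (fun r : ℝ => ∫ y : V, ‖(r : ℂ) ^ (a - 1) * (f (r • y) * g y)‖)
      (Set.Ioc 0 1) := by
    have hb : IntegrableOn (fun r : ℝ => r ^ (a.re - 1) * (Cf * ∫ y : V, ‖g y‖))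
        (Set.Ioc 0 1) := by
      refine Integrable.mul_const ?_ _
      have := (intervalIntegral.intervalIntegrable_rpow' (a := 0) (b := 1)
        (show -1 < a.re - 1 by linarith))
      rwa [intervalIntegrable_iff_integrableOn_Ioc_of_le zero_le_one] at this
    refine Integrable.mono' hb (hm2.mono_measure (Measure.restrict_mono_set _
      Set.Ioc_subset_Ioi_self)) ?_
    filter_upwards [ae_restrict_mem measurableSet_Ioc] with r hr
    rw [Real.norm_of_nonneg (integral_nonneg fun _ => norm_nonneg _)]
    simp_rw [hnorm r hr.1]
    rw [integral_const_mul]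
    refine mul_le_mul_of_nonneg_left ?_ (Real.rpow_nonneg hr.1.le _)
    rw [← integral_const_mul]
    refine integral_mono_of_nonneg (.of_forall fun y => by positivity)
      (hg.integrable.norm.const_mul _) (.of_forall fun y => ?_)
    exact mul_le_mul_of_nonneg_right (hCf _) (norm_nonneg _)
  have h2 : IntegrableOn (fun r : ℝ => ∫ y : V, ‖(r : ℂ) ^ (a - 1) * (f (r • y) * g y)‖)
      (Set.Ioi 1) := by
    have hb : IntegrableOn (fun r : ℝ => r ^ (a.re - 1 - finrank ℝ V) * (Cg * ∫ y : V, ‖f y‖))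
        (Set.Ioi 1) :=
      ((integrableOn_Ioi_rpow_of_lt (by linarith) one_pos)).mul_const _
    refine Integrable.mono' hb (hm2.mono_measure (Measure.restrict_mono_set _
      (Set.Ioi_subset_Ioi zero_le_one))) ?_
    filter_upwards [ae_restrict_mem measurableSet_Ioi] with r hr
    have hr0 : (0 : ℝ) < r := one_pos.trans hr
    rw [Real.norm_of_nonneg (integral_nonneg fun _ => norm_nonneg _)]
    simp_rw [hnorm r hr0]
    rw [integral_const_mul, Real.rpow_sub hr0 (a.re - 1), Real.rpow_natCast, div_eq_mul_inv, mul_assoc]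
    refine mul_le_mul_of_nonneg_left ?_ (Real.rpow_nonneg hr0.le _)
    have := Measure.integral_comp_smul_of_nonneg (volume : Measure V) (fun x : V => ‖f x‖) r (hR := hr0.le)
    rw [smul_eq_mul] at this
    rw [mul_left_comm, ← this, ← integral_const_mul]
    refine integral_mono_of_nonneg (.of_forall fun y => by positivity)
      (((hf.comp_smul hr0.ne').integrable.norm).const_mul _) (.of_forall fun y => ?_)
    simp only
    rw [mul_comm]
    exact mul_le_mul_of_nonneg_right (hCg _) (norm_nonneg _)
  rw [hsplit]
  exact h1.union h2

lemma integrable_radial_mul {f g : V → ℂ} (hf : IsTame f) (hg : IsTame g) {a : ℂ}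
    (ha : 0 < a.re) (ha' : a.re < finrank ℝ V) :
    Integrable fun x => radial f a x * g x := by
  refine (integrable_radial_prod hf hg ha ha').integral_prod_right.congr (.of_forall fun x => ?_)
  simp only [radial, mellin, smul_eq_mul]
  rw [← integral_mul_const]
  simp_rw [mul_assoc]

lemma integral_radial_mul {f g : V → ℂ} (hf : IsTame f) (hg : IsTame g) {a : ℂ}
    (ha : 0 < a.re) (ha' : a.re < finrank ℝ V) :
    ∫ x, radial f a x * g x = mellin (fun r : ℝ => ∫ x, f (r • x) * g x) a := by
  have := integral_integral_swap (f := fun (r : ℝ) (x : V) =>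
    (r : ℂ) ^ (a - 1) * (f (r • x) * g x)) (integrable_radial_prod hf hg ha ha')
  simp only [radial, mellin, smul_eq_mul]
  simp_rw [← integral_const_mul, this, ← integral_mul_const, mul_assoc]

/-- Parseval's formula for the homogeneous functions `radial f a`. -/
theorem integral_radial_mul_angFourier {f g : V → ℂ} (hf : IsTame f) (hg : IsTame g)
    (hf' : IsTame (angFourier f)) (hg' : IsTame (angFourier g)) {a : ℂ}
    (ha : 0 < a.re) (ha' : a.re < finrank ℝ V) :
    ∫ x, radial f a x * angFourier g x =
      ∫ x, radial (angFourier f) (finrank ℝ V - a) x * g x := by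
  rw [integral_radial_mul hf hg' ha ha',
    integral_radial_mul hf' hg (by simpa using ha') (by simpa using ha)]
  -- Moving the transform onto the dilate of f produces r^{-dim} f^(x/r); the substitution r ↦ 1/r
  -- in the Mellin integral then turns a into dim - a.
  have h : mellin (fun r : ℝ => ∫ x, f (r • x) * angFourier g x) a =
      mellin (fun r : ℝ => (r : ℂ) ^ (-(finrank ℝ V : ℂ)) •
        ((fun s : ℝ => ∫ x, angFourier f (s • x) * g x) r⁻¹)) a := by
    refine setIntegral_congr_fun measurableSet_Ioi fun r hr => ?_
    have hr : 0 < r := hr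
    simp only
    rw [integral_mul_angFourier (hf.comp_smul hr.ne') hg]
    simp_rw [angFourier_comp_smul f hr, mul_assoc]
    rw [integral_const_mul, Complex.cpow_neg, Complex.cpow_natCast, smul_eq_mul]
    simp only [smul_eq_mul]
  rw [h, mellin_cpow_smul, mellin_comp_inv (fun s : ℝ => ∫ x, angFourier f (s • x) * g x)]
  congr 1
  ring

-- Dominated convergence: near r = 0 boundedness of f suffices, near infinity the decay of order k >
-- Re a does, uniformly for x staying outside the ball of radius |x₀|/2.
omit [FiniteDimensional ℝ V] [MeasurableSpace V] [BorelSpace V] in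
lemma continuousOn_radial {f : V → ℂ} (hf : Continuous f) {a : ℂ} (ha : 0 < a.re) {k : ℕ}
    (hk : a.re < k) {C : ℝ} (hC : ∀ x, ‖f x‖ ≤ C) (hCk : ∀ x, ‖x‖ ^ k * ‖f x‖ ≤ C) :
    ContinuousOn (radial f a) {0}ᶜ := by
  intro x₀ hx₀
  have hx₀ : 0 < ‖x₀‖ := norm_pos_iff.2 hx₀
  have hC0 : 0 ≤ C := (norm_nonneg _).trans (hC 0)
  refine ContinuousAt.continuousWithinAt ?_
  set B : ℝ → ℝ := fun r =>
    (Set.Ioc 0 1).indicator (fun r => r ^ (a.re - 1) * C) r +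
      (Set.Ioi 1).indicator (fun r => r ^ (a.re - 1 - k) * (C / (‖x₀‖ / 2) ^ k)) r with hB
  refine continuousAt_of_dominated (bound := B) ?_ ?_ ?_ ?_
  · refine .of_forall fun x => ?_
    refine AEStronglyMeasurable.smul (f := fun r : ℝ => (r : ℂ) ^ (a - 1))
      (g := fun r => f (r • x)) ?_ ?_
    · exact (Complex.measurable_ofReal.pow_const _).aestronglyMeasurable
    · have : Continuous fun r : ℝ => r • x := continuous_id.smul continuous_const
      exact (hf.comp this).aestronglyMeasurable
  · have : ∀ᶠ x in nhds x₀, ‖x₀‖ / 2 < ‖x‖ :=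
      continuous_norm.continuousAt.eventually (lt_mem_nhds (by linarith))
    filter_upwards [this] with x hx
    filter_upwards [ae_restrict_mem measurableSet_Ioi] with r hr
    have hr : 0 < r := hr
    rw [norm_smul, Complex.norm_cpow_eq_rpow_re_of_pos hr]
    simp only [Complex.sub_re, Complex.one_re, hB]
    rcases le_or_gt r 1 with h | h
    · rw [Set.indicator_of_mem (show r ∈ Set.Ioc 0 1 from ⟨hr, h⟩),
        Set.indicator_of_notMem (by simpa using h), add_zero]
      exact mul_le_mul_of_nonneg_left (hC _) (by positivity)
    · rw [Set.indicator_of_notMem (by simp [h]), Set.indicator_of_mem (show r ∈ Set.Ioi 1 from h),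
        zero_add, Real.rpow_sub hr (a.re - 1), Real.rpow_natCast, div_mul_eq_mul_div, mul_div_assoc]
      refine mul_le_mul_of_nonneg_left ?_ (by positivity)
      rw [div_div, le_div_iff₀ (by positivity), mul_comm]
      refine le_trans ?_ (hCk (r • x))
      rw [norm_smul, Real.norm_of_nonneg hr.le, mul_pow, mul_comm (r ^ k)]
      gcongr
  · refine Integrable.add ?_ ?_
    · rw [integrable_indicator_iff measurableSet_Ioc]
      refine Integrable.mono_measure ?_ (Measure.restrict_mono le_rfl Measure.restrict_le_self)
      refine Integrable.mul_const ?_ _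
      have := (intervalIntegral.intervalIntegrable_rpow' (a := 0) (b := 1)
        (show -1 < a.re - 1 by linarith))
      rwa [intervalIntegrable_iff_integrableOn_Ioc_of_le zero_le_one] at this
    · rw [integrable_indicator_iff measurableSet_Ioi]
      refine Integrable.mono_measure ?_ (Measure.restrict_mono le_rfl Measure.restrict_le_self)
      exact ((integrableOn_Ioi_rpow_of_lt (by linarith) one_pos)).mul_const _
  · refine .of_forall fun r => ?_
    have : Continuous fun x : V => f (r • x) := hf.comp (continuous_const_smul r)
    have : Continuous fun x : V => (r : ℂ) ^ (a - 1) • f (r • x) := by fun_prop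
    exact this.continuousAt

omit [FiniteDimensional ℝ V] [MeasurableSpace V] [BorelSpace V] in
lemma continuousOn_radial_schwartz (f : 𝓢(V, ℂ)) {a : ℂ} (ha : 0 < a.re) :
    ContinuousOn (radial f a) {0}ᶜ := by
  obtain ⟨k, hk⟩ := exists_nat_gt a.re
  obtain ⟨C, _, hC⟩ := f.decay 0 0
  obtain ⟨C', _, hC'⟩ := f.decay k 0
  refine continuousOn_radial f.continuous ha hk (C := max C C') (fun x => ?_) fun x => ?_
  · exact le_max_of_le_left (by simpa using hC x)
  · exact le_max_of_le_right (by simpa using hC' x)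

end Fourier

/-! ### Smooth gauges, cutoff weights, and the reproducing bump. -/

section Gauge

variable {V : Type*} [NormedAddCommGroup V] [InnerProductSpace ℝ V]

/-- A gauge comparable to the norm that is smooth off the origin. -/
structure IsSmoothGauge (g : V → ℝ) : Prop where
  continuous : Continuous g
  pos : ∀ x, x ≠ 0 → 0 < g x
  smul : ∀ (t : ℝ) (x : V), 0 ≤ t → g (t • x) = t * g x
  add_le : ∀ x y, g (x + y) ≤ g x + g y
  contDiffOn : ContDiffOn ℝ ∞ g {0}ᶜ
  norm_le : ∃ R, 0 < R ∧ ∀ x, ‖x‖ ≤ R * g x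

lemma IsSmoothGauge.zero {g : V → ℝ} (hg : IsSmoothGauge g) : g 0 = 0 := by
  simpa using hg.smul 0 0 le_rfl

/-- A smooth function on the line vanishing outside `[a, b]`, where `0 < a`. -/
structure IsCutoff (η : ℝ → ℂ) (a b : ℝ) : Prop where
  contDiff : ContDiff ℝ ∞ η
  pos : 0 < a
  eq_zero : ∀ t, t ∉ Set.Icc a b → η t = 0

/-- The function `η(g(x)) |x|^{-p}`. -/
def weight (g : V → ℝ) (η : ℝ → ℂ) (p : ℝ) (x : V) : ℂ := η (g x) * ((‖x‖ ^ (-p) : ℝ) : ℂ)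

variable {g : V → ℝ} {η : ℝ → ℂ} {a b : ℝ}

lemma contDiff_of_eq_zero_of_lt (hg : IsSmoothGauge g) {f : V → ℂ} (hf : ContDiffOn ℝ ∞ f {0}ᶜ)
    (ha : 0 < a) (hfa : ∀ x, g x < a → f x = 0) : ContDiff ℝ ∞ f := by
  rw [contDiff_iff_contDiffAt]
  intro x
  rcases lt_or_ge (g x) a with h | h
  · have : f =ᶠ[nhds x] fun _ => 0 := by
      filter_upwards [hg.continuous.continuousAt.eventually (gt_mem_nhds h)] with y hy
      exact hfa y hy
    exact contDiffAt_const.congr_of_eventuallyEq this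
  · have hx : x ≠ 0 := by
      rintro rfl
      rw [hg.zero] at h
      linarith
    exact hf.contDiffAt (isOpen_compl_singleton.mem_nhds hx)

lemma contDiffOn_norm_rpow (p : ℝ) : ContDiffOn ℝ ∞ (fun x : V => ‖x‖ ^ (-p)) {0}ᶜ := by
  intro x hx
  have : ContDiffAt ℝ ∞ (fun x : V => ‖x‖) x := contDiffAt_norm ℝ hx
  exact (this.rpow_const_of_ne (norm_ne_zero_iff.2 hx)).contDiffWithinAt

lemma contDiffOn_weight (hg : IsSmoothGauge g) (hη : ContDiff ℝ ∞ η) (p : ℝ) :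
    ContDiffOn ℝ ∞ (weight g η p) {0}ᶜ := by
  refine ContDiffOn.mul (hη.comp_contDiffOn hg.contDiffOn) ?_
  exact Complex.ofRealCLM.contDiff.comp_contDiffOn (contDiffOn_norm_rpow p)

lemma contDiff_weight (hg : IsSmoothGauge g) (hη : IsCutoff η a b) (p : ℝ) :
    ContDiff ℝ ∞ (weight g η p) :=
  contDiff_of_eq_zero_of_lt hg (contDiffOn_weight hg hη.contDiff p) hη.pos fun x hx => by
    rw [weight, hη.eq_zero _ (fun h => (not_lt.2 h.1) hx), zero_mul]

lemma hasCompactSupport_weight [FiniteDimensional ℝ V] (hg : IsSmoothGauge g)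
    (hη : IsCutoff η a b) (p : ℝ) : HasCompactSupport (weight g η p) := by
  obtain ⟨R, hR, h⟩ := hg.norm_le
  have : ProperSpace V := FiniteDimensional.proper ℝ V
  refine HasCompactSupport.intro (isCompact_closedBall (0 : V) (R * b)) fun x hx => ?_
  rw [weight, hη.eq_zero _ (fun h' => hx ?_), zero_mul]
  rw [mem_closedBall_zero_iff]
  exact (h x).trans (mul_le_mul_of_nonneg_left h'.2 hR.le)

/-- `weight g η p` as a Schwartz function. -/
def weightSchwartz [FiniteDimensional ℝ V] (hg : IsSmoothGauge g) (hη : IsCutoff η a b) (p : ℝ) :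
    𝓢(V, ℂ) :=
  (hasCompactSupport_weight hg hη p).toSchwartzMap (contDiff_weight hg hη p)

lemma coe_weightSchwartz [FiniteDimensional ℝ V] (hg : IsSmoothGauge g) (hη : IsCutoff η a b)
    (p : ℝ) : ⇑(weightSchwartz hg hη p) = weight g η p := rfl

/-- The measure dt/t is dilation invariant, so this normalisation makes averages over dilates
reproduce homogeneous functions. -/
lemma exists_normalized_cutoff : ∃ κ : ℝ → ℝ, ContDiff ℝ ∞ κ ∧ (∀ t, t ∉ Set.Icc 1 2 → κ t = 0) ∧
    ∫ t in Set.Ioi (0 : ℝ), κ t / t = 1 := by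
  let f : ContDiffBump (3 / 2 : ℝ) := ⟨1 / 4, 1 / 2, by norm_num, by norm_num⟩
  have hf0 : ∀ t, t ∉ Set.Icc (1 : ℝ) 2 → f t = 0 := by
    intro t ht
    refine f.zero_of_le_dist ?_
    simp only [f, Real.dist_eq]
    by_contra! h
    rw [abs_lt] at h
    exact ht ⟨by linarith, by linarith⟩
  have hsupp : Function.support (fun t : ℝ => f t / t) ⊆ Set.Ioi 0 := by
    intro t ht
    by_contra h
    refine ht ?_
    simp only
    rw [hf0 t fun h' => h (one_pos.trans_le h'.1), zero_div]
  have hpos : 0 < ∫ t in Set.Ioi (0 : ℝ), f t / t := by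
    rw [setIntegral_eq_integral_of_forall_compl_eq_zero
      fun t ht => Function.notMem_support.1 fun h => ht (hsupp h)]
    have hc : Continuous fun t : ℝ => f t / t := by
      rw [continuous_iff_continuousAt]
      intro t
      rcases lt_or_ge t 1 with h | h
      · have : (fun t : ℝ => f t / t) =ᶠ[nhds t] fun _ => 0 := by
          filter_upwards [gt_mem_nhds h] with s hs
          rw [hf0 s fun h' => (not_lt.2 h'.1) hs, zero_div]
        exact continuousAt_const.congr this.symm
      · exact f.continuous.continuousAt.div continuousAt_id (by simp; linarith)
    have hcs : HasCompactSupport fun t : ℝ => f t / t :=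
      HasCompactSupport.intro (isCompact_Icc (a := (1 : ℝ)) (b := 2)) fun t ht => by
        rw [hf0 t ht, zero_div]
    rw [integral_pos_iff_support_of_nonneg _ (hc.integrable_of_hasCompactSupport hcs)]
    · refine (hc.isOpen_support).measure_pos _ ⟨3 / 2, ?_⟩
      have : f (3 / 2 : ℝ) = 1 := f.one_of_mem_closedBall (by simp [f])
      simp [this]
    · intro t
      rcases le_or_gt t 0 with h | h
      · simp only [Pi.zero_apply]
        rw [hf0 t fun h' => by linarith [h'.1], zero_div]
      · exact div_nonneg f.nonneg h.le
  refine ⟨fun t => (∫ t in Set.Ioi (0 : ℝ), f t / t)⁻¹ * f t, contDiff_const.mul f.contDiff,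
    fun t ht => by simp [hf0 t ht], ?_⟩
  simp_rw [mul_div_assoc]
  rw [integral_const_mul, inv_mul_cancel₀ hpos.ne']

/-- The function `κ(t) t^w`. -/
def cutPow (κ : ℝ → ℝ) (w : ℂ) (t : ℝ) : ℂ := (κ t : ℂ) * (t : ℂ) ^ w

lemma contDiffOn_cpow_const (w : ℂ) : ContDiffOn ℝ ∞ (fun t : ℝ => (t : ℂ) ^ w) (Set.Ioi 0) := by
  have : Set.EqOn (fun t : ℝ => (t : ℂ) ^ w) (fun t : ℝ => Complex.exp ((Real.log t : ℝ) * w))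
      (Set.Ioi 0) := by
    intro t ht
    have ht : 0 < t := ht
    simp only
    rw [Complex.cpow_def_of_ne_zero (by exact_mod_cast ht.ne'), Complex.ofReal_log ht.le]
  refine ContDiffOn.congr ?_ this
  refine ContDiffOn.cexp ?_
  refine ContDiffOn.mul ?_ contDiffOn_const
  refine Complex.ofRealCLM.contDiff.comp_contDiffOn ?_
  exact Real.contDiffOn_log.mono fun t ht => ne_of_gt ht

lemma isCutoff_cutPow {κ : ℝ → ℝ} (hκ : ContDiff ℝ ∞ κ) (h0 : ∀ t, t ∉ Set.Icc 1 2 → κ t = 0)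
    (w : ℂ) : IsCutoff (cutPow κ w) 1 2 where
  pos := one_pos
  eq_zero t ht := by rw [cutPow, h0 t ht]; simp
  contDiff := by
    rw [contDiff_iff_contDiffAt]
    intro t
    rcases lt_or_ge t 1 with h | h
    · have : cutPow κ w =ᶠ[nhds t] fun _ => 0 := by
        filter_upwards [gt_mem_nhds h] with s hs
        rw [cutPow, h0 s fun h' => (not_lt.2 h'.1) hs]
        simp
      exact contDiffAt_const.congr_of_eventuallyEq this
    · refine ContDiffAt.mul ?_ ((contDiffOn_cpow_const w).contDiffAt
        (Ioi_mem_nhds (by linarith)))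
      exact (Complex.ofRealCLM.contDiff.comp hκ).contDiffAt

/-- Integration in polar form of a homogeneous function cut off by `κ(g)`. -/
lemma radial_weight_cutPow (hg : IsSmoothGauge g) {κ : ℝ → ℝ}
    (hκ : ∫ t in Set.Ioi (0 : ℝ), κ t / t = 1) (s p : ℝ) {x : V} (hx : x ≠ 0) :
    radial (weight g (cutPow κ (-s)) p) (s + p) x =
      ((g x ^ (-s) * ‖x‖ ^ (-p) : ℝ) : ℂ) := by
  have hgx := hg.pos x hx
  rw [radial, mellin]
  -- All powers of r cancel except dr/r, so the substitution t = r g(x) leaves ∫ κ(t) dt/t = 1.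
  have h : ∀ r ∈ Set.Ioi (0 : ℝ), (r : ℂ) ^ ((s : ℂ) + p - 1) • weight g (cutPow κ (-s)) p (r • x) =
      (((g x ^ (-s) * ‖x‖ ^ (-p)) * g x * (κ (r * g x) / (r * g x)) : ℝ) : ℂ) := by
    intro r hr
    have hr : 0 < r := hr
    rw [weight, cutPow, hg.smul r x hr.le, norm_smul, Real.norm_of_nonneg hr.le, smul_eq_mul,
      ← Complex.ofReal_neg, ← Complex.ofReal_cpow (by positivity), ← Complex.ofReal_add,
      ← Complex.ofReal_one, ← Complex.ofReal_sub, ← Complex.ofReal_cpow hr.le,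
      ← Complex.ofReal_mul, ← Complex.ofReal_mul, ← Complex.ofReal_mul]
    congr 1
    rw [Real.mul_rpow hr.le hgx.le, Real.mul_rpow hr.le (norm_nonneg _), Real.rpow_sub hr,
      Real.rpow_add hr, Real.rpow_neg hr.le, Real.rpow_neg hr.le, Real.rpow_one]
    have := (Real.rpow_pos_of_pos hr s).ne'
    have := (Real.rpow_pos_of_pos hr p).ne'
    field_simp
  rw [setIntegral_congr_fun measurableSet_Ioi h, integral_complex_ofReal]
  congr 1
  rw [integral_const_mul, integral_comp_mul_right_Ioi (fun t => κ t / t) 0 hgx, zero_mul, hκ]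
  simp only [smul_eq_mul]
  field_simp

end Gauge

/-! ### The gauge of D, and existence and uniqueness of the Fourier transform. -/

section Body

variable {N : ℕ}

lemma isSmoothGauge_gauge (D : ConvexBody (Euc N)) (hD_int : (interior (D : Set (Euc N))).Nonempty)
    (hD_symm : ∀ x ∈ D, -x ∈ D) (hD_smooth : IsInfinitelySmooth D) :
    IsSmoothGauge (gauge (D : Set (Euc N))) := by
  have h0 : (D : Set (Euc N)) ∈ nhds 0 := by
    obtain ⟨x, hx⟩ := hD_int
    have hx' : -x ∈ (D : Set (Euc N)) := hD_symm x (interior_subset hx)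
    -- The origin is the midpoint of an interior point and its reflection, hence interior.
    have := D.convex.combo_interior_self_mem_interior hx hx'
      (a := 1 / 2) (b := 1 / 2) (by norm_num) (by norm_num) (by norm_num)
    rw [smul_neg, add_neg_cancel] at this
    exact mem_interior_iff_mem_nhds.1 this
  have ha : Absorbent ℝ (D : Set (Euc N)) := absorbent_nhds_zero h0
  refine ⟨continuous_gauge D.convex h0, fun x hx => ?_, fun t x ht => ?_,
    gauge_add_le D.convex ha, hD_smooth, ?_⟩
  · exact (gauge_pos ha ((NormedSpace.isVonNBounded_iff ℝ).2 D.isCompact.isBounded)).2 hx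
  · rw [gauge_smul_of_nonneg ht, smul_eq_mul]
  · obtain ⟨R, hR, h⟩ := D.isCompact.isBounded.exists_pos_norm_le
    refine ⟨R, hR, fun x => ?_⟩
    have := le_gauge_of_subset_closedBall (x := x) ha hR.le fun y hy => by
      simpa using h y hy
    rwa [div_le_iff₀ hR, mul_comm] at this

lemma gauge_le_one_iff (D : ConvexBody (Euc N)) (hD_int : (interior (D : Set (Euc N))).Nonempty)
    (hD_symm : ∀ x ∈ D, -x ∈ D) (x : Euc N) : gauge (D : Set (Euc N)) x ≤ 1 ↔ x ∈ D := by
  have h0 : (D : Set (Euc N)) ∈ nhds 0 := by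
    obtain ⟨x, hx⟩ := hD_int
    have hx' : -x ∈ (D : Set (Euc N)) := hD_symm x (interior_subset hx)
    have := D.convex.combo_interior_self_mem_interior hx hx'
      (a := 1 / 2) (b := 1 / 2) (by norm_num) (by norm_num) (by norm_num)
    rw [smul_neg, add_neg_cancel] at this
    exact mem_interior_iff_mem_nhds.1 this
  rw [gauge_le_one_iff_mem_closure D.convex h0, D.isCompact.isClosed.closure_eq]
  rfl

/-- The Fourier transform of `g^{-s} |x|^{-p}` as a homogeneous function. -/
theorem isFourierTransform_radial {f : Euc N → ℝ} {g : Euc N → ℝ} (hg : IsSmoothGauge g)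
    {κ : ℝ → ℝ} (hκ : ContDiff ℝ ∞ κ) (h0 : ∀ t, t ∉ Set.Icc 1 2 → κ t = 0)
    (h1 : ∫ t in Set.Ioi (0 : ℝ), κ t / t = 1) {s p : ℝ} (hs : 0 < s + p) (hs' : s + p < N)
    (hf : ∀ x, f x = g x ^ (-s) * ‖x‖ ^ (-p)) :
    IsFourierTransform f
      (radial (angFourier (weight g (cutPow κ (-s)) p)) (N - (s + p))) := by
  have : NeZero N := ⟨by
    rintro rfl
    rw [Nat.cast_zero] at hs'
    linarith⟩
  set ψ := weightSchwartz hg (isCutoff_cutPow hκ h0 (-s)) p with hψ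
  have hN : finrank ℝ (Euc N) = N := finrank_euclideanSpace_fin
  have hae : ∀ᵐ x : Euc N, radial ψ (s + p) x = (f x : ℂ) := by
    filter_upwards [compl_mem_ae_iff.2 (measure_singleton (0 : Euc N))] with x hx
    rw [hf, hψ, coe_weightSchwartz, radial_weight_cutPow hg h1 s p hx]
  have hFT : angFourier (weight g (cutPow κ (-s)) p) = ⇑(schwartzFourier ψ) := by
    rw [coe_schwartzFourier, hψ, coe_weightSchwartz]
  have hre : ((s : ℂ) + p).re = s + p := by simp
  have hre' : ((N : ℂ) - (s + p)).re = N - (s + p) := by simp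
  refine ⟨?_, fun φ => ?_, fun φ => ?_, fun φ => ?_⟩
  · rw [hFT]
    exact continuousOn_radial_schwartz _ (by rw [hre']; linarith)
  · refine (integrable_radial_mul (isTame_schwartz ψ) (isTame_schwartz (schwartzFourier φ))
      (a := s + p) (by rw [hre]; exact hs) (by rw [hre, hN]; exact hs')).congr ?_
    filter_upwards [hae] with x hx
    rw [hx, schwartzFourier_apply]
    rfl
  · rw [hFT]
    exact integrable_radial_mul (isTame_schwartz _) (isTame_schwartz φ)
      (by rw [hre']; linarith) (by rw [hre', hN]; linarith)
  · have := integral_radial_mul_angFourier (isTame_schwartz ψ) (isTame_schwartz φ)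
      (coe_schwartzFourier ψ ▸ isTame_schwartz _) (coe_schwartzFourier φ ▸ isTame_schwartz _)
      (a := s + p) (by rw [hre]; exact hs) (by rw [hre, hN]; exact hs')
    rw [hN] at this
    rw [hFT, coe_schwartzFourier, ← this]
    refine integral_congr_ae ?_
    filter_upwards [hae] with x hx
    rw [hx]
    rfl

/-- The Fourier transform is determined off the origin. -/
theorem IsFourierTransform.eqOn {f : Euc N → ℝ} {F₁ F₂ : Euc N → ℂ}
    (h₁ : IsFourierTransform f F₁) (h₂ : IsFourierTransform f F₂) : Set.EqOn F₁ F₂ {0}ᶜ := by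
  have hU : IsOpen ({0}ᶜ : Set (Euc N)) := isOpen_compl_singleton
  have hc := h₁.continuousOn.sub h₂.continuousOn
  have := hU.ae_eq_zero_of_integral_contDiff_smul_eq_zero (μ := volume)
    (hc.locallyIntegrableOn hU.measurableSet) fun φ hφ hφc _ => by
      set ψ : 𝓢(Euc N, ℂ) := HasCompactSupport.toSchwartzMap (f := fun x => (φ x : ℂ))
        (hφc.comp_left Complex.ofReal_zero) (Complex.ofRealCLM.contDiff.comp hφ) with hψ
      have h := (h₁.eq ψ).symm.trans (h₂.eq ψ)
      rw [← sub_eq_zero, ← integral_sub (h₁.integrable_right ψ) (h₂.integrable_right ψ)] at h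
      rw [← h]
      refine integral_congr_ae (.of_forall fun x => ?_)
      simp only [Complex.real_smul, ← sub_mul]
      rw [mul_comm]
      rfl
  refine Measure.eqOn_open_of_ae_eq (μ := volume) ?_ hU h₁.continuousOn h₂.continuousOn
  rw [Filter.EventuallyEq, ae_restrict_iff' hU.measurableSet]
  filter_upwards [this] with x hx hx'
  exact sub_eq_zero.1 (hx hx')

end Body

/-! ### Smooth dependence of integrals on a parameter. -/

section Parametric

variable {P V F : Type*} [NormedAddCommGroup P] [NormedSpace ℝ P]
  [NormedAddCommGroup V] [NormedSpace ℝ V] [MeasurableSpace V] [BorelSpace V]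
  [NormedAddCommGroup F] [NormedSpace ℝ F]

/-- Smoothness of an integral depending on a parameter. -/
theorem contDiffOn_integral_smul {μ : Measure V} {f : V → ℝ} {n : ℕ∞} {g : P → V → F} {s : Set P}
    {K : Set V} (hs : IsOpen s) (hK : IsCompact K) (hgK : ∀ p ∈ s, ∀ x, x ∉ K → g p x = 0)
    (hf : LocallyIntegrable f μ) (hg : ContDiffOn ℝ n (fun z : P × V => g z.1 z.2) (s ×ˢ Set.univ)) :
    ContDiffOn ℝ n (fun p => ∫ x, f x • g p x ∂μ) s := by
  -- The integral is the convolution of f with the reflected g(p, ·), evaluated at 0.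
  have h := contDiffOn_convolution_right_with_param (μ := μ) (f := f) (n := n)
    (ContinuousLinearMap.lsmul ℝ ℝ : ℝ →L[ℝ] F →L[ℝ] F) (g := fun p x => g p (-x)) (s := s)
    (k := -K) hs hK.neg (fun p x hp hx => hgK p hp _ fun h => hx (by simpa using h)) hf
    (hg.comp (g := fun z : P × V => g z.1 z.2) (f := fun z : P × V => (z.1, -z.2))
      (by fun_prop) fun z hz => ⟨hz.1, trivial⟩)
  have h2 := h.comp (f := fun p : P => (p, (0 : V))) (s := s) (by fun_prop) fun p hp => ⟨hp, trivial⟩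
  refine h2.congr fun p hp => ?_
  simp [convolution]

end Parametric

/-! ### Integrability of powers of the norm. -/

section PowerIntegrability

variable {V : Type*} [NormedAddCommGroup V] [InnerProductSpace ℝ V] [FiniteDimensional ℝ V]
  [MeasurableSpace V] [BorelSpace V]

lemma integrableOn_norm_rpow_ball [Nontrivial V] {s : ℝ} (hs : -(finrank ℝ V : ℝ) < s) (R : ℝ) :
    IntegrableOn (fun x : V => ‖x‖ ^ s) (Metric.ball 0 R) := by
  rcases le_or_gt R 0 with hR | hR
  · rw [Metric.ball_eq_empty.2 hR]
    exact integrableOn_empty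
  rw [integrableOn_fun_norm_addHaar volume (f := fun y : ℝ => y ^ s)]
  have hpos : 0 < finrank ℝ V := finrank_pos
  have h := (intervalIntegral.intervalIntegrable_rpow' (a := 0) (b := R)
    (r := s + finrank ℝ V - 1) (by linarith))
  rw [intervalIntegrable_iff_integrableOn_Ioo_of_le hR.le] at h
  refine h.congr_fun (fun y hy => ?_) measurableSet_Ioo
  simp only [smul_eq_mul]
  rw [← Real.rpow_natCast, ← Real.rpow_add hy.1, Nat.cast_sub hpos]
  congr 1
  push_cast
  ring

lemma integrable_norm_rpow_mul_schwartz [Nontrivial V] {s : ℝ} (hs : -(finrank ℝ V : ℝ) < s)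
    (φ : 𝓢(V, ℂ)) : Integrable fun x => ‖x‖ ^ s * ‖φ x‖ := by
  obtain ⟨C, hC⟩ := (isTame_schwartz φ).bounded
  obtain ⟨k, hk⟩ := exists_nat_gt s
  have hm : AEStronglyMeasurable (fun x : V => ‖x‖ ^ s * ‖φ x‖) volume :=
    (measurable_norm.pow_const s).aestronglyMeasurable.mul
      φ.continuous.norm.aestronglyMeasurable
  have hb : Integrable fun x : V =>
      (Metric.ball (0 : V) 1).indicator (fun x : V => ‖x‖ ^ s * C) x + ‖x‖ ^ k * ‖φ x‖ := by
    refine Integrable.add ?_ (φ.integrable_pow_mul volume k)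
    rw [integrable_indicator_iff measurableSet_ball]
    exact (integrableOn_norm_rpow_ball hs 1).mul_const C
  refine hb.mono' hm (.of_forall fun x => ?_)
  rw [Real.norm_of_nonneg (by positivity)]
  rcases lt_or_ge ‖x‖ 1 with h | h
  · rw [Set.indicator_of_mem (by simpa using h)]
    have : ‖x‖ ^ s * ‖φ x‖ ≤ ‖x‖ ^ s * C := mul_le_mul_of_nonneg_left (hC x) (by positivity)
    have : 0 ≤ ‖x‖ ^ k * ‖φ x‖ := by positivity
    linarith
  · rw [Set.indicator_of_notMem (by simpa using h), zero_add]
    refine mul_le_mul_of_nonneg_right ?_ (norm_nonneg _)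
    rw [← Real.rpow_natCast]
    exact Real.rpow_le_rpow_of_exponent_le h hk.le

omit [InnerProductSpace ℝ V] [FiniteDimensional ℝ V] in
lemma measurable_norm_cpow (z : ℂ) : Measurable fun x : V => (‖x‖ : ℂ) ^ z :=
  (Complex.measurable_ofReal.comp measurable_norm).pow_const z

lemma integrable_norm_cpow_mul_iff [Nontrivial V] {f : V → ℂ} (hf : AEStronglyMeasurable f volume)
    (z : ℂ) : Integrable (fun x => (‖x‖ : ℂ) ^ z * f x) ↔
      Integrable (fun x => ‖x‖ ^ z.re * ‖f x‖) := by
  have hm : AEStronglyMeasurable (fun x : V => (‖x‖ : ℂ) ^ z * f x) volume :=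
    (measurable_norm_cpow z).aestronglyMeasurable.mul hf
  rw [← integrable_norm_iff hm]
  refine integrable_congr ?_
  filter_upwards [compl_mem_ae_iff.2 (measure_singleton (0 : V))] with x hx
  rw [norm_mul, Complex.norm_cpow_eq_rpow_re_of_pos (norm_pos_iff.2 hx)]

lemma integrable_norm_cpow_mul_schwartz [Nontrivial V] {z : ℂ} (hz : -(finrank ℝ V : ℝ) < z.re)
    (φ : 𝓢(V, ℂ)) : Integrable fun x => (‖x‖ : ℂ) ^ z * φ x :=
  (integrable_norm_cpow_mul_iff φ.continuous.aestronglyMeasurable z).2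
    (integrable_norm_rpow_mul_schwartz hz φ)

end PowerIntegrability

/-! ### Fourier transform of powers of the norm in the plane. -/

section Riesz

/-- The standard Gaussian on the plane. -/
def gaussian (x : Euc 2) : ℂ := Complex.exp (-(1 / 2 : ℂ) * ‖x‖ ^ 2)

lemma isTame_gaussian : IsTame gaussian where
  continuous := by unfold gaussian; fun_prop
  integrable := by
    unfold gaussian
    simpa using
      GaussianFourier.integrable_cexp_neg_mul_sq_norm_add (V := Euc 2) (b := 1 / 2) (by norm_num) 0 0
  bounded := by
    refine ⟨1, fun x => ?_⟩
    have : (-(1 / 2 : ℂ) * ‖x‖ ^ 2) = ((-(1 / 2) * ‖x‖ ^ 2 : ℝ) : ℂ) := by push_cast; rfl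
    rw [gaussian, this, Complex.norm_exp_ofReal, Real.exp_le_one_iff]
    nlinarith [sq_nonneg ‖x‖]

lemma angFourier_gaussian : angFourier gaussian = fun x => 2 * Real.pi * gaussian x := by
  funext x
  have := fourier_gaussian_innerProductSpace (V := Euc 2) (b := 1 / 2) (by norm_num)
    ((2 * Real.pi)⁻¹ • x)
  have hpi : (Real.pi : ℂ) ≠ 0 := by exact_mod_cast Real.pi_ne_zero
  rw [angFourier_eq_fourier]
  refine this.trans ?_
  rw [finrank_euclideanSpace_fin, norm_smul, gaussian, Real.norm_of_nonneg (by positivity)]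
  congr 1
  · norm_num
    ring
  · congr 1
    push_cast
    field_simp

/-- The substitution t = r² turns the Mellin integral into Euler's integral for Γ. Hence powers of
the norm are Mellin integrals of a Gaussian, and Parseval's formula applies to them. -/
lemma radial_gaussian {a : ℂ} (ha : 0 < a.re) {x : Euc 2} (hx : x ≠ 0) :
    radial gaussian a x = 2 ^ (a / 2 - 1) * Complex.Gamma (a / 2) * (‖x‖ : ℂ) ^ (-a) := by
  have hx' : 0 < ‖x‖ := norm_pos_iff.2 hx
  have h1 : ∀ r ∈ Set.Ioi (0 : ℝ), (r : ℂ) ^ (a - 1) • gaussian (r • x) =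
      (r : ℂ) ^ (a - 1) • (fun t : ℝ => Complex.exp (-((‖x‖ ^ 2 / 2 : ℝ) * t : ℂ))) (r ^ (2 : ℝ)) := by
    intro r hr
    have hr : 0 < r := hr
    simp only [gaussian, norm_smul, Real.norm_of_nonneg hr.le]
    congr 2
    rw [Real.rpow_two]
    push_cast
    ring
  rw [radial, mellin, setIntegral_congr_fun measurableSet_Ioi h1]
  change mellin (fun r : ℝ =>
    (fun t : ℝ => Complex.exp (-((‖x‖ ^ 2 / 2 : ℝ) * t : ℂ))) (r ^ (2 : ℝ))) a = _
  rw [mellin_comp_rpow (fun t : ℝ => Complex.exp (-((‖x‖ ^ 2 / 2 : ℝ) * t : ℂ)))]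
  have h2 : mellin (fun t : ℝ => Complex.exp (-((‖x‖ ^ 2 / 2 : ℝ) * t : ℂ))) (a / (2 : ℝ)) =
      (1 / (‖x‖ ^ 2 / 2 : ℝ) : ℂ) ^ (a / 2) * Complex.Gamma (a / 2) := by
    have := Complex.integral_cpow_mul_exp_neg_mul_Ioi (a := a / 2) (r := ‖x‖ ^ 2 / 2)
      (by simpa using ha) (by positivity)
    rw [← this, mellin]
    simp
  rw [h2]
  have h3 : (1 / (‖x‖ ^ 2 / 2 : ℝ) : ℂ) ^ (a / 2) = 2 ^ (a / 2) * (‖x‖ : ℂ) ^ (-a) := by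
    have e1 : (1 / (‖x‖ ^ 2 / 2 : ℝ) : ℂ) = ((2 : ℝ) : ℂ) * ((‖x‖ ^ (-2 : ℝ) : ℝ) : ℂ) := by
      rw [Real.rpow_neg hx'.le, Real.rpow_two]
      push_cast
      field_simp
    rw [e1, Complex.mul_cpow_ofReal_nonneg (by norm_num) (by positivity),
      Complex.ofReal_cpow hx'.le, ← Complex.cpow_mul]
    · push_cast
      congr 2
      ring
    · rw [← Complex.ofReal_log hx'.le, ← Complex.ofReal_mul, Complex.ofReal_im]
      linarith [Real.pi_pos]
    · rw [← Complex.ofReal_log hx'.le, ← Complex.ofReal_mul, Complex.ofReal_im]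
      exact Real.pi_pos.le
  rw [h3, Complex.cpow_sub _ _ two_ne_zero, Complex.cpow_one, Complex.real_smul]
  norm_num
  ring

/-- The Fourier transform of a power of the norm in the plane. -/
theorem integral_norm_cpow_mul_eq (φ : 𝓢(Euc 2, ℂ)) {z : ℂ} (hz : -2 < z.re) (hz' : z.re < 0) :
    (Complex.Gamma (-z / 2))⁻¹ * ∫ u, (‖u‖ : ℂ) ^ (-z - 2) * φ u =
      2 ^ (-z - 2) / (Real.pi * Complex.Gamma ((z + 2) / 2)) *
        ∫ u, (‖u‖ : ℂ) ^ z * angFourier φ u := by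
  have hfr : finrank ℝ (Euc 2) = 2 := finrank_euclideanSpace_fin
  have h := integral_radial_mul_angFourier isTame_gaussian (isTame_schwartz φ)
    (by rw [angFourier_gaussian]; exact
      ⟨continuous_const.mul isTame_gaussian.continuous, isTame_gaussian.integrable.const_mul _,
        by
          obtain ⟨C, hC⟩ := isTame_gaussian.bounded
          refine ⟨‖(2 * Real.pi : ℂ)‖ * C, fun x => ?_⟩
          rw [norm_mul]
          exact mul_le_mul_of_nonneg_left (hC x) (norm_nonneg _)⟩)
    (coe_schwartzFourier φ ▸ isTame_schwartz _) (a := -z) (by simpa using hz')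
    (by rw [hfr]; simp; linarith)
  have hae : ∀ᵐ x : Euc 2, x ≠ 0 := compl_mem_ae_iff.2 (measure_singleton (0 : Euc 2))
  have hL : ∫ x, radial gaussian (-z) x * angFourier φ x =
      2 ^ (-z / 2 - 1) * Complex.Gamma (-z / 2) * ∫ u, (‖u‖ : ℂ) ^ z * angFourier φ u := by
    rw [← integral_const_mul]
    refine integral_congr_ae ?_
    filter_upwards [hae] with x hx
    rw [radial_gaussian (by simpa using hz') hx, neg_neg, mul_assoc]
  have hR : ∫ x, radial (angFourier gaussian) (finrank ℝ (Euc 2) - -z) x * φ x =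
      2 * Real.pi * (2 ^ ((z + 2) / 2 - 1) * Complex.Gamma ((z + 2) / 2)) *
        ∫ u, (‖u‖ : ℂ) ^ (-z - 2) * φ u := by
    rw [← integral_const_mul]
    refine integral_congr_ae ?_
    filter_upwards [hae] with x hx
    have : radial (angFourier gaussian) (finrank ℝ (Euc 2) - -z) x =
        2 * Real.pi * radial gaussian (z + 2) x := by
      rw [hfr, angFourier_gaussian, radial, radial, mellin, mellin, ← integral_const_mul]
      refine integral_congr_ae (.of_forall fun r => ?_)
      simp only [smul_eq_mul]
      push_cast
      rw [show (2 - -z : ℂ) - 1 = z + 2 - 1 by ring]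
      ring
    rw [this, radial_gaussian (by simp; linarith) hx, show -(z + 2) = -z - 2 by ring]
    ring
  rw [hL, hR] at h
  have hG1 : Complex.Gamma (-z / 2) ≠ 0 := Complex.Gamma_ne_zero_of_re_pos (by simp; linarith)
  have hG2 : Complex.Gamma ((z + 2) / 2) ≠ 0 :=
    Complex.Gamma_ne_zero_of_re_pos (by simp; linarith)
  have hpi : (Real.pi : ℂ) ≠ 0 := by exact_mod_cast Real.pi_ne_zero
  have e1 : (2 : ℂ) ^ (-z / 2 - 1) = 2 ^ (-z - 2) * (2 * 2 ^ ((z + 2) / 2 - 1)) := by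
    rw [show -z / 2 - 1 = (-z - 2) + (1 + ((z + 2) / 2 - 1)) by ring,
      Complex.cpow_add _ _ two_ne_zero, Complex.cpow_add _ _ two_ne_zero, Complex.cpow_one]
  have hne : (2 : ℂ) ^ ((z + 2) / 2 - 1) ≠ 0 := by
    rw [Complex.cpow_def_of_ne_zero two_ne_zero]; exact Complex.exp_ne_zero _
  rw [e1] at h
  set I₁ := ∫ u, (‖u‖ : ℂ) ^ (-z - 2) * φ u
  set I₂ := ∫ u, (‖u‖ : ℂ) ^ z * angFourier φ u
  have h' : 2 ^ (-z - 2) * Complex.Gamma (-z / 2) * I₂ =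
      Real.pi * Complex.Gamma ((z + 2) / 2) * I₁ := by
    refine mul_left_cancel₀ (mul_ne_zero two_ne_zero hne) ?_
    linear_combination h
  generalize Complex.Gamma (-z / 2) = G₁ at *
  field_simp
  linear_combination -h'

end Riesz

/-! ### Splitting along H and H^⊥, section integrals, and the Fourier slice theorem. -/

section Section

variable {N : ℕ} {H : Submodule ℝ (Euc N)} (e : OrthonormalBasis (Fin 2) ℝ Hᗮ)

lemma planePoint_eq (u : Euc 2) : planePoint e u = (e.repr.symm u : Hᗮ) := by
  rw [← e.sum_repr_symm]
  simp [planePoint, Fin.sum_univ_two]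

/-- `planePoint e` as a linear isometry. -/
def planeIsometry : Euc 2 →ₗᵢ[ℝ] Euc N := Hᗮ.subtypeₗᵢ.comp e.repr.symm.toLinearIsometry

lemma planeIsometry_apply (u : Euc 2) : planeIsometry e u = planePoint e u :=
  (planePoint_eq e u).symm

lemma coe_planeIsometry : ⇑(planeIsometry e) = planePoint e := funext (planeIsometry_apply e)

lemma continuous_planePoint : Continuous (planePoint e) :=
  coe_planeIsometry e ▸ (planeIsometry e).continuous

lemma contDiff_planePoint {n : WithTop ℕ∞} : ContDiff ℝ n (planePoint e) :=
  coe_planeIsometry e ▸ (planeIsometry e).toContinuousLinearMap.contDiff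

lemma planePoint_smul (r : ℝ) (u : Euc 2) : planePoint e (r • u) = r • planePoint e u := by
  simp_rw [← planeIsometry_apply, map_smul]

lemma norm_planePoint (u : Euc 2) : ‖planePoint e u‖ = ‖u‖ := by
  rw [← planeIsometry_apply, (planeIsometry e).norm_map]

lemma inner_planePoint (u v : Euc 2) : inner ℝ (planePoint e u) (planePoint e v) = inner ℝ u v := by
  simp_rw [← planeIsometry_apply, (planeIsometry e).inner_map_map]

lemma inner_coe_planePoint (h : H) (u : Euc 2) : inner ℝ (h : Euc N) (planePoint e u) = 0 := by
  rw [planePoint_eq]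
  exact (e.repr.symm u).2 h h.2

lemma norm_add_planePoint_sq (h : H) (u : Euc 2) :
    ‖(h : Euc N) + planePoint e u‖ ^ 2 = ‖h‖ ^ 2 + ‖u‖ ^ 2 := by
  rw [norm_add_sq_real, inner_coe_planePoint, norm_planePoint]
  simp

lemma norm_le_norm_add_planePoint (h : H) (u : Euc 2) :
    ‖h‖ ≤ ‖(h : Euc N) + planePoint e u‖ := by
  refine le_of_sq_le_sq ?_ (norm_nonneg _)
  rw [norm_add_planePoint_sq]
  nlinarith [sq_nonneg ‖u‖]

lemma norm_le_norm_add_planePoint' (h : H) (u : Euc 2) :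
    ‖u‖ ≤ ‖(h : Euc N) + planePoint e u‖ := by
  refine le_of_sq_le_sq ?_ (norm_nonneg _)
  rw [norm_add_planePoint_sq]
  nlinarith [sq_nonneg ‖h‖]

/-- The splitting `H × ℝ² ≃ ℝ^N`. -/
def splitting : H × Euc 2 ≃ₜ Euc N :=
  ((Homeomorph.refl H).prodCongr e.repr.symm.toHomeomorph).trans
    ((WithLp.homeomorphProd 2 H Hᗮ).symm.trans H.orthogonalDecomposition.symm.toHomeomorph)

lemma splitting_apply (z : H × Euc 2) :
    splitting e z = (z.1 : Euc N) + planePoint e z.2 := by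
  rw [planePoint_eq]
  simp [splitting]
  rfl

lemma measurePreserving_splitting : MeasurePreserving (splitting e) := by
  have h1 : MeasurePreserving (Prod.map id e.repr.symm : H × Euc 2 → H × Hᗮ) :=
    (MeasurePreserving.id volume).prod e.repr.symm.measurePreserving
  exact H.orthogonalDecomposition.symm.measurePreserving.comp
    ((WithLp.volume_preserving_toLp H Hᗮ).comp h1)

/-- The integral of a function over the sections parallel to `H`. -/
def sectionInt (f : Euc N → ℂ) (u : Euc 2) : ℂ := ∫ h : H, f ((h : Euc N) + planePoint e u)

lemma integral_eq_integral_sectionInt {f : Euc N → ℂ} (hf : Integrable f) :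
    ∫ x, f x = ∫ u, sectionInt e f u := by
  have hmp := measurePreserving_splitting e
  have hme := (splitting e).measurableEmbedding
  rw [← hmp.integral_comp hme]
  have hi : Integrable (fun z => f (splitting e z)) := (hmp.integrable_comp_emb hme).2 hf
  refine (integral_prod_symm _ hi).trans ?_
  simp_rw [splitting_apply, sectionInt]

/-- Fourier slice theorem: for ξ in H^⊥ the exponential is constant along the sections, so Fubini
integrates f over them first. -/
lemma angFourier_planePoint {f : Euc N → ℂ} (hf : Integrable f) (u : Euc 2) :
    angFourier f (planePoint e u) = angFourier (sectionInt e f) u := by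
  rw [angFourier, integral_eq_integral_sectionInt e, angFourier]
  · refine integral_congr_ae (.of_forall fun v => ?_)
    simp only [sectionInt]
    rw [← integral_const_mul]
    refine integral_congr_ae (.of_forall fun h => ?_)
    simp only [inner_add_left, inner_coe_planePoint, inner_planePoint, zero_add]
  · refine hf.bdd_mul (c := 1) ?_ (.of_forall fun x => (norm_cexp_neg_mul_I _).le)
    exact Continuous.aestronglyMeasurable (by fun_prop)

lemma contDiff_sectionInt {f : Euc N → ℂ} (hf : ContDiff ℝ ∞ f) (hc : HasCompactSupport f) :
    ContDiff ℝ ∞ (sectionInt e f) := by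
  obtain ⟨R, hR⟩ := hc.isCompact.isBounded.subset_closedBall (0 : Euc N)
  rw [← contDiffOn_univ]
  have := contDiffOn_integral_smul (μ := (volume : Measure H)) (f := fun _ => 1) (n := ⊤)
    (g := fun (u : Euc 2) (h : H) => f ((h : Euc N) + planePoint e u)) (s := Set.univ)
    (K := Metric.closedBall 0 R) isOpen_univ (isCompact_closedBall _ _) ?_
    (locallyIntegrable_const _) ?_
  · simpa [sectionInt] using! this
  · intro u _ h hh
    by_contra hne
    have := hR (subset_tsupport f (Function.mem_support.2 hne))
    rw [mem_closedBall_zero_iff] at this hh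
    exact hh ((norm_le_norm_add_planePoint e h u).trans this)
  · rw [Set.univ_prod_univ, contDiffOn_univ]
    refine hf.comp ?_
    exact (H.subtypeL.contDiff.comp contDiff_snd).add ((contDiff_planePoint e).comp contDiff_fst)

lemma hasCompactSupport_sectionInt {f : Euc N → ℂ} (hc : HasCompactSupport f) :
    HasCompactSupport (sectionInt e f) := by
  obtain ⟨R, hR⟩ := hc.isCompact.isBounded.subset_closedBall (0 : Euc N)
  refine HasCompactSupport.intro (isCompact_closedBall (0 : Euc 2) R) fun u hu => ?_
  rw [sectionInt]
  refine integral_eq_zero_of_ae (.of_forall fun h => ?_)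
  by_contra hne
  have := hR (subset_tsupport f (Function.mem_support.2 hne))
  rw [mem_closedBall_zero_iff] at this hu
  exact hu ((norm_le_norm_add_planePoint' e h u).trans this)

/-- `sectionInt e f` as a Schwartz function. -/
def sectionSchwartz {f : Euc N → ℂ} (hf : ContDiff ℝ ∞ f) (hc : HasCompactSupport f) :
    𝓢(Euc 2, ℂ) :=
  (hasCompactSupport_sectionInt e hc).toSchwartzMap (contDiff_sectionInt e hf hc)

lemma coe_sectionSchwartz {f : Euc N → ℂ} (hf : ContDiff ℝ ∞ f) (hc : HasCompactSupport f) :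
    ⇑(sectionSchwartz e hf hc) = sectionInt e f := rfl

lemma integral_eq_polar {f : Euc 2 → ℂ} (hf : Integrable f) :
    ∫ u, f u = ∫ t in (0 : ℝ)..(2 * Real.pi), ∫ r in Set.Ioi (0 : ℝ),
      (r : ℂ) * f (r • !₂[Real.cos t, Real.sin t]) := by
  have hm2 : MeasurePreserving (fun z : ℝ × ℝ => (!₂[z.1, z.2] : Euc 2)) := by
    have := (PiLp.volume_preserving_toLp (Fin 2)).comp (volume_preserving_finTwoArrow ℝ).symm
    exact this
  have hme : MeasurableEmbedding (fun z : ℝ × ℝ => (!₂[z.1, z.2] : Euc 2)) :=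
    ((MeasurableEquiv.finTwoArrow (α := ℝ)).symm.trans
      (MeasurableEquiv.toLp 2 (Fin 2 → ℝ))).measurableEmbedding
  set w : ℝ × ℝ → ℂ := fun z => f !₂[z.1, z.2] with hw
  have hwi : Integrable w := (hm2.integrable_comp_emb hme).2 hf
  have hmul : ∀ r t : ℝ, (!₂[r * Real.cos t, r * Real.sin t] : Euc 2) =
      r • !₂[Real.cos t, Real.sin t] := by
    intro r t
    ext i
    fin_cases i <;> simp
  rw [← hm2.integral_comp hme]
  change ∫ z, w z = _
  rw [← integral_comp_polarCoord_symm]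
  have hint : IntegrableOn (fun z : ℝ × ℝ => z.1 • w (polarCoord.symm z)) polarCoord.target := by
    have h1 := (integrableOn_image_iff_integrableOn_abs_det_fderiv_smul volume
      polarCoord.open_target.measurableSet
      (fun z _ => (hasFDerivAt_polarCoord_symm z).hasFDerivWithinAt)
      polarCoord.symm.injOn w).1 hwi.integrableOn
    refine h1.congr_fun (fun z hz => ?_) polarCoord.open_target.measurableSet
    simp only [det_fderivPolarCoordSymm]
    rw [abs_of_pos hz.1]
  have hT : polarCoord.target = Set.Ioi (0 : ℝ) ×ˢ Set.Ioo (-Real.pi) Real.pi := rfl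
  rw [hT] at hint ⊢
  rw [IntegrableOn, Measure.volume_eq_prod, ← Measure.prod_restrict] at hint
  rw [Measure.volume_eq_prod, ← Measure.prod_restrict, integral_prod_symm _ hint]
  set J : ℝ → ℂ := fun t => ∫ r in Set.Ioi (0 : ℝ), (r : ℂ) * f (r • !₂[Real.cos t, Real.sin t])
    with hJ
  -- `polarCoord` takes angles in (-π, π); periodicity moves the interval to [0, 2π].
  have hper : Function.Periodic J (2 * Real.pi) := by
    intro t
    simp only [hJ, Real.cos_add_two_pi, Real.sin_add_two_pi]
  have h3 := hper.intervalIntegral_add_eq (-Real.pi) 0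
  rw [zero_add, show -Real.pi + 2 * Real.pi = Real.pi by ring] at h3
  rw [← h3, intervalIntegral.integral_of_le (by linarith [Real.pi_pos]),
    integral_Ioc_eq_integral_Ioo]
  refine integral_congr_ae (.of_forall fun t => ?_)
  simp only [hJ]
  refine integral_congr_ae (.of_forall fun r => ?_)
  simp only [polarCoord_symm_apply, hw, hmul, Complex.real_smul]

/-- The integral over the circle of a radial integral is an integral over the plane. -/
lemma circleInt_radial {f : Euc N → ℂ} {z : ℂ}
    (hf : Integrable fun u => (‖u‖ : ℂ) ^ z * f (planePoint e u)) :
    circleInt e (radial f (z + 2)) = ∫ u, (‖u‖ : ℂ) ^ z * f (planePoint e u) := by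
  rw [integral_eq_polar hf, circleInt]
  refine intervalIntegral.integral_congr fun t _ => ?_
  simp only [radial, mellin]
  refine setIntegral_congr_fun measurableSet_Ioi fun r hr => ?_
  have hr : 0 < r := hr
  have h1 : ‖(!₂[Real.cos t, Real.sin t] : Euc 2)‖ = 1 := by
    rw [EuclideanSpace.norm_eq]
    simp
  simp only [smul_eq_mul, norm_smul, h1, mul_one, Real.norm_of_nonneg hr.le, planePoint_smul]
  rw [← mul_assoc, show z + 2 - 1 = 1 + z by ring,
    Complex.cpow_add _ _ (by exact_mod_cast hr.ne'), Complex.cpow_one]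

end Section

/-! ### Cutoffs and their moments. -/

section Cutoff

variable {η : ℝ → ℂ} {a b : ℝ}

lemma IsCutoff.eq_zero_of_le (hη : IsCutoff η a b) {t : ℝ} (ht : t ≤ a) : η t = 0 := by
  have hc : IsClosed {t | η t = 0} := isClosed_eq hη.contDiff.continuous continuous_const
  have : Set.Iio a ⊆ {t | η t = 0} := fun s hs => hη.eq_zero s fun h => (not_lt.2 h.1) hs
  have := hc.closure_subset_iff.2 this
  rw [closure_Iio] at this
  exact this ht

lemma IsCutoff.eq_zero_of_ge (hη : IsCutoff η a b) {t : ℝ} (ht : b ≤ t) : η t = 0 := by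
  have hc : IsClosed {t | η t = 0} := isClosed_eq hη.contDiff.continuous continuous_const
  have : Set.Ioi b ⊆ {t | η t = 0} := fun s hs => hη.eq_zero s fun h => (not_lt.2 h.2) hs
  have := hc.closure_subset_iff.2 this
  rw [closure_Ioi] at this
  exact this ht

lemma IsCutoff.continuous_deriv (hη : IsCutoff η a b) : Continuous (deriv η) :=
  hη.contDiff.continuous_deriv (by norm_num)

lemma IsCutoff.deriv_eq_zero (hη : IsCutoff η a b) {t : ℝ} (ht : t ∉ Set.Icc a b) :
    deriv η t = 0 := by
  have : η =ᶠ[nhds t] fun _ => 0 := by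
    filter_upwards [isClosed_Icc.isOpen_compl.mem_nhds ht] with s hs
    exact hη.eq_zero s hs
  rw [this.deriv_eq, deriv_const]

/-- Layer-cake formula. Applied at s = g(x) it writes η(g) as a superposition of indicators of the
dilated bodies {g ≤ t}. -/
lemma IsCutoff.eq_integral_deriv (hη : IsCutoff η a b) (s : ℝ) :
    η s = -∫ t in Set.Ioc a b, (Set.Ici s).indicator (deriv η) t := by
  have hcs : HasCompactSupport η := HasCompactSupport.intro isCompact_Icc hη.eq_zero
  have h1 := hcs.integral_Ioi_deriv_eq (hη.contDiff.of_le (by simp)) s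
  rw [eq_neg_iff_add_eq_zero, ← neg_eq_iff_add_eq_zero, ← h1, ← integral_Ici_eq_integral_Ioi,
    ← integral_indicator measurableSet_Ici, ← integral_Icc_eq_integral_Ioc]
  refine (setIntegral_eq_integral_of_forall_compl_eq_zero fun t ht => ?_).symm
  rw [Set.indicator_apply, hη.deriv_eq_zero ht, ite_self]

/-- The Mellin-type transform `-∫ η'(t) t^c dt`. -/
def cutoffMoment (η : ℝ → ℂ) (a b : ℝ) (c : ℂ) : ℂ :=
  -∫ t in Set.Ioc a b, (t : ℂ) ^ c * deriv η t

/-- Integration by parts without boundary terms gives c ∫ η(t) t^{c-1} dt, and for η = κ t^{-c} the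
integrand is κ(t)/t. The resulting factor is the one in the denominators of both final formulas. -/
lemma cutoffMoment_cutPow {κ : ℝ → ℝ} (hκ : ContDiff ℝ ∞ κ)
    (h0 : ∀ t, t ∉ Set.Icc 1 2 → κ t = 0) (h1 : ∫ t in Set.Ioi (0 : ℝ), κ t / t = 1) (c : ℂ) :
    cutoffMoment (cutPow κ (-c)) 1 2 c = c := by
  have hη := isCutoff_cutPow hκ h0 (-c)
  set η := cutPow κ (-c) with hηdef
  have hpos : ∀ t ∈ Set.uIcc (1 : ℝ) 2, 0 < t := by
    intro t ht
    rw [Set.uIcc_of_le (by norm_num)] at ht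
    linarith [ht.1]
  have hd1 : ∀ t ∈ Set.uIcc (1 : ℝ) 2, HasDerivAt (fun t : ℝ => (t : ℂ) ^ c)
      (c * (t : ℂ) ^ (c - 1)) t := by
    intro t ht
    have h := (hasDerivAt_id (t : ℂ)).cpow_const (c := c) (Or.inl (by simpa using hpos t ht))
    simpa using h.comp_ofReal
  have hd2 : ∀ t ∈ Set.uIcc (1 : ℝ) 2, HasDerivAt η (deriv η t) t := fun t _ =>
    ((hη.contDiff.differentiable (by simp)) t).hasDerivAt
  have hcont : ContinuousOn (fun t : ℝ => c * (t : ℂ) ^ (c - 1)) (Set.uIcc 1 2) :=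
    continuousOn_const.mul (((contDiffOn_cpow_const (c - 1)).continuousOn).mono hpos)
  have h := intervalIntegral.integral_mul_deriv_eq_deriv_mul hd1 hd2 hcont.intervalIntegrable
    (hη.continuous_deriv.intervalIntegrable _ _)
  rw [hη.eq_zero_of_le le_rfl, hη.eq_zero_of_ge le_rfl, mul_zero, mul_zero, sub_zero,
    zero_sub] at h
  rw [cutoffMoment, ← intervalIntegral.integral_of_le (by norm_num), h, neg_neg]
  have h2 : ∀ t ∈ Set.uIcc (1 : ℝ) 2, c * (t : ℂ) ^ (c - 1) * η t = c * ((κ t / t : ℝ) : ℂ) := by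
    intro t ht
    have ht := hpos t ht
    have hne : (t : ℂ) ≠ 0 := by exact_mod_cast ht.ne'
    rw [hηdef, cutPow, Complex.cpow_sub _ _ hne, Complex.cpow_neg, Complex.cpow_one]
    have : (t : ℂ) ^ c ≠ 0 := by
      rw [Complex.cpow_def_of_ne_zero hne]
      exact Complex.exp_ne_zero _
    push_cast
    field_simp
  rw [intervalIntegral.integral_congr h2, intervalIntegral.integral_const_mul,
    intervalIntegral.integral_ofReal, intervalIntegral.integral_of_le (by norm_num),
    ← integral_Icc_eq_integral_Ioc]
  have h3 : ∫ t in Set.Icc (1 : ℝ) 2, κ t / t = ∫ t in Set.Ioi (0 : ℝ), κ t / t := by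
    rw [setIntegral_eq_integral_of_forall_compl_eq_zero fun t ht => by rw [h0 t ht, zero_div],
      setIntegral_eq_integral_of_forall_compl_eq_zero fun t ht => ?_]
    rw [h0 t fun h' => ht (by simp; linarith [h'.1]), zero_div]
  rw [h3, h1]
  simp

end Cutoff

/-! ### Bounds for the section function, and its relation to sections of smooth weights. -/

section SectionFunction

variable {N : ℕ} {H : Submodule ℝ (Euc N)} (e : OrthonormalBasis (Fin 2) ℝ Hᗮ) {g : Euc N → ℝ}
  {η : ℝ → ℂ} {a b : ℝ}

/-- The section function of the body `{g ≤ 1}`. -/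
def gaugeSection (g : Euc N → ℝ) (e : OrthonormalBasis (Fin 2) ℝ Hᗮ) (p : ℝ) (u : Euc 2) : ℝ :=
  ∫ h : H, {x | g x ≤ 1}.indicator (fun x => ‖x‖ ^ (-p)) ((h : Euc N) + planePoint e u)

lemma sectionFun_eq_gaugeSection (D : ConvexBody (Euc N))
    (hD_int : (interior (D : Set (Euc N))).Nonempty) (hD_symm : ∀ x ∈ D, -x ∈ D) (p : ℝ) :
    sectionFun D H e p = gaugeSection (gauge (D : Set (Euc N))) e p := by
  funext u
  have hm : MeasurableSet {h : H | (h : Euc N) + planePoint e u ∈ D} := by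
    have : IsClosed {h : H | (h : Euc N) + planePoint e u ∈ (D : Set (Euc N))} :=
      D.isCompact.isClosed.preimage (by fun_prop)
    exact this.measurableSet
  rw [sectionFun, gaugeSection, ← integral_indicator hm]
  refine integral_congr_ae (.of_forall fun h => ?_)
  have hiff := gauge_le_one_iff D hD_int hD_symm ((h : Euc N) + planePoint e u)
  simp only
  by_cases hx : (h : Euc N) + planePoint e u ∈ D
  · rw [Set.indicator_of_mem (by exact hx), Set.indicator_of_mem (by exact hiff.2 hx)]
  · rw [Set.indicator_of_notMem (by exact hx),
      Set.indicator_of_notMem (by exact fun h => hx (hiff.1 h))]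

lemma measurable_norm_rpow (p : ℝ) : Measurable fun x : Euc N => ‖x‖ ^ p :=
  measurable_norm.pow_const p

lemma measurable_indicator_gauge (hg : IsSmoothGauge g) (p : ℝ) :
    Measurable ({x | g x ≤ 1}.indicator (fun x => ‖x‖ ^ (-p))) :=
  (measurable_norm_rpow _).indicator (isClosed_le hg.continuous continuous_const).measurableSet

lemma measurable_gaugeSection (hg : IsSmoothGauge g) (p : ℝ) : Measurable (gaugeSection g e p) := by
  have hm : Measurable fun z : Euc 2 × H =>
      {x | g x ≤ 1}.indicator (fun x => ‖x‖ ^ (-p)) ((z.2 : Euc N) + planePoint e z.1) := by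
    refine (measurable_indicator_gauge hg p).comp ?_
    have := continuous_planePoint e
    exact Continuous.measurable (by fun_prop)
  exact (hm.stronglyMeasurable.integral_prod_right').measurable

lemma gaugeSection_nonneg (p : ℝ) (u : Euc 2) : 0 ≤ gaugeSection g e p u :=
  integral_nonneg fun _ => Set.indicator_nonneg (fun x _ => by positivity) _

/-- The alternative p₁ = 0 keeps the case H = 0 (n = 1), where no positive exponent below the
dimension exists. -/
lemma integrableOn_norm_rpow_subspace {p₁ : ℝ} (hp : p₁ = 0 ∨ p₁ < finrank ℝ H) (hp0 : 0 ≤ p₁)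
    (r : ℝ) : IntegrableOn (fun h : H => ‖h‖ ^ (-p₁)) (Metric.ball 0 r) := by
  rcases hp with rfl | hp
  · simp only [neg_zero, Real.rpow_zero]
    exact integrableOn_const measure_ball_lt_top.ne
  · have : 0 < finrank ℝ H := by
      have : (0 : ℝ) < finrank ℝ H := hp0.trans_lt hp
      exact_mod_cast this
    have : Nontrivial H := Module.nontrivial_of_finrank_pos this
    exact integrableOn_norm_rpow_ball (by linarith) r

/-- By orthogonality the norm of h + u dominates both |h| and |u|, so the singularity can be shared:
p₁ is paid by integration over H, and p₂ remains as a singularity in u. -/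
lemma ae_norm_rpow_le {p₁ p₂ : ℝ} (hp : p₁ = 0 ∨ p₁ < finrank ℝ H) (hp₁ : 0 ≤ p₁) (hp₂ : 0 ≤ p₂)
    {u : Euc 2} (hu : p₂ = 0 ∨ u ≠ 0) :
    ∀ᵐ h : H, ‖(h : Euc N) + planePoint e u‖ ^ (-(p₁ + p₂)) ≤ ‖h‖ ^ (-p₁) * ‖u‖ ^ (-p₂) := by
  have hae : ∀ᵐ h : H, p₁ = 0 ∨ h ≠ 0 := by
    rcases hp with rfl | hp
    · simp
    · have : 0 < finrank ℝ H := by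
        have : (0 : ℝ) < finrank ℝ H := hp₁.trans_lt hp
        exact_mod_cast this
      have : Nontrivial H := Module.nontrivial_of_finrank_pos this
      filter_upwards [compl_mem_ae_iff.2 (measure_singleton (0 : H))] with h hh
      exact Or.inr hh
  filter_upwards [hae] with h hh
  set x := (h : Euc N) + planePoint e u with hx
  have h1 : ‖x‖ ^ (-p₁) ≤ ‖h‖ ^ (-p₁) := by
    rcases hh with rfl | hh
    · simp
    · exact Real.rpow_le_rpow_of_nonpos (norm_pos_iff.2 hh) (norm_le_norm_add_planePoint e h u)
        (by linarith)
  have h2 : ‖x‖ ^ (-p₂) ≤ ‖u‖ ^ (-p₂) := by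
    rcases hu with rfl | hu
    · simp
    · exact Real.rpow_le_rpow_of_nonpos (norm_pos_iff.2 hu) (norm_le_norm_add_planePoint' e h u)
        (by linarith)
  rcases eq_or_ne x 0 with h0 | h0
  · have hp : ∀ q : ℝ, (0 : ℝ) ^ q ≤ 1 := fun q => by
      rcases eq_or_ne q 0 with rfl | hq
      · simp
      · rw [Real.zero_rpow hq]; exact zero_le_one
    have hn : ‖h‖ ≤ 0 :=
      (norm_le_norm_add_planePoint e h u).trans_eq (by rw [← hx, h0, norm_zero])
    have hn' : ‖u‖ ≤ 0 :=
      (norm_le_norm_add_planePoint' e h u).trans_eq (by rw [← hx, h0, norm_zero])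
    -- Here h = 0 and u = 0, so the two alternatives force both exponents to vanish.
    have e1 : p₁ = 0 := hh.resolve_right (by simpa using hn)
    have e2 : p₂ = 0 := hu.resolve_right (by simpa using hn')
    simp [e1, e2]
  · rw [neg_add, Real.rpow_add (norm_pos_iff.2 h0)]
    exact mul_le_mul h1 h2 (by positivity) (by positivity)

lemma integrableOn_norm_add_rpow {p₁ p₂ : ℝ} (hp : p₁ = 0 ∨ p₁ < finrank ℝ H) (hp₁ : 0 ≤ p₁)
    (hp₂ : 0 ≤ p₂) {u : Euc 2} (hu : p₂ = 0 ∨ u ≠ 0) (r : ℝ) :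
    IntegrableOn (fun h : H => ‖(h : Euc N) + planePoint e u‖ ^ (-(p₁ + p₂)))
      (Metric.ball 0 r) := by
  refine Integrable.mono' ((integrableOn_norm_rpow_subspace hp hp₁ r).mul_const (‖u‖ ^ (-p₂))) ?_ ?_
  · refine ((measurable_norm_rpow _).comp ?_).aestronglyMeasurable
    exact Continuous.measurable (by fun_prop)
  · filter_upwards [ae_restrict_of_ae (ae_norm_rpow_le e hp hp₁ hp₂ hu)] with h hh
    rw [Real.norm_of_nonneg (by positivity)]
    exact hh

lemma gaugeSection_le (hg : IsSmoothGauge g) {p₁ p₂ : ℝ} (hp : p₁ = 0 ∨ p₁ < finrank ℝ H)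
    (hp₁ : 0 ≤ p₁) (hp₂ : 0 ≤ p₂) : ∃ C r : ℝ, 0 ≤ C ∧ ∀ u : Euc 2, p₂ = 0 ∨ u ≠ 0 →
      gaugeSection g e (p₁ + p₂) u ≤
        (Metric.ball 0 r).indicator (fun u : Euc 2 => ‖u‖ ^ (-p₂) * C) u := by
  obtain ⟨R, hR, hgR⟩ := hg.norm_le
  refine ⟨∫ h : H in Metric.ball 0 (R + 1), ‖h‖ ^ (-p₁), R + 1,
    integral_nonneg fun _ => by positivity, fun u hu => ?_⟩
  have hx : ∀ x : Euc N, g x ≤ 1 → ‖x‖ < R + 1 := fun x hx => by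
    have := hgR x
    nlinarith
  by_cases hur : u ∈ Metric.ball (0 : Euc 2) (R + 1)
  · rw [Set.indicator_of_mem hur, gaugeSection, ← integral_const_mul,
      ← integral_indicator measurableSet_ball]
    refine integral_mono_of_nonneg (.of_forall fun _ =>
      Set.indicator_nonneg (fun x _ => by positivity) _) ?_ ?_
    · rw [integrable_indicator_iff measurableSet_ball]
      exact (integrableOn_norm_rpow_subspace hp hp₁ _).const_mul _
    · filter_upwards [ae_norm_rpow_le e hp hp₁ hp₂ hu] with h hh
      by_cases hgx : g ((h : Euc N) + planePoint e u) ≤ 1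
      · have hb : h ∈ Metric.ball (0 : H) (R + 1) := by
          rw [mem_ball_zero_iff]
          exact (norm_le_norm_add_planePoint e h u).trans_lt (hx _ hgx)
        rw [Set.indicator_of_mem (by exact hgx), Set.indicator_of_mem hb, mul_comm]
        exact hh
      · rw [Set.indicator_of_notMem (by exact hgx)]
        exact Set.indicator_nonneg (fun x _ => by positivity) _
  · rw [Set.indicator_of_notMem hur, gaugeSection]
    refine (integral_eq_zero_of_ae (.of_forall fun h => ?_)).le
    refine Set.indicator_of_notMem (fun hgx => hur ?_) _
    rw [mem_ball_zero_iff]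
    exact (norm_le_norm_add_planePoint' e h u).trans_lt (hx _ hgx)

/-- Integrability of powers of the norm against the section function. -/
lemma integrable_norm_rpow_mul_gaugeSection (hg : IsSmoothGauge g) {p s : ℝ} (hp : 0 ≤ p)
    (hs : -2 < s) (hsp : p < finrank ℝ H + 2 + s) :
    Integrable fun u => ‖u‖ ^ s * gaugeSection g e p u := by
  -- If |u|^{s-p} is integrable at 0 in the plane, u takes the whole singularity. Otherwise u takes
  -- an exponent c < s + 2 so large that the rest p - c is below dim H.
  obtain ⟨p₁, p₂, rfl, h1, h2, h3, h4⟩ : ∃ p₁ p₂ : ℝ, p = p₁ + p₂ ∧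
      (p₁ = 0 ∨ p₁ < finrank ℝ H) ∧ 0 ≤ p₁ ∧ 0 ≤ p₂ ∧ p₂ < s + 2 := by
    rcases lt_or_ge p (s + 2) with h | h
    · exact ⟨0, p, by ring, Or.inl rfl, le_rfl, hp, h⟩
    · obtain ⟨c, hc1, hc2⟩ := exists_between
        (max_lt (show p - finrank ℝ H < s + 2 by linarith) (show (0 : ℝ) < s + 2 by linarith))
      obtain ⟨hc3, hc4⟩ := max_lt_iff.1 hc1
      exact ⟨p - c, c, by ring, Or.inr (by linarith), by linarith, hc4.le, hc2⟩
  obtain ⟨C, r, hC, hCr⟩ := gaugeSection_le e hg h1 h2 h3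
  have hb : Integrable ((Metric.ball (0 : Euc 2) r).indicator fun u => ‖u‖ ^ (s - p₂) * C) := by
    rw [integrable_indicator_iff measurableSet_ball]
    refine (integrableOn_norm_rpow_ball ?_ r).mul_const C
    rw [finrank_euclideanSpace_fin]
    push_cast
    linarith
  refine hb.mono' ((measurable_norm.pow_const s).mul
    (measurable_gaugeSection e hg _)).aestronglyMeasurable ?_
  filter_upwards [compl_mem_ae_iff.2 (measure_singleton (0 : Euc 2))] with u hu
  have hu' : 0 < ‖u‖ := norm_pos_iff.2 hu
  rw [Real.norm_of_nonneg (mul_nonneg (by positivity) (gaugeSection_nonneg e _ u))]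
  refine (mul_le_mul_of_nonneg_left (hCr u (Or.inr hu)) (by positivity)).trans ?_
  by_cases hr : u ∈ Metric.ball (0 : Euc 2) r
  · rw [Set.indicator_of_mem hr, Set.indicator_of_mem hr, ← mul_assoc, ← Real.rpow_add hu',
      ← sub_eq_add_neg]
  · rw [Set.indicator_of_notMem hr, Set.indicator_of_notMem hr, mul_zero]

lemma integral_indicator_gauge_le (hg : IsSmoothGauge g) (p : ℝ) {t : ℝ} (ht : 0 < t) (u : Euc 2) :
    ∫ h : H, {x | g x ≤ t}.indicator (fun x => ‖x‖ ^ (-p)) ((h : Euc N) + planePoint e u) =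
      t ^ (finrank ℝ H - p) * gaugeSection g e p (t⁻¹ • u) := by
  set f : H → ℝ := fun h =>
    {x | g x ≤ t}.indicator (fun x => ‖x‖ ^ (-p)) ((h : Euc N) + planePoint e u) with hf
  have h := Measure.integral_comp_smul_of_nonneg (volume : Measure H) f t (hR := ht.le)
  rw [smul_eq_mul, eq_inv_mul_iff_mul_eq₀ (by positivity)] at h
  rw [← h, gaugeSection, Real.rpow_sub ht, Real.rpow_natCast, div_eq_mul_inv, mul_assoc,
    ← Real.rpow_neg ht.le, ← integral_const_mul (t ^ (-p))]
  refine congrArg (fun I : ℝ => t ^ finrank ℝ H * I) (integral_congr_ae (.of_forall fun h => ?_))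
  have hx : ((t • h : H) : Euc N) + planePoint e u =
      t • ((h : Euc N) + planePoint e (t⁻¹ • u)) := by
    rw [planePoint_smul, smul_add, smul_inv_smul₀ ht.ne']
    rfl
  simp only [hf]
  rw [hx]
  set x := (h : Euc N) + planePoint e (t⁻¹ • u)
  have hiff : g (t • x) ≤ t ↔ g x ≤ 1 := by
    rw [hg.smul t x ht.le]
    exact mul_le_iff_le_one_right ht
  simp only [Set.indicator_apply, Set.mem_ofPred_eq, hiff]
  split_ifs
  · rw [norm_smul, Real.norm_of_nonneg ht.le, Real.mul_rpow ht.le (norm_nonneg _)]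
  · simp

/-- Sections of smooth weights as averages of dilates of the section function. -/
theorem sectionInt_weight_eq (hg : IsSmoothGauge g) (hη : IsCutoff η a b) {p₁ p₂ : ℝ}
    (hp : p₁ = 0 ∨ p₁ < finrank ℝ H) (hp₁ : 0 ≤ p₁) (hp₂ : 0 ≤ p₂) {u : Euc 2}
    (hu : p₂ = 0 ∨ u ≠ 0) :
    sectionInt e (weight g η (p₁ + p₂)) u = -∫ t in Set.Ioc a b,
      ((t ^ (finrank ℝ H - (p₁ + p₂)) * gaugeSection g e (p₁ + p₂) (t⁻¹ • u) : ℝ) : ℂ) *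
        deriv η t := by
  set p := p₁ + p₂ with hpdef
  obtain ⟨R, hR, hgR⟩ := hg.norm_le
  set K : H → ℝ → ℂ := fun h t =>
    (({x | g x ≤ t}.indicator (fun x => ‖x‖ ^ (-p)) ((h : Euc N) + planePoint e u) : ℝ) : ℂ) *
      deriv η t with hK
  have hcont : Continuous fun h : H => (h : Euc N) + planePoint e u := by fun_prop
  have hKi : Integrable (Function.uncurry K)
      ((volume : Measure H).prod (volume.restrict (Set.Ioc a b))) := by
    have h1 : Integrable ((Metric.ball (0 : H) (R * b + 1)).indicator fun h : H =>
        ‖(h : Euc N) + planePoint e u‖ ^ (-p)) := by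
      rw [integrable_indicator_iff measurableSet_ball]
      exact integrableOn_norm_add_rpow e hp hp₁ hp₂ hu _
    have h2 : Integrable (fun t => ‖deriv η t‖) (volume.restrict (Set.Ioc a b)) :=
      (hη.continuous_deriv.norm.integrableOn_Icc).mono_set Set.Ioc_subset_Icc_self
    refine (h1.mul_prod h2).mono' ?_ ?_
    · refine Measurable.aestronglyMeasurable ?_
      refine Measurable.mul (Complex.measurable_ofReal.comp ?_)
        (hη.continuous_deriv.measurable.comp measurable_snd)
      have hs : MeasurableSet {z : H × ℝ | g ((z.1 : Euc N) + planePoint e u) ≤ z.2} := by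
        have := hg.continuous
        exact (isClosed_le (by fun_prop) (by fun_prop)).measurableSet
      have := ((measurable_norm_rpow (-p)).comp
        (hcont.measurable.comp (measurable_fst (α := H) (β := ℝ)))).indicator hs
      exact this
    · have hmem : ∀ᵐ z ∂((volume : Measure H).prod (volume.restrict (Set.Ioc a b))),
          z.2 ∈ Set.Ioc a b :=
        Measure.quasiMeasurePreserving_snd.ae (ae_restrict_mem measurableSet_Ioc)
      filter_upwards [hmem] with z hz
      simp only [Function.uncurry, hK, norm_mul, Complex.norm_real]
      refine mul_le_mul_of_nonneg_right ?_ (norm_nonneg _)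
      rw [Real.norm_of_nonneg (Set.indicator_nonneg (fun x _ => by positivity) _)]
      by_cases hgx : g ((z.1 : Euc N) + planePoint e u) ≤ z.2
      · rw [Set.indicator_of_mem (by exact hgx), Set.indicator_of_mem]
        rw [mem_ball_zero_iff]
        have := (norm_le_norm_add_planePoint e z.1 u).trans (hgR _)
        have : R * g ((z.1 : Euc N) + planePoint e u) ≤ R * b :=
          mul_le_mul_of_nonneg_left (hgx.trans hz.2) hR.le
        linarith
      · rw [Set.indicator_of_notMem (by exact hgx)]
        exact Set.indicator_nonneg (fun x _ => by positivity) _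
  -- Fubini for the layer-cake formula: integrating over H first gives sections of {g ≤ t}, which
  -- are dilates of sections of {g ≤ 1}.
  have hswap := integral_integral_swap hKi
  have hL : sectionInt e (weight g η p) u = -∫ h : H, ∫ t in Set.Ioc a b, K h t := by
    rw [sectionInt, ← integral_neg]
    refine integral_congr_ae (.of_forall fun h => ?_)
    simp only [weight, hK]
    rw [hη.eq_integral_deriv, neg_mul, ← integral_mul_const]
    congr 1
    refine integral_congr_ae (.of_forall fun t => ?_)
    simp only [Set.indicator_apply, Set.mem_Ici, Set.mem_ofPred_eq]
    split_ifs <;> simp [mul_comm]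
  rw [hL, hswap]
  congr 1
  refine setIntegral_congr_fun measurableSet_Ioc fun t ht => ?_
  simp only [hK]
  rw [integral_mul_const, integral_complex_ofReal,
    integral_indicator_gauge_le e hg p (hη.pos.trans ht.1) u]

/-- The moments of the sections of smooth weights in terms of those of the section function. -/
theorem integral_norm_cpow_mul_sectionInt (hg : IsSmoothGauge g) (hη : IsCutoff η a b) {p : ℝ}
    (hp : 0 ≤ p) {w : ℂ} (hw : -2 < w.re) (hwp : p < finrank ℝ H + 2 + w.re) :
    ∫ u, (‖u‖ : ℂ) ^ w * sectionInt e (weight g η p) u =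
      cutoffMoment η a b (finrank ℝ H - p + w + 2) *
        ∫ u, (‖u‖ : ℂ) ^ w * (gaugeSection g e p u : ℂ) := by
  set A := gaugeSection g e p with hA
  have hAm : Measurable A := measurable_gaugeSection e hg p
  have hAi : Integrable fun u => (‖u‖ : ℂ) ^ w * (A u : ℂ) := by
    refine (integrable_norm_cpow_mul_iff (f := fun u => (A u : ℂ))
      (Complex.measurable_ofReal.comp hAm).aestronglyMeasurable w).2 ?_
    refine (integrable_norm_rpow_mul_gaugeSection e hg hp hw hwp).congr (.of_forall fun u => ?_)
    simp only [Complex.norm_real]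
    rw [Real.norm_of_nonneg (gaugeSection_nonneg e p u)]
  set m : ℝ := (finrank ℝ H : ℝ) with hm
  set B : Euc 2 → ℂ := fun u => (‖u‖ : ℂ) ^ w * (A u : ℂ) with hB
  -- Since |u|^w = t^w |u/t|^w, the moment of each dilate is a power of t times the moment of A. The
  -- substitution u ↦ tu adds t², for a total exponent m - p + w + 2.
  set K : ℝ → Euc 2 → ℂ := fun t u =>
    (t : ℂ) ^ ((m : ℂ) - p + w) * deriv η t * B (t⁻¹ • u) with hK
  have hKt : ∀ t ∈ Set.Ioc a b, ∀ u : Euc 2, (‖u‖ : ℂ) ^ w *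
      (((t ^ (m - p) * A (t⁻¹ • u) : ℝ) : ℂ) * deriv η t) = K t u := by
    intro t ht u
    have ht : 0 < t := hη.pos.trans ht.1
    have hu : (‖u‖ : ℂ) ^ w = (t : ℂ) ^ w * (‖t⁻¹ • u‖ : ℂ) ^ w := by
      rw [← Complex.mul_cpow_ofReal_nonneg ht.le (norm_nonneg _), norm_smul, norm_inv,
        Real.norm_of_nonneg ht.le, ← Complex.ofReal_mul, mul_inv_cancel_left₀ ht.ne']
    simp only [hK, hB]
    rw [hu, Complex.cpow_add _ _ (by exact_mod_cast ht.ne'), ← Complex.ofReal_sub,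
      ← Complex.ofReal_cpow ht.le]
    push_cast
    ring
  have hscale : ∀ t : ℝ, 0 < t → ∀ f : Euc 2 → ℂ,
      ∫ u, f (t⁻¹ • u) = (t : ℂ) ^ (2 : ℂ) * ∫ u, f u := by
    intro t ht f
    have := Measure.integral_comp_inv_smul_of_nonneg (volume : Measure (Euc 2)) f ht.le
    rw [this, finrank_euclideanSpace_fin, Complex.real_smul]
    norm_num
  have hKi : Integrable (Function.uncurry K)
      ((volume.restrict (Set.Ioc a b)).prod (volume : Measure (Euc 2))) := by
    have hmeas : AEStronglyMeasurable (Function.uncurry K)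
        ((volume.restrict (Set.Ioc a b)).prod (volume : Measure (Euc 2))) := by
      refine Measurable.aestronglyMeasurable ?_
      have hBm : Measurable B :=
        (measurable_norm_cpow w).mul (Complex.measurable_ofReal.comp hAm)
      refine Measurable.mul (Measurable.mul ?_ ?_) (hBm.comp ?_)
      · exact (Complex.measurable_ofReal.comp measurable_fst).pow_const _
      · exact hη.continuous_deriv.measurable.comp measurable_fst
      · exact measurable_fst.inv.smul measurable_snd
    rw [integrable_prod_iff hmeas]
    constructor
    · filter_upwards [ae_restrict_mem measurableSet_Ioc] with t ht
      have ht : 0 < t := hη.pos.trans ht.1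
      have hBi : Integrable fun u => B (t⁻¹ • u) := hAi.comp_smul (inv_pos.2 ht).ne'
      exact hBi.const_mul ((t : ℂ) ^ ((m : ℂ) - p + w) * deriv η t)
    · have hc : ContinuousOn (fun t : ℝ => (t : ℂ) ^ ((m : ℂ) - p + w) * deriv η t *
          ((t : ℂ) ^ (2 : ℂ))) (Set.Icc a b) := by
        have hcp : ∀ z : ℂ, ContinuousOn (fun t : ℝ => (t : ℂ) ^ z) (Set.Icc a b) := fun z =>
          (contDiffOn_cpow_const z).continuousOn.mono fun t ht => hη.pos.trans_le ht.1
        exact ((hcp _).mul hη.continuous_deriv.continuousOn).mul (hcp _)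
      have hi : IntegrableOn (fun t : ℝ => ‖(t : ℂ) ^ ((m : ℂ) - p + w) * deriv η t *
          ((t : ℂ) ^ (2 : ℂ))‖ * ∫ u, ‖B u‖) (Set.Ioc a b) :=
        ((hc.norm.integrableOn_Icc).mono_set Set.Ioc_subset_Icc_self).mul_const _
      refine hi.congr ?_
      filter_upwards [ae_restrict_mem measurableSet_Ioc] with t ht
      have ht : 0 < t := hη.pos.trans ht.1
      simp only [Function.uncurry, hK, norm_mul]
      rw [integral_const_mul]
      have := Measure.integral_comp_inv_smul_of_nonneg (volume : Measure (Euc 2))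
        (fun u => ‖B u‖) ht.le
      rw [finrank_euclideanSpace_fin, smul_eq_mul] at this
      rw [show (∫ u, ‖B (t⁻¹ • u)‖) = _ from this]
      have h2 : ‖(t : ℂ) ^ (2 : ℂ)‖ = t ^ 2 := by
        norm_num [Real.norm_of_nonneg ht.le]
      simp only [hB, norm_mul] at h2 ⊢
      rw [h2]
      ring
  have h1 : ∫ u, (‖u‖ : ℂ) ^ w * sectionInt e (weight g η p) u =
      -∫ u, ∫ t in Set.Ioc a b, K t u := by
    rw [← integral_neg]
    refine integral_congr_ae ?_
    filter_upwards [compl_mem_ae_iff.2 (measure_singleton (0 : Euc 2))] with u hu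
    have := sectionInt_weight_eq e hg hη (p₁ := 0) (p₂ := p) (Or.inl rfl) le_rfl hp
      (u := u) (Or.inr hu)
    rw [zero_add] at this
    rw [this, mul_neg, ← integral_const_mul]
    congr 1
    exact setIntegral_congr_fun measurableSet_Ioc fun t ht => hKt t ht u
  rw [h1, ← integral_integral_swap hKi, cutoffMoment, neg_mul, ← integral_mul_const]
  congr 1
  refine setIntegral_congr_fun measurableSet_Ioc fun t ht => ?_
  have ht : 0 < t := hη.pos.trans ht.1
  simp only [hK]
  rw [integral_const_mul, hscale t ht, Complex.cpow_add _ (2 : ℂ) (by exact_mod_cast ht.ne')]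
  simp only [hm]
  push_cast
  ring

end SectionFunction

/-! ### Holomorphic dependence of moments on the exponent. -/

section Holomorphic

lemma rpow_le_rpow_add_rpow {t x y z : ℝ} (ht : 0 < t) (h₁ : x ≤ y) (h₂ : y ≤ z) :
    t ^ y ≤ t ^ x + t ^ z := by
  rcases le_or_gt 1 t with h | h
  · exact (Real.rpow_le_rpow_of_exponent_le h h₂).trans
      (le_add_of_nonneg_left (Real.rpow_nonneg ht.le _))
  · exact (Real.rpow_le_rpow_of_exponent_ge ht h.le h₁).trans
      (le_add_of_nonneg_right (Real.rpow_nonneg ht.le _))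

/-- Moments `∫ ρ^z h` depend holomorphically on the exponent. -/
theorem differentiableOn_integral_cpow {α : Type*} [MeasurableSpace α] {μ : Measure α} {ρ : α → ℝ}
    {h : α → ℂ} (hρ : Measurable ρ) (hpos : ∀ᵐ x ∂μ, 0 < ρ x) (hh : AEStronglyMeasurable h μ)
    {lo hi : ℝ} (hint : ∀ s, lo < s → s < hi → Integrable (fun x => ρ x ^ s * ‖h x‖) μ) :
    DifferentiableOn ℂ (fun z : ℂ => ∫ x, (ρ x : ℂ) ^ z * h x ∂μ) {z | lo < z.re ∧ z.re < hi} := by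
  intro z₀ hz₀
  obtain ⟨h1, h2⟩ := hz₀
  obtain ⟨r, hr, hr'⟩ : ∃ r, 0 < r ∧ 2 * r < min (z₀.re - lo) (hi - z₀.re) := by
    have : 0 < min (z₀.re - lo) (hi - z₀.re) := lt_min (by linarith) (by linarith)
    exact ⟨min (z₀.re - lo) (hi - z₀.re) / 4, by linarith, by linarith⟩
  obtain ⟨hr1, hr2⟩ := lt_min_iff.1 hr'
  refine DifferentiableAt.differentiableWithinAt ?_
  have hm : ∀ z : ℂ, AEStronglyMeasurable (fun x => (ρ x : ℂ) ^ z * h x) μ := fun z =>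
    (((Complex.measurable_ofReal.comp hρ).pow_const z).aestronglyMeasurable).mul hh
  -- Two real exponents at distance 2r on either side of Re z₀ dominate every exponent in between,
  -- whether ρ is large or small.
  set B : α → ℝ := fun x =>
    (ρ x ^ (z₀.re - 2 * r) * ‖h x‖ + ρ x ^ (z₀.re + 2 * r) * ‖h x‖) with hB
  have hBi : Integrable B μ :=
    (hint _ (by linarith) (by linarith)).add (hint _ (by linarith) (by linarith))
  have hbd : ∀ x, 0 < ρ x → ∀ z : ℂ, ‖z - z₀‖ ≤ 2 * r → ‖(ρ x : ℂ) ^ z * h x‖ ≤ B x := by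
    intro x hx z hz
    have hre := (Complex.abs_re_le_norm (z - z₀)).trans hz
    rw [Complex.sub_re, abs_le] at hre
    rw [norm_mul, Complex.norm_cpow_eq_rpow_re_of_pos hx, hB]
    simp only
    rw [← add_mul]
    exact mul_le_mul_of_nonneg_right
      (rpow_le_rpow_add_rpow hx (by linarith) (by linarith)) (norm_nonneg _)
  have hd : ∀ x, 0 < ρ x → ∀ z : ℂ, HasDerivAt (fun z : ℂ => (ρ x : ℂ) ^ z * h x)
      ((ρ x : ℂ) ^ z * Complex.log (ρ x) * h x) z := by
    intro x hx z
    have := ((hasDerivAt_id z).const_cpow (c := (ρ x : ℂ))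
      (Or.inl (by exact_mod_cast hx.ne'))).mul_const (h x)
    simpa using this
  refine (hasDerivAt_integral_of_dominated_loc_of_deriv_le (s := Metric.ball z₀ r)
    (F := fun z x => (ρ x : ℂ) ^ z * h x)
    (F' := fun z x => (ρ x : ℂ) ^ z * Complex.log (ρ x) * h x)
    (bound := fun x => B x / r) (Metric.ball_mem_nhds _ hr) (.of_forall hm) ?_ ?_ ?_
    (hBi.div_const r) ?_).2.differentiableAt
  · refine hBi.mono' (hm z₀) ?_
    filter_upwards [hpos] with x hx
    exact hbd x hx z₀ (by simp; linarith)
  · have hc := Complex.measurable_ofReal.comp hρ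
    exact ((hc.pow_const z₀).mul (Complex.measurable_log.comp hc)).aestronglyMeasurable.mul hh
  · filter_upwards [hpos] with x hx z hz
    rw [mem_ball_iff_norm] at hz
    rw [← (hd x hx z).deriv]
    -- Cauchy's estimate on circles of radius r bounds the derivative by B/r, so the logarithm needs
    -- no separate estimate.
    refine Complex.norm_deriv_le_of_forall_mem_sphere_norm_le hr ?_ fun w hw => ?_
    · exact Differentiable.diffContOnCl fun w => (hd x hx w).differentiableAt
    · refine hbd x hx w ?_
      rw [mem_sphere_iff_norm] at hw
      calc ‖w - z₀‖ = ‖(w - z) + (z - z₀)‖ := by ring_nf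
        _ ≤ 2 * r := (norm_add_le _ _).trans (by linarith)
  · filter_upwards [hpos] with x hx z _
    exact hd x hx z

lemma differentiable_cutoffMoment {η : ℝ → ℂ} {a b : ℝ} (hη : IsCutoff η a b) :
    Differentiable ℂ (cutoffMoment η a b) := by
  intro z
  have h := differentiableOn_integral_cpow (μ := volume.restrict (Set.Ioc a b)) (ρ := fun t => t)
    (h := deriv η) (lo := z.re - 1) (hi := z.re + 1) measurable_id ?_
    hη.continuous_deriv.aestronglyMeasurable fun s _ _ => ?_
  · have hopen : IsOpen {w : ℂ | z.re - 1 < w.re ∧ w.re < z.re + 1} :=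
      (isOpen_lt continuous_const Complex.continuous_re).inter
        (isOpen_lt Complex.continuous_re continuous_const)
    exact (h.differentiableAt (hopen.mem_nhds ⟨by linarith, by linarith⟩)).neg
  · filter_upwards [ae_restrict_mem measurableSet_Ioc] with t ht
    exact hη.pos.trans ht.1
  · refine IntegrableOn.mono_set (t := Set.Icc a b) ?_ Set.Ioc_subset_Icc_self
    refine ContinuousOn.integrableOn_Icc ?_
    refine ContinuousOn.mul ?_ hη.continuous_deriv.norm.continuousOn
    exact fun t ht => (Real.continuousAt_rpow_const _ _
      (Or.inl (hη.pos.trans_le ht.1).ne')).continuousWithinAt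

end Holomorphic

/-! ### Analytic continuation of the action on the section function. -/

section Regularization

variable {N : ℕ} {H : Submodule ℝ (Euc N)} (e : OrthonormalBasis (Fin 2) ℝ Hᗮ) {g : Euc N → ℝ}
  {η : ℝ → ℂ} {a b : ℝ}

/-- The moment `∫ |u|^{-z-2} A(u) du` of the section function. -/
def sectionMoment (g : Euc N → ℝ) (e : OrthonormalBasis (Fin 2) ℝ Hᗮ) (p : ℝ) (z : ℂ) : ℂ :=
  ∫ u : Euc 2, (‖u‖ : ℂ) ^ (-z - 2) * (gaugeSection g e p u : ℂ)

/-- The Fourier side of the regularised action on the sections of a smooth weight. -/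
def fourierMoment (g : Euc N → ℝ) (e : OrthonormalBasis (Fin 2) ℝ Hᗮ) (η : ℝ → ℂ) (p : ℝ)
    (z : ℂ) : ℂ :=
  2 ^ (-z - 2) / (Real.pi * Complex.Gamma ((z + 2) / 2)) *
    ∫ u : Euc 2, (‖u‖ : ℂ) ^ z * angFourier (sectionInt e (weight g η p)) u

/-- In this strip both integrals converge: the dilation identity gives the moment of S as a multiple
of that of A, and the planar Riesz formula evaluates it on the Fourier side. -/
lemma cutoffMoment_mul_sectionMoment (hg : IsSmoothGauge g) (hη : IsCutoff η a b) {p : ℝ}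
    (hp : 0 ≤ p) {z : ℂ} (hz : -2 < z.re) (hz0 : z.re < 0) (hzp : z.re < finrank ℝ H - p) :
    cutoffMoment η a b (finrank ℝ H - p - z) *
      ((Complex.Gamma (-z / 2))⁻¹ * sectionMoment g e p z) = fourierMoment g e η p z := by
  have h1 := integral_norm_cpow_mul_sectionInt e hg hη hp (w := -z - 2) (by simp; linarith)
    (by simp; linarith)
  have h2 := integral_norm_cpow_mul_eq
    (sectionSchwartz e (contDiff_weight hg hη p) (hasCompactSupport_weight hg hη p)) hz hz0
  rw [coe_sectionSchwartz, h1] at h2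
  rw [fourierMoment, ← h2, sectionMoment,
    show (finrank ℝ H : ℂ) - p + (-z - 2) + 2 = finrank ℝ H - p - z by ring]
  ring

lemma isOpen_re_lt (c : ℝ) : IsOpen {z : ℂ | z.re < c} :=
  isOpen_lt Complex.continuous_re continuous_const

lemma isOpen_lt_re (c : ℝ) : IsOpen {z : ℂ | c < z.re} :=
  isOpen_lt continuous_const Complex.continuous_re

lemma analyticOnNhd_fourierMoment (hg : IsSmoothGauge g) (hη : IsCutoff η a b) (p : ℝ) :
    AnalyticOnNhd ℂ (fourierMoment g e η p) {z | -2 < z.re} := by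
  refine DifferentiableOn.analyticOnNhd ?_ (isOpen_lt_re _)
  set φ := schwartzFourier
    (sectionSchwartz e (contDiff_weight hg hη p) (hasCompactSupport_weight hg hη p)) with hφ
  have hφc : angFourier (sectionInt e (weight g η p)) = ⇑φ := by
    rw [hφ, coe_schwartzFourier, coe_sectionSchwartz]
  intro z hz
  have hz : -2 < z.re := hz
  refine DifferentiableAt.differentiableWithinAt ?_
  unfold fourierMoment
  refine DifferentiableAt.mul ?_ ?_
  · have h2 : DifferentiableAt ℂ (fun z : ℂ => (2 : ℂ) ^ (-z - 2)) z := by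
      refine DifferentiableAt.const_cpow (by fun_prop) (Or.inl two_ne_zero)
    have h3 : DifferentiableAt ℂ (fun z : ℂ => (Complex.Gamma ((z + 2) / 2))⁻¹) z :=
      (Complex.differentiable_one_div_Gamma ((z + 2) / 2)).comp z
        (f := fun z : ℂ => (z + 2) / 2) (by fun_prop)
    simp_rw [div_eq_mul_inv, mul_inv]
    simp_rw [div_eq_mul_inv] at h3
    exact h2.mul (h3.const_mul _)
  · rw [hφc]
    have h := differentiableOn_integral_cpow (μ := (volume : Measure (Euc 2)))
      (ρ := fun u => ‖u‖) (h := φ) (lo := -2) (hi := z.re + 1) measurable_norm ?_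
      φ.continuous.aestronglyMeasurable fun s hs _ => ?_
    · exact h.differentiableAt (((isOpen_lt_re _).inter (isOpen_re_lt _)).mem_nhds
        ⟨hz, by simp⟩)
    · filter_upwards [compl_mem_ae_iff.2 (measure_singleton (0 : Euc 2))] with u hu
      exact norm_pos_iff.2 hu
    · refine integrable_norm_rpow_mul_schwartz ?_ φ
      rw [finrank_euclideanSpace_fin]
      exact_mod_cast hs

lemma differentiableOn_sectionMoment (hg : IsSmoothGauge g) {p : ℝ} (hp : 0 ≤ p) :
    DifferentiableOn ℂ (sectionMoment g e p) {z | z.re < 0 ∧ z.re < finrank ℝ H - p} := by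
  intro z hz
  obtain ⟨h0, hzp⟩ := hz
  refine DifferentiableAt.differentiableWithinAt ?_
  set lo : ℝ := max (-2) (p - finrank ℝ H - 2) with hlo
  have h := differentiableOn_integral_cpow (μ := (volume : Measure (Euc 2)))
    (ρ := fun u => ‖u‖) (h := fun u => (gaugeSection g e p u : ℂ)) (lo := lo)
    (hi := -z.re - 1) measurable_norm ?_
    (Complex.measurable_ofReal.comp (measurable_gaugeSection e hg p)).aestronglyMeasurable
    fun s hs _ => ?_
  · have hopen : IsOpen {w : ℂ | lo < w.re ∧ w.re < -z.re - 1} :=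
      (isOpen_lt_re _).inter (isOpen_re_lt _)
    have hmem : (-z - 2) ∈ {w : ℂ | lo < w.re ∧ w.re < -z.re - 1} := by
      refine ⟨max_lt ?_ ?_, ?_⟩ <;> simp <;> linarith
    have := (h.differentiableAt (hopen.mem_nhds hmem)).comp z (f := fun z : ℂ => -z - 2)
      (by fun_prop)
    exact this
  · filter_upwards [compl_mem_ae_iff.2 (measure_singleton (0 : Euc 2))] with u hu
    exact norm_pos_iff.2 hu
  · obtain ⟨h1, h2⟩ := max_lt_iff.1 hs
    refine (integrable_norm_rpow_mul_gaugeSection e hg hp h1 (by linarith)).congr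
      (.of_forall fun u => ?_)
    simp only [Complex.norm_real]
    rw [Real.norm_of_nonneg (gaugeSection_nonneg e p u)]

lemma differentiable_cutoffMoment_comp (hη : IsCutoff η a b) (c : ℂ) :
    Differentiable ℂ fun z => cutoffMoment η a b (c - z) :=
  (differentiable_cutoffMoment hη).comp (by fun_prop)

/-- Every regularised action is given by the Fourier side. -/
theorem IsRegularizedAction.cutoffMoment_mul_eq (hg : IsSmoothGauge g) (hη : IsCutoff η a b)
    {p c : ℝ} (hp : 0 ≤ p) (hc : -2 < c) (hcp : c < finrank ℝ H - p) {G : ℂ → ℂ}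
    (hG : IsRegularizedAction (gaugeSection g e p) c G) {z : ℂ} (hz : -2 < z.re) (hzc : z.re ≤ c) :
    cutoffMoment η a b (finrank ℝ H - p - z) * G z = fourierMoment g e η p z := by
  set U : Set ℂ := {z | -2 < z.re ∧ z.re ≤ c} with hU
  have hUconv : Convex ℝ U := by
    have h1 : Convex ℝ {z : ℂ | -2 < z.re} := convex_halfSpace_re_gt _
    have h2 : Convex ℝ {z : ℂ | z.re ≤ c} := convex_halfSpace_re_le _
    exact h1.inter h2
  have hA : AnalyticOnNhd ℂ (fun z => cutoffMoment η a b (finrank ℝ H - p - z) * G z) U := by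
    refine AnalyticOnNhd.mul ?_ (hG.analytic.mono fun z hz => hz.2)
    exact ((differentiable_cutoffMoment_comp hη _).differentiableOn.analyticOnNhd
      isOpen_univ).mono (Set.subset_univ _)
  have hB : AnalyticOnNhd ℂ (fourierMoment g e η p) U :=
    (analyticOnNhd_fourierMoment e hg hη p).mono fun z hz => hz.1
  -- A base point for the identity theorem, inside the strip where the defining integral converges
  -- and the planar Riesz formula is available.
  obtain ⟨x, hx1, hx2⟩ := exists_between (lt_min hc (show (-2 : ℝ) < 0 by norm_num))
  obtain ⟨hx3, hx4⟩ := lt_min_iff.1 hx2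
  refine hA.eqOn_of_preconnected_of_eventuallyEq hB hUconv.isPreconnected (z₀ := (x : ℂ))
    ⟨by simpa using hx1, by simpa using hx3.le⟩ ?_ ⟨hz, hzc⟩
  have hopen : IsOpen {z : ℂ | -2 < z.re ∧ z.re < c ∧ z.re < 0} :=
    (isOpen_lt_re _).inter ((isOpen_re_lt _).inter (isOpen_re_lt _))
  filter_upwards [hopen.mem_nhds (⟨by simpa using hx1, by simpa using hx3, by simpa using hx4⟩ :
    (x : ℂ) ∈ {z : ℂ | -2 < z.re ∧ z.re < c ∧ z.re < 0})] with w hw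
  obtain ⟨hw1, hw2, hw3⟩ := hw
  rw [hG.eq_integral w hw2.le hw3]
  exact cutoffMoment_mul_sectionMoment e hg hη hp hw1 hw3 (hw2.trans hcp)

/-- For -2 < Re z < 0 both sides equal the product of the two cutoff moments with the action on A;
the identity theorem extends this. It makes the quotient Fourier moment over cutoff moment
independent of the cutoff, hence fit to define the continuation. -/
lemma cutoffMoment_mul_fourierMoment {η' : ℝ → ℂ} {a' b' : ℝ} (hg : IsSmoothGauge g)
    (hη : IsCutoff η a b) (hη' : IsCutoff η' a' b') {p : ℝ} (hp : 0 ≤ p)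
    (hpm : p < finrank ℝ H) {z : ℂ} (hz : -2 < z.re) :
    cutoffMoment η a b (finrank ℝ H - p - z) * fourierMoment g e η' p z =
      cutoffMoment η' a' b' (finrank ℝ H - p - z) * fourierMoment g e η p z := by
  have hU : Convex ℝ {z : ℂ | -2 < z.re} := convex_halfSpace_re_gt _
  have hA : ∀ {η η' : ℝ → ℂ} {a b a' b' : ℝ}, IsCutoff η a b → IsCutoff η' a' b' →
      AnalyticOnNhd ℂ (fun z => cutoffMoment η a b (finrank ℝ H - p - z) *
        fourierMoment g e η' p z) {z : ℂ | -2 < z.re} := by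
    intro η η' a b a' b' hη hη'
    refine AnalyticOnNhd.mul ?_ (analyticOnNhd_fourierMoment e hg hη' p)
    exact ((differentiable_cutoffMoment_comp hη _).differentiableOn.analyticOnNhd
      isOpen_univ).mono (Set.subset_univ _)
  refine (hA hη hη').eqOn_of_preconnected_of_eventuallyEq (hA hη' hη) hU.isPreconnected
    (z₀ := -1) (by simp) ?_ hz
  filter_upwards [((isOpen_lt_re (-2)).inter (isOpen_re_lt 0)).mem_nhds
    (⟨by simp, by simp⟩ : (-1 : ℂ) ∈ {z : ℂ | -2 < z.re} ∩ {z : ℂ | z.re < 0})] with w hw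
  obtain ⟨hw1, hw2⟩ := hw
  have hw2 : w.re < 0 := hw2
  rw [← cutoffMoment_mul_sectionMoment e hg hη hp hw1 hw2 (by linarith),
    ← cutoffMoment_mul_sectionMoment e hg hη' hp hw1 hw2 (by linarith)]
  ring

/-- Existence of the regularised action. -/
theorem exists_isRegularizedAction (hg : IsSmoothGauge g) {p c : ℝ} (hp : 0 ≤ p)
    (hcp : c < finrank ℝ H - p) :
    ∃ G, IsRegularizedAction (gaugeSection g e p) c G := by
  classical
  obtain ⟨κ, hκ, hκ0, hκ1⟩ := exists_normalized_cutoff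
  set m : ℂ := (finrank ℝ H : ℂ) - p with hm
  have hmre : m.re = finrank ℝ H - p := by simp [hm]
  have hη : ∀ z : ℂ, IsCutoff (cutPow κ (-(m - z))) 1 2 := fun z => isCutoff_cutPow hκ hκ0 _
  have hM : ∀ z : ℂ, cutoffMoment (cutPow κ (-(m - z))) 1 2 (m - z) = m - z := fun z =>
    cutoffMoment_cutPow hκ hκ0 hκ1 _
  have hne : ∀ z : ℂ, z.re < finrank ℝ H - p → m - z ≠ 0 := by
    intro z hz h
    have := congrArg Complex.re h
    rw [Complex.sub_re, hmre, Complex.zero_re] at this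
    linarith
  -- For Re z ≥ 0 the cutoff varies with z, so that its moment is exactly m - z, which does not
  -- vanish on the half-plane.
  set G : ℂ → ℂ := fun z => if z.re < 0 then (Complex.Gamma (-z / 2))⁻¹ * sectionMoment g e p z
    else fourierMoment g e (cutPow κ (-(m - z))) p z / (m - z) with hGdef
  refine ⟨G, ?_, fun z hzc hz0 => ?_, fun z hzc hz0 => ?_⟩
  · intro z₀ hz₀
    have hz₀ : z₀.re ≤ c := hz₀
    rcases lt_or_ge z₀.re 0 with h0 | h0
    · have hopen : IsOpen {z : ℂ | z.re < 0 ∧ z.re < finrank ℝ H - p} :=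
        (isOpen_re_lt _).inter (isOpen_re_lt _)
      have hd : DifferentiableOn ℂ G {z : ℂ | z.re < 0 ∧ z.re < finrank ℝ H - p} := by
        refine DifferentiableOn.congr (f := fun z => (Complex.Gamma (-z / 2))⁻¹ *
          sectionMoment g e p z) ?_ fun z hz => if_pos hz.1
        refine DifferentiableOn.mul ?_ (differentiableOn_sectionMoment e hg hp)
        exact (Complex.differentiable_one_div_Gamma.comp (by fun_prop :
          Differentiable ℂ fun z : ℂ => -z / 2)).differentiableOn
      exact hd.analyticOnNhd hopen z₀ ⟨h0, by linarith⟩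
    · have hpm : p < finrank ℝ H := by linarith
      have hz₀' : -2 < z₀.re := by linarith
      -- Analyticity at z₀ is seen with the cutoff frozen at z₀: by independence of the cutoff, G is
      -- near z₀ a quotient of analytic functions with nonzero denominator, also across Re z = 0.
      have key : ∀ z : ℂ, -2 < z.re → z.re < finrank ℝ H - p →
          cutoffMoment (cutPow κ (-(m - z₀))) 1 2 (m - z) * G z =
            fourierMoment g e (cutPow κ (-(m - z₀))) p z := by
        intro z hz hzp
        by_cases hz0 : z.re < 0
        · simp only [hGdef, if_pos hz0]
          exact cutoffMoment_mul_sectionMoment e hg (hη z₀) hp hz hz0 hzp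
        · simp only [hGdef, if_neg hz0]
          have := cutoffMoment_mul_fourierMoment e hg (hη z₀) (hη z) hp hpm hz
          rw [hM z] at this
          rw [← mul_div_assoc, this, mul_div_cancel_left₀ _ (hne z hzp)]
      have hMd := differentiable_cutoffMoment_comp (hη z₀) m
      have hMne : ∀ᶠ z in nhds z₀, cutoffMoment (cutPow κ (-(m - z₀))) 1 2 (m - z) ≠ 0 := by
        refine (hMd.continuous.continuousAt).eventually_ne ?_
        rw [hM z₀]
        exact hne z₀ (by linarith)
      have hev : (fun z => fourierMoment g e (cutPow κ (-(m - z₀))) p z /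
          cutoffMoment (cutPow κ (-(m - z₀))) 1 2 (m - z)) =ᶠ[nhds z₀] G := by
        filter_upwards [hMne, (isOpen_lt_re (-2)).mem_nhds hz₀', (isOpen_re_lt _).mem_nhds
          (show z₀.re < finrank ℝ H - p by linarith)] with z h1 h2 h3
        rw [← key z h2 h3, mul_div_cancel_left₀ _ h1]
      refine AnalyticAt.congr ?_ hev
      refine (analyticOnNhd_fourierMoment e hg (hη z₀) p z₀ hz₀').div ?_ hMne.self_of_nhds
      exact hMd.differentiableOn.analyticOnNhd isOpen_univ z₀ trivial
  · refine (integrable_norm_cpow_mul_iff (f := fun u => (gaugeSection g e p u : ℂ))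
      (Complex.measurable_ofReal.comp (measurable_gaugeSection e hg p)).aestronglyMeasurable _).2 ?_
    refine (integrable_norm_rpow_mul_gaugeSection e hg hp (s := (-z - 2).re) (by simp; linarith)
      (by simp; linarith)).congr (.of_forall fun u => ?_)
    simp only [Complex.norm_real]
    rw [Real.norm_of_nonneg (gaugeSection_nonneg e p u)]
  · simp only [hGdef, if_pos hz0]
    rfl

end Regularization

/-! ### The circle integral of the Fourier transform as a plane integral. -/

section Circle

variable {N : ℕ} {H : Submodule ℝ (Euc N)} (e : OrthonormalBasis (Fin 2) ℝ Hᗮ) {g : Euc N → ℝ}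

lemma circleInt_congr {F₁ F₂ : Euc N → ℂ} (h : Set.EqOn F₁ F₂ {0}ᶜ) :
    circleInt e F₁ = circleInt e F₂ := by
  refine intervalIntegral.integral_congr fun t _ => h ?_
  have h1 : ‖(!₂[Real.cos t, Real.sin t] : Euc 2)‖ = 1 := by
    rw [EuclideanSpace.norm_eq]
    simp
  have : ‖planePoint e !₂[Real.cos t, Real.sin t]‖ ≠ 0 := by rw [norm_planePoint, h1]; norm_num
  exact norm_ne_zero_iff.1 this

/-- The circle average of the Fourier transform in terms of the sections of a smooth weight. -/
theorem circleInt_eq_integral (hg : IsSmoothGauge g) {κ : ℝ → ℝ} (hκ : ContDiff ℝ ∞ κ)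
    (h0 : ∀ t, t ∉ Set.Icc 1 2 → κ t = 0) (h1 : ∫ t in Set.Ioi (0 : ℝ), κ t / t = 1) {s p q : ℝ}
    (hq : -2 < q) (hsp : 0 < s + p) (hN : s + p + q + 2 = N) {f : Euc N → ℝ}
    (hf : ∀ x, f x = g x ^ (-s) * ‖x‖ ^ (-p)) {F : Euc N → ℂ} (hF : IsFourierTransform f F) :
    circleInt e F = ∫ u : Euc 2, (‖u‖ : ℂ) ^ (q : ℂ) *
      angFourier (sectionInt e (weight g (cutPow κ (-s)) p)) u := by
  have hF' := isFourierTransform_radial hg hκ h0 h1 hsp (by linarith) hf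
  rw [circleInt_congr e (hF.eqOn hF')]
  have hη := isCutoff_cutPow hκ h0 (-(s : ℂ))
  have hexp : (N : ℂ) - (s + p) = q + 2 := by
    have : (N : ℂ) = ((s + p + q + 2 : ℝ) : ℂ) := by rw [hN]; simp
    rw [this]
    push_cast
    ring
  have hplane : ∀ u, angFourier (weight g (cutPow κ (-s)) p) (planePoint e u) =
      angFourier (sectionInt e (weight g (cutPow κ (-s)) p)) u := fun u =>
    angFourier_planePoint e (weightSchwartz hg hη p).integrable u
  rw [hexp, circleInt_radial]
  · simp_rw [hplane]
  · simp_rw [hplane]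
    have := integrable_norm_cpow_mul_schwartz (z := (q : ℂ)) (by
      rw [finrank_euclideanSpace_fin]
      exact_mod_cast hq) (schwartzFourier
      (sectionSchwartz e (contDiff_weight hg hη p) (hasCompactSupport_weight hg hη p)))
    rwa [coe_schwartzFourier, coe_sectionSchwartz] at this

end Circle

/-! ### The formula of part (1). -/

section Main

variable {n : ℕ} (D : ConvexBody (Euc (2 * n)))

lemma exists_isFourierTransform (hg : IsSmoothGauge (gauge (D : Set (Euc (2 * n))))) {s p : ℝ}
    (hs : 0 < s + p) (hs' : s + p < 2 * n) : ∃ F, IsFourierTransform (normPower D s p) F := by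
  obtain ⟨κ, hκ, hκ0, hκ1⟩ := exists_normalized_cutoff
  exact ⟨_, isFourierTransform_radial hg hκ hκ0 hκ1 hs (by push_cast; exact hs') fun x => rfl⟩

/-- The regularised action as an integral of the Fourier transform over the circle. -/
theorem regularizedAction_eq_circleInt (hD_int : (interior (D : Set (Euc (2 * n)))).Nonempty)
    (hD_symm : ∀ x ∈ D, -x ∈ D) (hD_smooth : IsInfinitelySmooth D)
    {H : Submodule ℝ (Euc (2 * n))} (hH : finrank ℝ H + 2 = 2 * n)
    (e : OrthonormalBasis (Fin 2) ℝ Hᗮ) {q p : ℝ} (hq : -2 < q) (hq' : q < 2 * n - 2) (hp : 0 ≤ p)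
    (hpq : p ≤ 2 * n - q - 3) {G : ℂ → ℂ} {F : Euc (2 * n) → ℂ}
    (hG : IsRegularizedAction (sectionFun D H e p) (2 * n - p - 3) G)
    (hF : IsFourierTransform (normPower D (2 * n - q - p - 2) p) F) :
    G (q : ℂ) = (((2 : ℝ) ^ (-q - 2) /
      (Real.pi * Real.Gamma ((q + 2) / 2) * (2 * n - q - p - 2)) : ℝ) : ℂ) * circleInt e F := by
  have hg := isSmoothGauge_gauge D hD_int hD_symm hD_smooth
  obtain ⟨κ, hκ, hκ0, hκ1⟩ := exists_normalized_cutoff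
  have hm : (finrank ℝ H : ℝ) = 2 * n - 2 := by
    have : (finrank ℝ H : ℝ) + 2 = 2 * n := by exact_mod_cast hH
    linarith
  have hmC : (finrank ℝ H : ℂ) = 2 * n - 2 := by exact_mod_cast congrArg (fun x : ℝ => (x : ℂ)) hm
  rw [sectionFun_eq_gaugeSection e D hD_int hD_symm] at hG
  set s : ℝ := 2 * n - q - p - 2 with hs
  have hc := circleInt_eq_integral e hg hκ hκ0 hκ1 (s := s) (p := p) hq (by rw [hs]; linarith)
    (by rw [hs]; push_cast; ring) (fun x => rfl) hF
  have h := hG.cutoffMoment_mul_eq e hg (isCutoff_cutPow hκ hκ0 (-(s : ℂ))) hp (by linarith)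
    (by linarith) (z := (q : ℂ)) (by simpa using hq) (by simp; linarith)
  have hsC : (finrank ℝ H : ℂ) - p - q = s := by
    rw [hmC, hs]
    push_cast
    ring
  -- At z = q the moment is taken at m - p - q = s, the very exponent of the cutoff, so it equals s.
  rw [hsC, cutoffMoment_cutPow hκ hκ0 hκ1, fourierMoment, ← hc] at h
  have hs0 : (s : ℂ) ≠ 0 := by
    have : 0 < s := by rw [hs]; linarith
    exact_mod_cast this.ne'
  have hpow : ((2 ^ (-q - 2) : ℝ) : ℂ) = (2 : ℂ) ^ (-(q : ℂ) - 2) := by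
    rw [Complex.ofReal_cpow (by norm_num)]
    push_cast
    rfl
  have hGam : ((Real.Gamma ((q + 2) / 2) : ℝ) : ℂ) = Complex.Gamma (((q : ℂ) + 2) / 2) := by
    rw [← Complex.Gamma_ofReal]
    push_cast
    rfl
  rw [Complex.ofReal_div, Complex.ofReal_mul, Complex.ofReal_mul, hpow, hGam]
  refine mul_left_cancel₀ hs0 (h.trans ?_)
  have hGne : Complex.Gamma (((q : ℂ) + 2) / 2) ≠ 0 :=
    Complex.Gamma_ne_zero_of_re_pos (by simp; linarith)
  have hpi : (Real.pi : ℂ) ≠ 0 := by exact_mod_cast Real.pi_ne_zero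
  field_simp

end Main

/-! ### Regularity of solutions of a refinement equation. -/

section SelfSimilar

variable {V F : Type*} [NormedAddCommGroup V] [NormedSpace ℝ V] [NormedAddCommGroup F]
  [NormedSpace ℝ F] [CompleteSpace F]

/-- A bounded solution of the refinement equation `S(u) = Q(u) + θ S(2u)` with smooth compactly
supported `Q` is `k` times continuously differentiable if `2 ^ k θ < 1`. -/
theorem contDiff_of_self_similar {Q S : V → F} {θ C : ℝ} {k : ℕ} (hQ : ContDiff ℝ ∞ Q)
    (hQc : HasCompactSupport Q) (hS : ∀ u, ‖S u‖ ≤ C) (h : ∀ u, S u = Q u + θ • S ((2 : ℝ) • u))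
    (hθ : 0 ≤ θ) (hk : θ * 2 ^ k < 1) : ContDiff ℝ k S := by
  have hθ1 : θ < 1 := by
    refine lt_of_le_of_lt ?_ hk
    exact le_mul_of_one_le_right hθ (one_le_pow₀ one_le_two)
  -- Iterating the equation gives a telescoping series. Each of i derivatives of the j-th term costs
  -- a factor 2^j, so 2^k θ < 1 gives geometric convergence through order k.
  have hpart : ∀ (n : ℕ) (u : V), ∑ j ∈ Finset.range n, θ ^ j • Q ((2 : ℝ) ^ j • u) =
      S u - θ ^ n • S ((2 : ℝ) ^ n • u) := by
    intro n u
    induction n with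
    | zero => simp
    | succ n ih =>
      rw [Finset.sum_range_succ, ih, h ((2 : ℝ) ^ n • u), smul_add, smul_smul, smul_smul,
        ← pow_succ, ← pow_succ']
      abel
  choose M hM using fun i : ℕ => (hQ.continuous_iteratedFDeriv (m := i)
    (mod_cast le_top)).bounded_above_of_compact_support (hQc.iteratedFDeriv i)
  have hM0 : ∀ i, 0 ≤ M i := fun i => (norm_nonneg _).trans (hM i 0)
  have hd : ∀ (i j : ℕ) (u : V),
      ‖iteratedFDeriv ℝ i (fun u => θ ^ j • Q ((2 : ℝ) ^ j • u)) u‖ ≤ (θ * 2 ^ i) ^ j * M i := by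
    intro i j u
    have hQi : ContDiff ℝ i Q := hQ.of_le (mod_cast le_top)
    have hQi' : ContDiff ℝ i fun u => Q ((2 : ℝ) ^ j • u) := by fun_prop
    rw [iteratedFDeriv_const_smul_apply' hQi'.contDiffAt,
      iteratedFDeriv_comp_const_smul _ hQi, norm_smul, norm_smul]
    simp only [norm_pow, Real.norm_ofNat, Real.norm_of_nonneg hθ]
    rw [mul_pow, ← pow_mul, ← pow_mul, mul_comm i j, ← mul_assoc]
    exact mul_le_mul_of_nonneg_left (hM i _) (by positivity)
  have hv : ∀ i : ℕ, (i : ℕ∞) ≤ (k : ℕ∞) → Summable fun j : ℕ => (θ * 2 ^ i) ^ j * M i := by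
    intro i hi
    refine (summable_geometric_of_lt_one (by positivity) (lt_of_le_of_lt ?_ hk)).mul_right _
    exact mul_le_mul_of_nonneg_left
      (pow_le_pow_right₀ one_le_two (by exact_mod_cast hi)) hθ
  have hsum := contDiff_tsum (𝕜 := ℝ) (N := k) (f := fun (j : ℕ) u => θ ^ j • Q ((2 : ℝ) ^ j • u))
    (v := fun i j => (θ * 2 ^ i) ^ j * M i)
    (fun j => (hQ.of_le (mod_cast le_top)).comp (contDiff_const_smul _) |>.const_smul (θ ^ j)) hv
    (fun i j u _ => hd i j u)
  have : S = fun u => ∑' j : ℕ, θ ^ j • Q ((2 : ℝ) ^ j • u) := by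
    funext u
    refine (HasSum.tsum_eq ?_).symm
    have hs : Summable fun j : ℕ => θ ^ j • Q ((2 : ℝ) ^ j • u) := by
      refine Summable.of_norm_bounded (hv 0 (by simp)) fun j => ?_
      simpa using hd 0 j u
    have h0 : Filter.Tendsto (fun n : ℕ => θ ^ n • S ((2 : ℝ) ^ n • u)) Filter.atTop (nhds 0) := by
      have := (tendsto_pow_atTop_nhds_zero_of_lt_one hθ hθ1).mul_const C
      rw [zero_mul] at this
      refine squeeze_zero_norm (fun n => ?_) this
      rw [norm_smul, norm_pow, Real.norm_of_nonneg hθ]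
      exact mul_le_mul_of_nonneg_left (hS _) (by positivity)
    have h1 := (tendsto_const_nhds (x := S u)).sub h0
    rw [sub_zero] at h1
    rw [hs.hasSum_iff_tendsto_nat]
    exact h1.congr fun n => (hpart n u).symm
  rw [this]
  exact_mod_cast hsum

end SelfSimilar

/-! ### Polar coordinates and smooth integrals over spheres. -/

section Polar

variable {E F : Type*} [NormedAddCommGroup E] [NormedSpace ℝ E] [FiniteDimensional ℝ E]
  [MeasurableSpace E] [BorelSpace E] [NormedAddCommGroup F] [NormedSpace ℝ F]

/-- Integration in polar coordinates. -/
theorem integral_eq_integral_sphere [Nontrivial E] (μ : Measure E) [μ.IsAddHaarMeasure] {f : E → F}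
    (hf : Integrable f μ) :
    ∫ x, f x ∂μ = ∫ θ : Metric.sphere (0 : E) 1, ∫ r in Set.Ioi (0 : ℝ),
      r ^ (finrank ℝ E - 1) • f (r • (θ : E)) ∂volume ∂μ.toSphere := by
  have hmp := μ.measurePreserving_homeomorphUnitSphereProd
  have hme := (homeomorphUnitSphereProd E).measurableEmbedding
  set w : Metric.sphere (0 : E) 1 × Set.Ioi (0 : ℝ) → F := fun z => f (z.2.1 • (z.1 : E)) with hw
  have hcomp : ∀ x : ({0}ᶜ : Set E), w (homeomorphUnitSphereProd E x) = f x := by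
    intro x
    have := congrArg Subtype.val ((homeomorphUnitSphereProd E).symm_apply_apply x)
    rw [homeomorphUnitSphereProd_symm_apply_coe] at this
    simp only [hw]
    rw [this]
  have hi : Integrable (fun x : ({0}ᶜ : Set E) => w (homeomorphUnitSphereProd E x))
      (μ.comap (↑)) := by
    simp_rw [hcomp]
    exact (integrableOn_iff_comap_subtypeVal (measurableSet_singleton _).compl).1 hf.integrableOn
  have hi' := (hmp.integrable_comp_emb (g := w) hme).1 hi
  calc
    _ = ∫ x : ({0}ᶜ : Set E), f x ∂μ.comap (↑) := by
      rw [integral_subtype_comap (measurableSet_singleton _).compl f, restrict_compl_singleton]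
    _ = ∫ z, w z ∂(μ.toSphere.prod (Measure.volumeIoiPow (finrank ℝ E - 1))) := by
      rw [← hmp.integral_comp hme]
      simp_rw [hcomp]
    _ = _ := by
      rw [integral_prod _ hi']
      refine integral_congr_ae (.of_forall fun θ => ?_)
      simp only [Measure.volumeIoiPow, ENNReal.ofReal]
      rw [integral_withDensity_eq_integral_smul,
        integral_subtype_comap measurableSet_Ioi
          fun a ↦ Real.toNNReal (a ^ (finrank ℝ E - 1)) • f (a • (θ : E)),
        setIntegral_congr_fun measurableSet_Ioi fun x hx ↦ ?_]
      · simp only [NNReal.smul_def]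
        rw [Real.coe_toNNReal _ (pow_nonneg hx.out.le _)]
      · exact (measurable_subtype_coe.pow_const _).real_toNNReal

/-- Smoothness of an integral over the sphere depending on a parameter. -/
theorem contDiffOn_integral_sphere {P : Type*} [NormedAddCommGroup P] [NormedSpace ℝ P]
    {E : Type*} [NormedAddCommGroup E] [InnerProductSpace ℝ E] [FiniteDimensional ℝ E]
    [MeasurableSpace E] [BorelSpace E]
    (μ : Measure (Metric.sphere (0 : E) 1)) [IsFiniteMeasure μ] {g : P → E → F} {s : Set P}
    (hs : IsOpen s) (hg : ContDiffOn ℝ ∞ (fun z : P × E => g z.1 z.2) (s ×ˢ {0}ᶜ)) :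
    ContDiffOn ℝ ∞ (fun p => ∫ θ, g p (θ : E) ∂μ) s := by
  have : ProperSpace E := FiniteDimensional.proper ℝ E
  -- The sphere measure is pushed forward to E, and the integrand is multiplied by a bump in |x|²
  -- that is 1 on the sphere and vanishes near 0, where g need not be smooth.
  let β : ContDiffBump (1 : ℝ) := ⟨1 / 4, 1 / 2, by norm_num, by norm_num⟩
  have hβ : ∀ x : E, β (‖x‖ ^ 2) ≠ 0 → 1 / 2 < ‖x‖ ^ 2 ∧ ‖x‖ ^ 2 < 3 / 2 := by
    intro x hx
    by_contra! h
    refine hx (β.zero_of_le_dist ?_)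
    simp only [β, Real.dist_eq]
    by_contra! h'
    rw [abs_lt] at h'
    linarith [h (by linarith)]
  have h := contDiffOn_integral_smul (μ := μ.map (↑)) (f := fun _ : E => 1) (n := ⊤)
    (g := fun p x => β (‖x‖ ^ 2) • g p x) (s := s) (K := Metric.closedBall 0 2) hs
    (isCompact_closedBall _ _) ?_ (locallyIntegrable_const _) ?_
  · refine h.congr fun p hp => ?_
    have hme : MeasurableEmbedding ((↑) : Metric.sphere (0 : E) 1 → E) :=
      MeasurableEmbedding.subtype_coe Metric.isClosed_sphere.measurableSet
    rw [hme.integral_map]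
    refine integral_congr_ae (.of_forall fun θ => ?_)
    have : ‖(θ : E)‖ = 1 := by simp
    simp only [one_smul, this]
    rw [one_pow, β.one_of_mem_closedBall (by simp [β]), one_smul]
  · intro p _ x hx
    rw [mem_closedBall_zero_iff] at hx
    have : β (‖x‖ ^ 2) = 0 := by
      by_contra hne
      nlinarith [(hβ x hne).2]
    rw [this, zero_smul]
  · rintro ⟨p, x⟩ ⟨hp, -⟩
    have hnorm : ContDiff ℝ ∞ fun z : P × E => ‖z.2‖ ^ 2 := contDiff_snd.norm_sq ℝ
    refine ContDiffAt.contDiffWithinAt ?_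
    rcases eq_or_ne x 0 with rfl | hx
    · have : (fun z : P × E => β (‖z.2‖ ^ 2) • g z.1 z.2) =ᶠ[nhds (p, 0)] fun _ => 0 := by
        filter_upwards [hnorm.continuous.continuousAt.eventually
          (gt_mem_nhds (show ‖((p, (0 : E)) : P × E).2‖ ^ 2 < (1 / 2 : ℝ) by simp))] with z hz
        have : β (‖z.2‖ ^ 2) = 0 := by
          by_contra hne
          linarith [(hβ z.2 hne).1]
        rw [this, zero_smul]
      exact contDiffAt_const.congr_of_eventuallyEq this
    · refine ContDiffAt.smul (β.contDiff.comp hnorm).contDiffAt ?_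
      exact hg.contDiffAt ((hs.prod isOpen_compl_singleton).mem_nhds ⟨hp, hx⟩)

end Polar

/-! ### Smoothness of the distance to the boundary along a ray. -/

section RadialDistance

variable {V : Type*} [NormedAddCommGroup V] [InnerProductSpace ℝ V] {g : V → ℝ}

/-- Convexity along a ray: r • y + x lies between x and r' • y + x. Stated without division. -/
lemma IsSmoothGauge.mul_le (hg : IsSmoothGauge g) (x y : V) {r r' : ℝ} (hr : 0 ≤ r) (h : r ≤ r') :
    r' * g (r • y + x) ≤ (r' - r) * g x + r * g (r' • y + x) := by
  rw [← hg.smul r' _ (hr.trans h), ← hg.smul (r' - r) x (by linarith), ← hg.smul r _ hr]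
  refine le_trans (le_of_eq (congrArg g ?_)) (hg.add_le _ _)
  module

lemma IsSmoothGauge.exists_eq_one (hg : IsSmoothGauge g) {x y : V} (hx : g x < 1) (hy : y ≠ 0) :
    ∃ r : ℝ, 0 < r ∧ g (r • y + x) = 1 := by
  obtain ⟨R, hR, hgR⟩ := hg.norm_le
  have hy' : 0 < ‖y‖ := norm_pos_iff.2 hy
  -- With |b y| = R + |x| the point b y + x has norm at least R, hence gauge at least 1.
  set b := (R + ‖x‖) / ‖y‖ with hb
  have hb0 : 0 < b := by positivity
  have hgb : 1 ≤ g (b • y + x) := by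
    have h1 := hgR (b • y + x)
    have h2 := norm_sub_le_norm_add (b • y) x
    rw [norm_smul, Real.norm_of_nonneg hb0.le, hb, div_mul_cancel₀ _ hy'.ne', ← hb] at h2
    exact le_of_mul_le_mul_left (by linarith) hR
  have hc : ContinuousOn (fun r : ℝ => g (r • y + x)) (Set.Icc 0 b) :=
    (hg.continuous.comp (by fun_prop)).continuousOn
  obtain ⟨r, hr, h⟩ := intermediate_value_Icc hb0.le hc
    (show (1 : ℝ) ∈ Set.Icc _ _ from ⟨by simpa using hx.le, hgb⟩)
  refine ⟨r, lt_of_le_of_ne hr.1 ?_, h⟩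
  rintro rfl
  simp only [zero_smul, zero_add] at h
  exact hx.ne h

/-- Convexity bounds the slope at the boundary below by the slope of the chord from r = 0. The bound
is positive for g x < 1, which is the nondegeneracy needed for the implicit function theorem. -/
lemma IsSmoothGauge.slope_le (hg : IsSmoothGauge g) {x y : V} {r₀ r : ℝ}
    (hr₀ : 0 < r₀) (h₀ : g (r₀ • y + x) = 1) (hr : 0 < r) (hne : r ≠ r₀) :
    (1 - g x) / r₀ ≤ slope (fun r : ℝ => g (r • y + x)) r₀ r := by
  rw [slope_def_field, h₀]
  rcases lt_or_gt_of_ne hne with h | h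
  · have := hg.mul_le x y hr.le h.le
    rw [h₀] at this
    rw [← neg_div_neg_eq (g (r • y + x) - 1), div_le_div_iff₀ hr₀ (by linarith)]
    nlinarith
  · have := hg.mul_le x y hr₀.le h.le
    rw [h₀] at this
    rw [div_le_div_iff₀ hr₀ (by linarith)]
    nlinarith

lemma IsSmoothGauge.le_one_iff (hg : IsSmoothGauge g) {x y : V} (hx : g x < 1) {r₀ r : ℝ}
    (hr₀ : 0 < r₀) (h₀ : g (r₀ • y + x) = 1) (hr : 0 ≤ r) : g (r • y + x) ≤ 1 ↔ r ≤ r₀ := by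
  constructor
  · intro h
    by_contra! hlt
    have := hg.mul_le x y hr₀.le hlt.le
    rw [h₀] at this
    nlinarith
  · intro h
    have := hg.mul_le x y hr h
    rw [h₀] at this
    nlinarith

/-- The distance in the direction `y` from an interior point `x` to the boundary of the body
`g ≤ 1` is a smooth function. -/
theorem IsSmoothGauge.exists_contDiffOn_radial [CompleteSpace V] (hg : IsSmoothGauge g) :
    ∃ ρ : V × V → ℝ, (∀ z : V × V, g z.1 < 1 → z.2 ≠ 0 → 0 < ρ z ∧
      ∀ r, 0 ≤ r → (g (r • z.2 + z.1) ≤ 1 ↔ r ≤ ρ z)) ∧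
      ContDiffOn ℝ ∞ ρ {z | g z.1 < 1 ∧ z.2 ≠ 0} := by
  choose! ρ hρ using fun z : V × V => fun (h : g z.1 < 1 ∧ z.2 ≠ 0) => hg.exists_eq_one h.1 h.2
  refine ⟨ρ, fun z h1 h2 => ⟨(hρ z ⟨h1, h2⟩).1, fun r hr =>
    hg.le_one_iff h1 (hρ z ⟨h1, h2⟩).1 (hρ z ⟨h1, h2⟩).2 hr⟩, fun z hz => ?_⟩
  refine ContDiffAt.contDiffWithinAt ?_
  have hopen : IsOpen {z : V × V | g z.1 < 1 ∧ z.2 ≠ 0} :=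
    (isOpen_lt (hg.continuous.comp continuous_fst) continuous_const).inter
      (isOpen_ne_fun continuous_snd continuous_const)
  obtain ⟨hpos, hone⟩ := hρ z hz
  set f : (V × V) × ℝ → ℝ := fun w => g (w.2 • w.1.2 + w.1.1) with hf
  have hne : ρ z • z.2 + z.1 ≠ 0 := by
    intro h
    rw [h, hg.zero] at hone
    exact zero_ne_one hone
  have hfc : ContDiffAt ℝ ∞ f (z, ρ z) := by
    have h1 : ContDiffAt ℝ ∞ g (ρ z • z.2 + z.1) :=
      hg.contDiffOn.contDiffAt (isOpen_compl_singleton.mem_nhds hne)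
    have h2 : ContDiffAt ℝ ∞ (fun w : (V × V) × ℝ => w.2 • w.1.2 + w.1.1) (z, ρ z) := by fun_prop
    exact h1.comp (z, ρ z) h2
  have hder : HasDerivAt (fun r : ℝ => g (r • z.2 + z.1)) (fderiv ℝ f (z, ρ z) (0, 1)) (ρ z) := by
    have h1 : HasDerivAt (fun r : ℝ => (z, r)) ((0 : V × V), (1 : ℝ)) (ρ z) :=
      (hasDerivAt_const (ρ z) z).prodMk (hasDerivAt_id (ρ z))
    exact (hfc.differentiableAt (by simp)).hasFDerivAt.comp_hasDerivAt (ρ z) h1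
  have hD : 0 < fderiv ℝ f (z, ρ z) (0, 1) := by
    refine lt_of_lt_of_le (div_pos (sub_pos.2 hz.1) hpos)
      (ge_of_tendsto (hasDerivAt_iff_tendsto_slope.1 hder) ?_)
    filter_upwards [mem_nhdsWithin_of_mem_nhds (lt_mem_nhds hpos), self_mem_nhdsWithin] with r hr h
    exact hg.slope_le hpos hone hr h
  have hinv : (fderiv ℝ f (z, ρ z) ∘L .inr ℝ (V × V) ℝ).IsInvertible := by
    refine ⟨ContinuousLinearEquiv.unitsEquivAut ℝ (Units.mk0 _ hD.ne'), ?_⟩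
    ext
    simp
  have hn : (∞ : WithTop ℕ∞) ≠ 0 := by simp
  have hψ := hfc.contDiffAt_implicitFunction hn hinv
  have hψ0 := hfc.implicitFunction_apply_self hn hinv
  have hψ1 := hfc.eventually_apply_implicitFunction hn hinv
  set ψ := hfc.implicitFunction hn hinv
  -- A ray from an interior point meets the boundary only once, so the chosen ρ agrees locally with
  -- the smooth implicit function.
  refine hψ.congr_of_eventuallyEq ?_
  have hev : ∀ᶠ w in nhds z, 0 < ψ w :=
    hψ.continuousAt.eventually (lt_mem_nhds (by rw [hψ0]; exact hpos))
  filter_upwards [hev, hψ1, hopen.mem_nhds hz] with w h1 h2 h3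
  obtain ⟨h4, h5⟩ := hρ w h3
  have h6 : g (ψ w • w.2 + w.1) = 1 := h2.trans hone
  exact le_antisymm ((hg.le_one_iff h3.1 h1 h6 h4.le).1 h5.le)
    ((hg.le_one_iff h3.1 h4 h5 h1.le).1 h6.le)

end RadialDistance

/-! ### Sections of a smooth density. -/

section SmoothPart

variable {N : ℕ} {H : Submodule ℝ (Euc N)} (e : OrthonormalBasis (Fin 2) ℝ Hᗮ) {g : Euc N → ℝ}

lemma integrable_indicator_gauge (hg : IsSmoothGauge g) {b : Euc N → ℂ} (hb : Continuous b)
    (u : Euc 2) :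
    Integrable fun h : H => {x | g x ≤ 1}.indicator b ((h : Euc N) + planePoint e u) := by
  obtain ⟨R, hR, hgR⟩ := hg.norm_le
  have hc : Continuous fun h : H => (h : Euc N) + planePoint e u := by fun_prop
  have hcl : IsClosed {h : H | g ((h : Euc N) + planePoint e u) ≤ 1} :=
    isClosed_le (hg.continuous.comp hc) continuous_const
  have hK : IsCompact {h : H | g ((h : Euc N) + planePoint e u) ≤ 1} := by
    refine (isCompact_closedBall (0 : H) R).of_isClosed_subset hcl fun h hh => ?_
    have hh : g ((h : Euc N) + planePoint e u) ≤ 1 := hh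
    rw [mem_closedBall_zero_iff]
    refine (norm_le_norm_add_planePoint e h u).trans ((hgR _).trans ?_)
    nlinarith
  have : IntegrableOn (fun h : H => b ((h : Euc N) + planePoint e u))
      {h : H | g ((h : Euc N) + planePoint e u) ≤ 1} :=
    (hb.comp hc).continuousOn.integrableOn_compact hK
  exact (integrable_indicator_iff hcl.measurableSet).2 this

/-- Sections of a smooth density over a smooth convex body depend smoothly on the section. -/
theorem contDiffOn_integral_indicator_gauge [Nontrivial H] (hg : IsSmoothGauge g) {b : Euc N → ℂ}
    (hb : ContDiff ℝ ∞ b) :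
    ContDiffOn ℝ ∞
      (fun u => ∫ h : H, {x | g x ≤ 1}.indicator b ((h : Euc N) + planePoint e u))
      {u | g (planePoint e u) < 1} := by
  obtain ⟨ρ, hρ, hρc⟩ := hg.exists_contDiffOn_radial
  set m := finrank ℝ H with hm
  have hm0 : 0 < m := finrank_pos
  have hs : IsOpen {u : Euc 2 | g (planePoint e u) < 1} :=
    isOpen_lt (hg.continuous.comp (continuous_planePoint e)) continuous_const
  let χ : ContDiffBump (0 : ℝ) := ⟨1, 2, by norm_num, by norm_num⟩
  set σ : Euc 2 × H → ℝ := fun z => ρ (planePoint e z.1, (z.2 : Euc N)) with hσ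
  have hσc : ContDiffOn ℝ ∞ σ ({u | g (planePoint e u) < 1} ×ˢ {0}ᶜ) := by
    refine hρc.comp (t := {z | g z.1 < 1 ∧ z.2 ≠ 0})
      (f := fun z : Euc 2 × H => (planePoint e z.1, (z.2 : Euc N))) ?_ ?_
    · refine ContDiff.contDiffOn ?_
      exact ((contDiff_planePoint e).comp contDiff_fst).prodMk
        (H.subtypeL.contDiff.comp contDiff_snd)
    · rintro ⟨u, h⟩ ⟨hu, hh⟩
      exact ⟨hu, fun h0 => hh (by simpa using h0)⟩
  -- The substitution r = sσ makes the radial domain the fixed interval (0, 1], so the moving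
  -- boundary enters only through the smooth σ. The bump χ is 1 there and only supplies compact
  -- support.
  set J : Euc 2 × H → ℂ := fun z => ∫ s : ℝ, (Set.Ioc (0 : ℝ) 1).indicator (fun s => s ^ (m - 1)) s •
    (χ s • (σ z ^ m • b ((s * σ z) • (z.2 : Euc N) + planePoint e z.1))) with hJ
  have hJc : ContDiffOn ℝ ∞ J ({u | g (planePoint e u) < 1} ×ˢ {0}ᶜ) := by
    refine contDiffOn_integral_smul (n := ⊤) (V := ℝ) (K := Metric.closedBall 0 2)
      (g := fun z s => χ s • (σ z ^ m • b ((s * σ z) • (z.2 : Euc N) + planePoint e z.1)))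
      (hs.prod isOpen_compl_singleton) (isCompact_closedBall _ _) ?_ ?_ ?_
    · intro z _ s hs
      rw [χ.zero_of_le_dist (by rw [Metric.mem_closedBall, not_le] at hs; exact hs.le), zero_smul]
    · refine Integrable.locallyIntegrable ?_
      rw [integrable_indicator_iff measurableSet_Ioc]
      exact ((continuous_pow _).integrableOn_Icc).mono_set Set.Ioc_subset_Icc_self
    · have hσ' : ContDiffOn ℝ ∞ (fun w : (Euc 2 × H) × ℝ => σ w.1)
          (({u | g (planePoint e u) < 1} ×ˢ {0}ᶜ) ×ˢ Set.univ) :=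
        hσc.comp contDiffOn_fst fun w hw => hw.1
      have hpp : ContDiff ℝ ∞ fun w : (Euc 2 × H) × ℝ => planePoint e w.1.1 :=
        (contDiff_planePoint e).comp (contDiff_fst.comp contDiff_fst)
      have hh : ContDiff ℝ ∞ fun w : (Euc 2 × H) × ℝ => (w.1.2 : Euc N) :=
        H.subtypeL.contDiff.comp (contDiff_snd.comp contDiff_fst)
      refine ContDiffOn.smul (χ.contDiff.comp contDiff_snd).contDiffOn ?_
      refine ContDiffOn.smul (hσ'.pow m) (hb.comp_contDiffOn ?_)
      exact ((contDiff_snd.contDiffOn.mul hσ').smul hh.contDiffOn).add hpp.contDiffOn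
  have hkey := contDiffOn_integral_sphere (volume : Measure H).toSphere (g := fun u h => J (u, h))
    hs hJc
  refine hkey.congr fun u hu => ?_
  rw [integral_eq_integral_sphere _ (integrable_indicator_gauge e hg hb.continuous u)]
  refine integral_congr_ae (.of_forall fun θ => ?_)
  have hθ : ((θ : H) : Euc N) ≠ 0 := by
    intro h0
    have h1 : ‖(θ : H)‖ = 1 := by simp
    rw [Submodule.coe_eq_zero.1 h0, norm_zero] at h1
    exact zero_ne_one h1
  obtain ⟨hpos, hiff⟩ := hρ (planePoint e u, ((θ : H) : Euc N)) hu hθ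
  set c := ρ (planePoint e u, ((θ : H) : Euc N)) with hc
  set f : ℝ → ℂ := fun r => r ^ (m - 1) • b (r • ((θ : H) : Euc N) + planePoint e u) with hf
  have h1 : ∀ r ∈ Set.Ioi (0 : ℝ), r ^ (m - 1) • {x | g x ≤ 1}.indicator b
      (((r • (θ : H) : H) : Euc N) + planePoint e u) = (Set.Iic c).indicator f r := by
    intro r hr
    have := hiff r (le_of_lt hr)
    simp only [Set.indicator_apply, Set.mem_ofPred_eq, Set.mem_Iic, Submodule.coe_smul, this, hf]
    split_ifs <;> simp
  have h2 : J (u, (θ : H)) = ∫ s in (0 : ℝ)..1, c • f (c * s) := by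
    rw [intervalIntegral.integral_of_le zero_le_one, ← integral_indicator measurableSet_Ioc]
    refine integral_congr_ae (.of_forall fun s => ?_)
    simp only [Set.indicator_apply]
    split_ifs with hs
    · have : χ s = 1 := χ.one_of_mem_closedBall (by
        rw [mem_closedBall_zero_iff, Real.norm_of_nonneg hs.1.le]; exact hs.2)
      simp only [hf, hσ, this, ← hc, smul_smul, mul_comm s c]
      congr 1
      obtain ⟨k, hk⟩ := Nat.exists_eq_succ_of_ne_zero hm0.ne'
      rw [hk, Nat.succ_sub_one, pow_succ, mul_pow]
      ring
    · simp
  beta_reduce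
  rw [← hm, setIntegral_congr_fun measurableSet_Ioi h1, setIntegral_indicator measurableSet_Iic, h2,
    intervalIntegral.integral_smul, intervalIntegral.smul_integral_comp_mul_left,
    mul_zero, mul_one, intervalIntegral.integral_of_le hpos.le]
  rfl

end SmoothPart

/-! ### Sections of the singular density near the origin. -/

section SingularPart

variable {N : ℕ} {H : Submodule ℝ (Euc N)} (e : OrthonormalBasis (Fin 2) ℝ Hᗮ) {g : Euc N → ℝ}

/-- Scaling of the sections of a smooth weight. -/
lemma sectionInt_weight_comp_mul (hg : IsSmoothGauge g) (η : ℝ → ℂ) (p : ℝ) {t : ℝ} (ht : 0 < t)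
    (u : Euc 2) :
    sectionInt e (weight g (fun s => η (t * s)) p) u =
      (t ^ (p - finrank ℝ H)) • sectionInt e (weight g η p) (t • u) := by
  have h := Measure.integral_comp_smul_of_nonneg (volume : Measure H)
    (fun h : H => weight g η p ((h : Euc N) + planePoint e (t • u))) t (hR := ht.le)
  rw [sectionInt, sectionInt, Real.rpow_sub ht, Real.rpow_natCast, div_eq_mul_inv, mul_smul, ← h,
    ← integral_smul]
  refine integral_congr_ae (.of_forall fun h => ?_)
  have hx : ((t • h : H) : Euc N) + planePoint e (t • u) =
      t • ((h : Euc N) + planePoint e u) := by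
    rw [planePoint_smul, smul_add]
    rfl
  simp only
  rw [hx, weight, weight, hg.smul t _ ht.le, norm_smul, Real.norm_of_nonneg ht.le,
    Real.mul_rpow ht.le (norm_nonneg _), Real.rpow_neg ht.le, Complex.real_smul]
  have : ((t ^ p : ℝ) : ℂ) ≠ 0 := by exact_mod_cast (Real.rpow_pos_of_pos ht p).ne'
  push_cast
  field_simp

lemma exists_smooth_step : ∃ l : ℝ → ℝ, ContDiff ℝ ∞ l ∧ (∀ t, t ≤ 1 / 2 → l t = 1) ∧
    (∀ t, 1 ≤ t → l t = 0) ∧ ∀ t, 0 ≤ l t ∧ l t ≤ 1 := by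
  refine ⟨fun t => Real.smoothTransition (2 - 2 * t), ?_, fun t ht => ?_, fun t ht => ?_,
    fun t => ⟨Real.smoothTransition.nonneg _, Real.smoothTransition.le_one _⟩⟩
  · exact Real.smoothTransition.contDiff.comp (by fun_prop)
  · exact Real.smoothTransition.one_of_one_le (by linarith)
  · exact Real.smoothTransition.zero_of_nonpos (by linarith)

variable {l : ℝ → ℝ}

lemma norm_weight_le (hl1 : ∀ t, 1 ≤ t → l t = 0)
    (hl : ∀ t, 0 ≤ l t ∧ l t ≤ 1) (p : ℝ) (x : Euc N) :
    ‖weight g (fun t => (l t : ℂ)) p x‖ ≤ {x | g x ≤ 1}.indicator (fun x => ‖x‖ ^ (-p)) x := by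
  rw [weight, norm_mul, Complex.norm_real, Complex.norm_real, Real.norm_of_nonneg (hl _).1,
    Real.norm_of_nonneg (by positivity)]
  rcases le_or_gt (g x) 1 with h | h
  · rw [Set.indicator_of_mem (by exact h)]
    exact mul_le_of_le_one_left (by positivity) (hl _).2
  · rw [Set.indicator_of_notMem (by exact not_le.2 h), hl1 _ h.le, zero_mul]

lemma integrable_indicator_norm_rpow (hg : IsSmoothGauge g) {p : ℝ} (hp : 0 ≤ p)
    (hp' : p < finrank ℝ H) (u : Euc 2) : Integrable fun h : H =>
      {x | g x ≤ 1}.indicator (fun x => ‖x‖ ^ (-p)) ((h : Euc N) + planePoint e u) := by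
  obtain ⟨R, hR, hgR⟩ := hg.norm_le
  have hcl : IsClosed {h : H | g ((h : Euc N) + planePoint e u) ≤ 1} :=
    isClosed_le (hg.continuous.comp (by fun_prop)) continuous_const
  have h1 := integrableOn_norm_add_rpow e (p₁ := p) (p₂ := 0) (Or.inr hp') hp le_rfl (Or.inl rfl)
    (u := u) (R + 1)
  rw [add_zero] at h1
  have h2 : {h : H | g ((h : Euc N) + planePoint e u) ≤ 1} ⊆ Metric.ball 0 (R + 1) := by
    intro h hh
    have hh : g ((h : Euc N) + planePoint e u) ≤ 1 := hh
    rw [mem_ball_zero_iff]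
    refine (norm_le_norm_add_planePoint e h u).trans_lt ((hgR _).trans_lt ?_)
    nlinarith
  exact (integrable_indicator_iff hcl.measurableSet).2 (h1.mono_set h2)

lemma measurable_weight (hg : IsSmoothGauge g) (hl : Continuous l) (p : ℝ) :
    Measurable (weight g (fun t => (l t : ℂ)) p) := by
  refine Measurable.mul ?_ (Complex.measurable_ofReal.comp (measurable_norm_rpow _))
  exact Complex.measurable_ofReal.comp (hl.measurable.comp hg.continuous.measurable)

lemma integrable_weight_section (hg : IsSmoothGauge g) (hlc : Continuous l)
    (hl1 : ∀ t, 1 ≤ t → l t = 0) (hl : ∀ t, 0 ≤ l t ∧ l t ≤ 1) {p : ℝ} (hp : 0 ≤ p)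
    (hp' : p < finrank ℝ H) (u : Euc 2) : Integrable fun h : H =>
      weight g (fun t => (l t : ℂ)) p ((h : Euc N) + planePoint e u) := by
  refine (integrable_indicator_norm_rpow e hg hp hp' u).mono' ?_
    (.of_forall fun h => norm_weight_le hl1 hl p _)
  refine ((measurable_weight hg hlc p).comp ?_).aestronglyMeasurable
  exact Continuous.measurable (by fun_prop)

/-- Sections of the part of the weight near the origin. -/
theorem contDiff_sectionInt_weight (hg : IsSmoothGauge g) (hlc : ContDiff ℝ ∞ l)
    (hl0 : ∀ t, t ≤ 1 / 2 → l t = 1) (hl1 : ∀ t, 1 ≤ t → l t = 0)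
    (hl : ∀ t, 0 ≤ l t ∧ l t ≤ 1) {p : ℝ} {k : ℕ} (hp : 0 ≤ p) (hp' : p + k < finrank ℝ H) :
    ContDiff ℝ k (sectionInt e (weight g (fun t => (l t : ℂ)) p)) := by
  have hpm : p < finrank ℝ H := lt_of_le_of_lt (by simp) hp'
  -- The difference l(t) - l(2t) vanishes for t ≤ 1/4 and t ≥ 1, so its weight is a test function.
  -- It is the inhomogeneity of the refinement equation.
  have hζ : IsCutoff (fun t => (l t : ℂ) - (l (2 * t) : ℂ)) (1 / 4) 1 := by
    refine ⟨?_, by norm_num, fun t ht => ?_⟩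
    · have hc := Complex.ofRealCLM.contDiff (n := ∞)
      exact (hc.comp hlc).sub (hc.comp (hlc.comp (contDiff_const.mul contDiff_id)))
    · rw [Set.mem_Icc, not_and_or, not_le, not_le] at ht
      rcases ht with h | h
      · rw [hl0 t (by linarith), hl0 _ (by linarith), sub_self]
      · rw [hl1 t (by linarith), hl1 _ (by linarith), sub_self]
  have hS : ∀ u, sectionInt e (weight g (fun t => (l t : ℂ)) p) u =
      sectionInt e (weight g (fun t => (l t : ℂ) - (l (2 * t) : ℂ)) p) u +
      ((2 : ℝ) ^ (p - finrank ℝ H)) •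
        sectionInt e (weight g (fun t => (l t : ℂ)) p) ((2 : ℝ) • u) := by
    intro u
    rw [← sectionInt_weight_comp_mul e hg (fun t => (l t : ℂ)) p two_pos, sectionInt, sectionInt,
      sectionInt, ← sub_eq_iff_eq_add, ← integral_sub]
    · refine integral_congr_ae (.of_forall fun h => ?_)
      simp only [weight]
      ring
    · exact integrable_weight_section e hg hlc.continuous hl1 hl hp hpm u
    · have h2 := (integrable_weight_section e hg hlc.continuous hl1 hl hp hpm
        ((2 : ℝ) • u)).comp_smul (two_ne_zero (α := ℝ))
      refine (h2.const_mul ((2 ^ p : ℝ) : ℂ)).congr (.of_forall fun h => ?_)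
      have hx : (((2 : ℝ) • h : H) : Euc N) + planePoint e ((2 : ℝ) • u) =
          (2 : ℝ) • ((h : Euc N) + planePoint e u) := by
        rw [planePoint_smul, smul_add]
        rfl
      simp only
      rw [hx, weight, weight, hg.smul 2 _ zero_le_two, norm_smul, Real.norm_of_nonneg zero_le_two,
        Real.mul_rpow zero_le_two (norm_nonneg _), Real.rpow_neg zero_le_two]
      have : ((2 ^ p : ℝ) : ℂ) ≠ 0 := by exact_mod_cast (Real.rpow_pos_of_pos two_pos p).ne'
      push_cast at this ⊢
      field_simp
  obtain ⟨C, r, hC, hCr⟩ := gaugeSection_le e hg (p₁ := p) (p₂ := 0) (Or.inr hpm) hp le_rfl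
  refine contDiff_of_self_similar (C := C)
    (contDiff_sectionInt e (contDiff_weight hg hζ p) (hasCompactSupport_weight hg hζ p))
    (hasCompactSupport_sectionInt e (hasCompactSupport_weight hg hζ p)) (fun u => ?_) hS
    (by positivity) ?_
  · refine (norm_integral_le_integral_norm _).trans ?_
    refine (integral_mono (integrable_weight_section e hg hlc.continuous hl1 hl hp hpm u).norm
      (integrable_indicator_norm_rpow e hg hp hpm u)
      fun h => norm_weight_le hl1 hl p _).trans ?_
    have := hCr u (Or.inl rfl)
    rw [add_zero] at this
    refine this.trans ?_
    refine Set.indicator_le' (fun u _ => ?_) (fun u _ => hC) u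
    simp
  -- With θ = 2^{p - m} the condition θ 2^k < 1 is exactly p + k < m.
  · rw [← Real.rpow_natCast, ← Real.rpow_add two_pos]
    exact Real.rpow_lt_one_of_one_lt_of_neg one_lt_two (by linarith)

/-- The section function of a smooth convex body is smooth near the origin up to the order allowed
by the singularity of the density. -/
theorem contDiffAt_gaugeSection [Nontrivial H] (hg : IsSmoothGauge g) {p : ℝ} {k : ℕ} (hp : 0 ≤ p)
    (hp' : p + k < finrank ℝ H) : ContDiffAt ℝ k (gaugeSection g e p) 0 := by
  have hpm : p < finrank ℝ H := lt_of_le_of_lt (by simp) hp'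
  obtain ⟨l, hlc, hl0, hl1, hl⟩ := exists_smooth_step
  have hS := contDiff_sectionInt_weight e hg hlc hl0 hl1 hl hp hp'
  -- The factor 1 - l(g) vanishes near the origin, so b is smooth everywhere. The part with l(g)
  -- vanishes outside the body, so no boundary enters there.
  set b : Euc N → ℂ := weight g (fun t => 1 - (l t : ℂ)) p with hb
  have hbc : ContDiff ℝ ∞ b := by
    refine contDiff_of_eq_zero_of_lt hg (contDiffOn_weight hg ?_ p)
      (show (0 : ℝ) < 1 / 2 by norm_num) fun x hx => ?_
    · exact contDiff_const.sub ((Complex.ofRealCLM.contDiff (n := ∞)).comp hlc)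
    · rw [hb, weight, hl0 _ hx.le]
      simp
  have hB := (contDiffOn_integral_indicator_gauge e hg hbc).contDiffAt
    (IsOpen.mem_nhds (isOpen_lt (hg.continuous.comp (continuous_planePoint e)) continuous_const)
      (show g (planePoint e 0) < 1 by
        rw [← zero_smul ℝ (0 : Euc 2), planePoint_smul, zero_smul, hg.zero]; exact one_pos))
  have hsum : ∀ u, (gaugeSection g e p u : ℂ) =
      sectionInt e (weight g (fun t => (l t : ℂ)) p) u +
        ∫ h : H, {x | g x ≤ 1}.indicator b ((h : Euc N) + planePoint e u) := by
    intro u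
    rw [sectionInt, ← integral_add (integrable_weight_section e hg hlc.continuous hl1 hl hp hpm u)
      (integrable_indicator_gauge e hg hbc.continuous u), gaugeSection, ← integral_complex_ofReal]
    refine integral_congr_ae (.of_forall fun h => ?_)
    set x := (h : Euc N) + planePoint e u
    simp only [weight, hb, Set.indicator_apply, Set.mem_ofPred_eq]
    split_ifs with hx
    · ring
    · rw [hl1 _ (not_le.1 hx).le]
      simp
  have hC := (hS.contDiffAt (x := 0)).add (hB.of_le (m := k) (mod_cast le_top))
  have := Complex.reCLM.contDiff.contDiffAt.comp (0 : Euc 2) hC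
  refine this.congr_of_eventuallyEq (.of_forall fun u => ?_)
  simp only [Function.comp_apply, ← hsum]
  simp

end SingularPart

/-! ### Differentiation of averages of dilates. -/

section Dilations

variable {V F : Type*} [NormedAddCommGroup V] [NormedSpace ℝ V] [FiniteDimensional ℝ V]
  [NormedAddCommGroup F] [NormedSpace ℝ F] [NormedSpace ℂ F] [IsScalarTower ℝ ℂ F]
  [SMulCommClass ℝ ℂ F]

/-- An average of dilates of a function. -/
def dilationAverage (c : ℝ → ℂ) (A : V → F) (u : V) : F :=
  ∫ t in Set.Ioc (1 : ℝ) 2, c t • A (t⁻¹ • u)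

omit [FiniteDimensional ℝ V] in
lemma inv_smul_mem_ball {r : ℝ} {u : V} (hu : u ∈ Metric.ball (0 : V) r) {t : ℝ} (ht : 1 ≤ t) :
    t⁻¹ • u ∈ Metric.ball (0 : V) r := by
  rw [mem_ball_zero_iff] at hu ⊢
  rw [norm_smul, norm_inv, Real.norm_of_nonneg (by linarith)]
  refine lt_of_le_of_lt ?_ hu
  exact mul_le_of_le_one_left (norm_nonneg _) (inv_le_one_of_one_le₀ ht)

omit [FiniteDimensional ℝ V] [NormedSpace ℝ F] [IsScalarTower ℝ ℂ F] [SMulCommClass ℝ ℂ F] in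
lemma continuousOn_dilation {r : ℝ} {A : V → F} (hA : ContinuousOn A (Metric.ball 0 r)) {c : ℝ → ℂ}
    (hc : ContinuousOn c (Set.Icc 1 2)) {u : V} (hu : u ∈ Metric.ball 0 r) :
    ContinuousOn (fun t : ℝ => c t • A (t⁻¹ • u)) (Set.Icc 1 2) := by
  have h1 : ContinuousOn (fun t : ℝ => t⁻¹ • u) (Set.Icc 1 2) := by
    refine (continuousOn_id.inv₀ fun t ht => ?_).smul continuousOn_const
    exact (one_pos.trans_le ht.1).ne'
  exact hc.smul (hA.comp h1 fun t ht => inv_smul_mem_ball hu ht.1)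

omit [FiniteDimensional ℝ V] [NormedSpace ℝ F] [IsScalarTower ℝ ℂ F] [SMulCommClass ℝ ℂ F] in
lemma integrableOn_dilation {r : ℝ} {A : V → F} (hA : ContinuousOn A (Metric.ball 0 r)) {c : ℝ → ℂ}
    (hc : ContinuousOn c (Set.Icc 1 2)) {u : V} (hu : u ∈ Metric.ball 0 r) :
    IntegrableOn (fun t : ℝ => c t • A (t⁻¹ • u)) (Set.Ioc 1 2) :=
  ((continuousOn_dilation hA hc hu).integrableOn_Icc).mono_set Set.Ioc_subset_Icc_self

lemma continuousOn_mul_inv {c : ℝ → ℂ} (hc : ContinuousOn c (Set.Icc 1 2)) :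
    ContinuousOn (fun t : ℝ => c t * (t : ℂ)⁻¹) (Set.Icc 1 2) := by
  refine hc.mul (ContinuousOn.inv₀ Complex.continuous_ofReal.continuousOn fun t ht => ?_)
  exact_mod_cast (one_pos.trans_le ht.1).ne'

theorem hasFDerivAt_dilationAverage {r : ℝ} {A : V → F} (hA : ContDiffOn ℝ 1 A (Metric.ball 0 r))
    {c : ℝ → ℂ} (hc : ContinuousOn c (Set.Icc 1 2)) {u : V} (hu : u ∈ Metric.ball 0 r) :
    HasFDerivAt (dilationAverage c A)
      (dilationAverage (fun t => c t * (t : ℂ)⁻¹) (fderiv ℝ A) u) u := by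
  have : ProperSpace V := FiniteDimensional.proper ℝ V
  -- A slightly smaller ball has compact closure inside the domain, which gives a uniform bound on
  -- the derivative; dilation by 1/t ≤ 1 keeps points in it.
  obtain ⟨r', hr', hr'r⟩ := exists_between (mem_ball_zero_iff.1 hu)
  have hA' : ContinuousOn (fderiv ℝ A) (Metric.ball 0 r) :=
    hA.continuousOn_fderiv_of_isOpen Metric.isOpen_ball le_rfl
  have hc' := continuousOn_mul_inv hc
  obtain ⟨M, hM⟩ := (isCompact_closedBall (0 : V) r').exists_bound_of_continuousOn
    (hA'.mono (Metric.closedBall_subset_ball hr'r))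
  obtain ⟨M', hM'⟩ := (isCompact_Icc (a := (1 : ℝ)) (b := 2)).exists_bound_of_continuousOn hc'
  refine hasFDerivAt_integral_of_dominated_of_fderiv_le (𝕜 := ℝ)
    (μ := volume.restrict (Set.Ioc (1 : ℝ) 2)) (s := Metric.ball 0 r')
    (F := fun u t => c t • A (t⁻¹ • u)) (F' := fun u t => (c t * (t : ℂ)⁻¹) • fderiv ℝ A (t⁻¹ • u))
    (bound := fun _ => M' * M) (Metric.isOpen_ball.mem_nhds (mem_ball_zero_iff.2 hr')) ?_
    (integrableOn_dilation hA.continuousOn hc hu)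
    (integrableOn_dilation hA' hc' hu).aestronglyMeasurable ?_ ?_ ?_
  · filter_upwards [Metric.isOpen_ball.mem_nhds hu] with w hw
    exact (integrableOn_dilation hA.continuousOn hc hw).aestronglyMeasurable
  · filter_upwards [ae_restrict_mem measurableSet_Ioc] with t ht w hw
    rw [norm_smul]
    have h1 := hM' t (Set.Ioc_subset_Icc_self ht)
    exact mul_le_mul h1 (hM _ (Metric.ball_subset_closedBall (inv_smul_mem_ball hw ht.1.le)))
      (norm_nonneg _) ((norm_nonneg _).trans h1)
  · exact integrable_const _
  · filter_upwards [ae_restrict_mem measurableSet_Ioc] with t ht w hw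
    have hw' := inv_smul_mem_ball (Metric.ball_subset_ball hr'r.le hw) ht.1.le
    have h1 : HasFDerivAt A (fderiv ℝ A (t⁻¹ • w)) (t⁻¹ • w) :=
      ((hA.contDiffAt (Metric.isOpen_ball.mem_nhds hw')).differentiableAt one_ne_zero).hasFDerivAt
    have h2 : HasFDerivAt (fun w : V => t⁻¹ • w) (t⁻¹ • ContinuousLinearMap.id ℝ V) w :=
      (hasFDerivAt_id w).const_smul t⁻¹
    have h3 := (h1.comp w h2).const_smul (c t)
    refine h3.congr_fderiv ?_
    ext v
    simp only [ContinuousLinearMap.comp_smul, ContinuousLinearMap.comp_id, FunLike.coe_smul,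
      Pi.smul_apply, mul_smul]
    rw [← Complex.ofReal_inv]
    exact congrArg (c t • ·) (algebraMap_smul ℂ t⁻¹ _).symm

end Dilations

/-! ### Iterated Laplacians of averages of dilates. -/

section Laplacian

variable {V F : Type*} [NormedAddCommGroup V] [InnerProductSpace ℝ V] [FiniteDimensional ℝ V]
  [NormedAddCommGroup F] [NormedSpace ℝ F]

/-- The trace of a bilinear map, as a continuous linear map. -/
def traceCLM (V F : Type*) [NormedAddCommGroup V] [InnerProductSpace ℝ V] [FiniteDimensional ℝ V]
    [NormedAddCommGroup F] [NormedSpace ℝ F] : (V →L[ℝ] V →L[ℝ] F) →L[ℝ] F :=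
  ∑ i, (ContinuousLinearMap.apply ℝ F (stdOrthonormalBasis ℝ V i)) ∘L
    (ContinuousLinearMap.apply ℝ (V →L[ℝ] F) (stdOrthonormalBasis ℝ V i))

lemma laplacian_eq_traceCLM (f : V → F) (x : V) :
    Laplacian.laplacian f x = traceCLM V F (fderiv ℝ (fderiv ℝ f) x) := by
  rw [InnerProductSpace.laplacian_eq_iteratedFDeriv_stdOrthonormalBasis]
  simp [traceCLM, iteratedFDeriv_two_apply]

lemma contDiffOn_laplacian {f : V → F} {s : Set V} (hs : IsOpen s) {k : ℕ}
    (hf : ContDiffOn ℝ (k + 2 : ℕ) f s) : ContDiffOn ℝ k (Laplacian.laplacian f) s := by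
  have h1 : ContDiffOn ℝ (k + 1 : ℕ) (fderiv ℝ f) s :=
    hf.fderiv_of_isOpen hs (by norm_cast)
  have h2 : ContDiffOn ℝ k (fderiv ℝ (fderiv ℝ f)) s :=
    h1.fderiv_of_isOpen hs (by norm_cast)
  refine ((traceCLM V F).contDiff.comp_contDiffOn h2).congr fun x _ => ?_
  exact laplacian_eq_traceCLM f x

lemma laplacian_iterate_congr {f₁ f₂ : V → F} {s : Set V} (hs : IsOpen s) (h : Set.EqOn f₁ f₂ s)
    (d : ℕ) : Set.EqOn ((Laplacian.laplacian (F := V → F))^[d] f₁)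
      ((Laplacian.laplacian (F := V → F))^[d] f₂) s := by
  induction d generalizing f₁ f₂ with
  | zero => exact h
  | succ d ih =>
    rw [Function.iterate_succ_apply, Function.iterate_succ_apply]
    refine ih fun x hx => ?_
    exact (InnerProductSpace.laplacian_congr_nhds
      (h.eventuallyEq_of_mem (hs.mem_nhds hx))).eq_of_nhds

lemma laplacian_iterate_ofReal {f : V → ℝ} {s : Set V} (hs : IsOpen s) {d : ℕ}
    (hf : ContDiffOn ℝ (2 * d : ℕ) f s) :
    Set.EqOn ((Laplacian.laplacian (F := V → ℂ))^[d] fun x => (f x : ℂ))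
      (fun x => (((Laplacian.laplacian (F := V → ℝ))^[d] f x : ℝ) : ℂ)) s := by
  induction d generalizing f with
  | zero => exact fun x _ => rfl
  | succ d ih =>
    rw [Function.iterate_succ_apply, Function.iterate_succ_apply]
    have hf2 : ContDiffOn ℝ (2 * d + 2 : ℕ) f s := hf
    refine Set.EqOn.trans (laplacian_iterate_congr hs (fun x hx => ?_) d)
      (ih (contDiffOn_laplacian hs hf2))
    have h2 : ContDiffAt ℝ 2 f x :=
      (hf2.contDiffAt (hs.mem_nhds hx)).of_le (by norm_cast; omega)
    exact h2.laplacian_CLM_comp_left (l := Complex.ofRealCLM)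

variable [NormedSpace ℂ F] [IsScalarTower ℝ ℂ F] [SMulCommClass ℝ ℂ F] [CompleteSpace F]

/-- The Laplacian of an average of dilates. -/
theorem laplacian_dilationAverage {r : ℝ} {A : V → F} (hA : ContDiffOn ℝ 2 A (Metric.ball 0 r))
    {c : ℝ → ℂ} (hc : ContinuousOn c (Set.Icc 1 2)) :
    Set.EqOn (Laplacian.laplacian (dilationAverage c A))
      (dilationAverage (fun t => c t * (t : ℂ)⁻¹ * (t : ℂ)⁻¹) (Laplacian.laplacian A))
      (Metric.ball 0 r) := by
  intro u hu
  have hA' : ContDiffOn ℝ 1 (fderiv ℝ A) (Metric.ball 0 r) :=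
    hA.fderiv_of_isOpen Metric.isOpen_ball (by norm_num)
  have hA'' : ContinuousOn (fderiv ℝ (fderiv ℝ A)) (Metric.ball 0 r) :=
    hA'.continuousOn_fderiv_of_isOpen Metric.isOpen_ball le_rfl
  have hc' := continuousOn_mul_inv hc
  -- Each differentiation brings out a factor 1/t by the chain rule.
  have h1 : fderiv ℝ (dilationAverage c A) =ᶠ[nhds u]
      dilationAverage (fun t => c t * (t : ℂ)⁻¹) (fderiv ℝ A) := by
    filter_upwards [Metric.isOpen_ball.mem_nhds hu] with w hw
    exact (hasFDerivAt_dilationAverage (hA.of_le (by norm_num)) hc hw).fderiv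
  rw [laplacian_eq_traceCLM, h1.fderiv_eq, (hasFDerivAt_dilationAverage hA' hc' hu).fderiv,
    dilationAverage, dilationAverage]
  have hi := integrableOn_dilation (F := V →L[ℝ] V →L[ℝ] F) hA'' (continuousOn_mul_inv hc') hu
  refine (ContinuousLinearMap.integral_comp_comm (𝕜 := ℝ) (E := V →L[ℝ] V →L[ℝ] F)
    (traceCLM V F) hi).symm.trans ?_
  refine integral_congr_ae (.of_forall fun t => ?_)
  simp only [laplacian_eq_traceCLM]
  simp [traceCLM, Finset.smul_sum]

theorem laplacian_iterate_dilationAverage {r : ℝ} {A : V → F} {d : ℕ}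
    (hA : ContDiffOn ℝ (2 * d : ℕ) A (Metric.ball 0 r)) {c : ℝ → ℂ}
    (hc : ContinuousOn c (Set.Icc 1 2)) :
    Set.EqOn ((Laplacian.laplacian (F := V → F))^[d] (dilationAverage c A))
      (dilationAverage (fun t => c t * ((t : ℂ) ^ (2 * d))⁻¹)
        ((Laplacian.laplacian (F := V → F))^[d] A)) (Metric.ball 0 r) := by
  induction d generalizing A c with
  | zero => intro u _; simp
  | succ d ih =>
    rw [Function.iterate_succ_apply, Function.iterate_succ_apply]
    have hA2 : ContDiffOn ℝ (2 * d + 2 : ℕ) A (Metric.ball 0 r) := hA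
    have hc' := continuousOn_mul_inv (continuousOn_mul_inv hc)
    refine Set.EqOn.trans (laplacian_iterate_congr Metric.isOpen_ball
      (laplacian_dilationAverage (hA2.of_le (by norm_cast; omega)) hc) d) ?_
    refine (ih (contDiffOn_laplacian Metric.isOpen_ball hA2) hc').trans fun u _ => ?_
    simp only [dilationAverage]
    refine integral_congr_ae (.of_forall fun t => ?_)
    simp only
    congr 1
    rw [show 2 * (d + 1) = 2 * d + 2 by ring, pow_add, mul_inv]
    ring

end Laplacian

/-! ### Fourier inversion at the origin. -/

section Inversion

variable {V : Type*} [NormedAddCommGroup V] [InnerProductSpace ℝ V] [FiniteDimensional ℝ V]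
  [MeasurableSpace V] [BorelSpace V]

lemma angFourier_laplacian (f : 𝓢(V, ℂ)) (ξ : V) :
    angFourier (Laplacian.laplacian f : 𝓢(V, ℂ)) ξ = -(‖ξ‖ : ℂ) ^ 2 * angFourier f ξ := by
  rw [angFourier_eq_fourier, angFourier_eq_fourier, ← SchwartzMap.fourier_coe,
    ← SchwartzMap.fourier_coe, SchwartzMap.laplacian_eq_fourierMultiplierCLM,
    SchwartzMap.fourierMultiplierCLM_apply, FourierTransform.fourier_smul,
    FourierTransform.fourier_fourierInv_eq]
  have hg : Function.HasTemperateGrowth fun x : V => ‖x‖ ^ 2 := by fun_prop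
  rw [smul_apply, SchwartzMap.smulLeftCLM_apply_apply hg, norm_smul,
    Real.norm_of_nonneg (by positivity)]
  have : (Real.pi : ℂ) ≠ 0 := by exact_mod_cast Real.pi_ne_zero
  simp only [Complex.real_smul]
  push_cast
  field_simp

omit [MeasurableSpace V] [BorelSpace V] in
lemma coe_laplacian_iterate (f : 𝓢(V, ℂ)) (d : ℕ) :
    ⇑((Laplacian.laplacian (F := 𝓢(V, ℂ)))^[d] f) =
      (Laplacian.laplacian (F := V → ℂ))^[d] ⇑f := by
  induction d generalizing f with
  | zero => rfl
  | succ d ih =>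
    rw [Function.iterate_succ_apply, Function.iterate_succ_apply, ih]
    congr 1
    funext x
    exact SchwartzMap.laplacian_apply f x

lemma angFourier_laplacian_iterate (f : 𝓢(V, ℂ)) (d : ℕ) (ξ : V) :
    angFourier ((Laplacian.laplacian (F := 𝓢(V, ℂ)))^[d] f : 𝓢(V, ℂ)) ξ =
      (-1) ^ d * (‖ξ‖ : ℂ) ^ (2 * d) * angFourier f ξ := by
  induction d with
  | zero => simp
  | succ d ih =>
    rw [Function.iterate_succ_apply', angFourier_laplacian, ih, mul_add, pow_add, pow_succ (-1 : ℂ)]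
    ring

/-- Fourier inversion at 0; the power of 2π comes from the rescaling of ξ between the two
normalisations. In the plane it is the 4π² of part (2). -/
lemma integral_angFourier (f : 𝓢(V, ℂ)) :
    ∫ ξ, angFourier f ξ = ((2 * Real.pi) ^ finrank ℝ V : ℝ) * f 0 := by
  have h := congrArg (fun φ : 𝓢(V, ℂ) => φ 0) (FourierTransform.fourierInv_fourier_eq (F := 𝓢(V, ℂ)) f)
  simp only [SchwartzMap.fourierInv_coe, Real.fourierInv_eq, SchwartzMap.fourier_coe] at h
  simp only [inner_zero_right, AddChar.map_zero_eq_one, one_smul] at h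
  have h2 := Measure.integral_comp_inv_smul_of_nonneg (volume : Measure V)
    (FourierTransform.fourier (f : V → ℂ)) (R := 2 * Real.pi) (by positivity)
  simp_rw [angFourier_eq_fourier]
  rw [h2, h, Complex.real_smul]

/-- The Laplacian at the origin in terms of the Fourier transform. -/
theorem integral_norm_pow_mul_angFourier (f : 𝓢(V, ℂ)) (d : ℕ) :
    ∫ ξ, (‖ξ‖ : ℂ) ^ (2 * d) * angFourier f ξ = (-1) ^ d * ((2 * Real.pi) ^ finrank ℝ V : ℝ) *
      (Laplacian.laplacian (F := V → ℂ))^[d] f 0 := by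
  have h := integral_angFourier ((Laplacian.laplacian (F := 𝓢(V, ℂ)))^[d] f)
  simp_rw [angFourier_laplacian_iterate, mul_assoc] at h
  rw [integral_const_mul, coe_laplacian_iterate] at h
  rw [mul_assoc, ← h, ← mul_assoc, ← mul_pow]
  norm_num

end Inversion

/-! ### The formula of part (2). -/

section LaplacianFormula

lemma sectionInt_weight_eq_dilationAverage {N : ℕ} {H : Submodule ℝ (Euc N)}
    (e : OrthonormalBasis (Fin 2) ℝ Hᗮ) {g : Euc N → ℝ} (hg : IsSmoothGauge g) {η : ℝ → ℂ}
    (hη : IsCutoff η 1 2) {p : ℝ} (hp : 0 ≤ p) (hp' : p < finrank ℝ H) :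
    sectionInt e (weight g η p) =
      dilationAverage (fun t => -((t : ℂ) ^ ((finrank ℝ H : ℂ) - p) * deriv η t))
        fun u => (gaugeSection g e p u : ℂ) := by
  funext u
  have h := sectionInt_weight_eq e hg hη (p₁ := p) (p₂ := 0) (Or.inr hp') hp le_rfl
    (u := u) (Or.inl rfl)
  rw [add_zero] at h
  rw [h, dilationAverage, ← integral_neg]
  refine setIntegral_congr_fun measurableSet_Ioc fun t ht => ?_
  have ht : 0 ≤ t := by linarith [ht.1]
  simp only [smul_eq_mul]
  push_cast [Complex.ofReal_cpow ht]
  ring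

/-- The Laplacians of the section function at the origin as integrals of the Fourier transform over
the circle. -/
theorem laplacian_iterate_eq_circleInt {N : ℕ} {H : Submodule ℝ (Euc N)} [Nontrivial H]
    (hH : finrank ℝ H + 2 = N) (e : OrthonormalBasis (Fin 2) ℝ Hᗮ) {g : Euc N → ℝ}
    (hg : IsSmoothGauge g) {d : ℕ} {p s : ℝ} (hp : 0 ≤ p) (hs : 0 < s)
    (hsN : s + p + 2 * d + 2 = N) {f : Euc N → ℝ}
    (hf : ∀ x, f x = g x ^ (-s) * ‖x‖ ^ (-p)) {F : Euc N → ℂ} (hF : IsFourierTransform f F) :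
    (((Laplacian.laplacian (F := Euc 2 → ℝ))^[d] (gaugeSection g e p) 0 : ℝ) : ℂ) =
      (((-1 : ℝ) ^ d / (4 * Real.pi ^ 2 * s) : ℝ) : ℂ) * circleInt e F := by
  obtain ⟨κ, hκ, hκ0, hκ1⟩ := exists_normalized_cutoff
  have hη := isCutoff_cutPow hκ hκ0 (-(s : ℂ))
  set η := cutPow κ (-(s : ℂ)) with hηdef
  have hm : (finrank ℝ H : ℝ) = s + p + 2 * d := by
    have : (finrank ℝ H : ℝ) + 2 = N := by exact_mod_cast hH
    linarith
  have hmC : (finrank ℝ H : ℂ) - p = s + 2 * d := by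
    have : (finrank ℝ H : ℂ) = ((s + p + 2 * d : ℝ) : ℂ) := by rw [← hm]; simp
    rw [this]
    push_cast
    ring
  have hd : (0 : ℝ) ≤ d := d.cast_nonneg
  obtain ⟨U, hU, hA⟩ := (contDiffAt_gaugeSection e hg (k := 2 * d) hp
    (by rw [hm]; push_cast; linarith)).contDiffOn (m := (2 * d : ℕ)) le_rfl
    fun h => absurd (WithTop.coe_injective h) (ENat.natCast_ne_top (2 * d))
  obtain ⟨r, hr, hrU⟩ := Metric.mem_nhds_iff.1 hU
  have hA := hA.mono hrU
  have h0 : (0 : Euc 2) ∈ Metric.ball (0 : Euc 2) r := Metric.mem_ball_self hr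
  have hAc : ContDiffOn ℝ (2 * d : ℕ) (fun u => (gaugeSection g e p u : ℂ)) (Metric.ball 0 r) :=
    Complex.ofRealCLM.contDiff.comp_contDiffOn hA
  have hc : ContinuousOn (fun t : ℝ => -((t : ℂ) ^ ((finrank ℝ H : ℂ) - p) * deriv η t))
      (Set.Icc 1 2) := by
    refine (ContinuousOn.mul ?_ hη.continuous_deriv.continuousOn).neg
    exact (contDiffOn_cpow_const _).continuousOn.mono fun t ht => one_pos.trans_le ht.1
  have hP := laplacian_iterate_dilationAverage hAc hc h0
  rw [← sectionInt_weight_eq_dilationAverage e hg hη hp (by rw [hm]; linarith)] at hP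
  -- At the origin all dilates take the same value, which factors out. The remaining weight is
  -- -η'(t) t^{m-p-2d} with m - p - 2d = s, whose integral is s.
  have hmom : dilationAverage (fun t => -((t : ℂ) ^ ((finrank ℝ H : ℂ) - p) * deriv η t) *
      ((t : ℂ) ^ (2 * d))⁻¹) ((Laplacian.laplacian (F := Euc 2 → ℂ))^[d]
        fun u => (gaugeSection g e p u : ℂ)) 0 =
      s * (((Laplacian.laplacian (F := Euc 2 → ℝ))^[d] (gaugeSection g e p) 0 : ℝ) : ℂ) := by
    have hz := laplacian_iterate_ofReal Metric.isOpen_ball hA h0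
    beta_reduce at hz
    rw [← hz, dilationAverage]
    simp_rw [smul_zero, smul_eq_mul]
    rw [integral_mul_const, ← cutoffMoment_cutPow hκ hκ0 hκ1 (s : ℂ), ← hηdef, cutoffMoment,
      ← integral_neg]
    congr 1
    refine setIntegral_congr_fun measurableSet_Ioc fun t ht => ?_
    have ht : (t : ℂ) ≠ 0 := by exact_mod_cast (one_pos.trans ht.1).ne'
    rw [hmC, Complex.cpow_add _ _ ht,
      show (2 * d : ℂ) = ((2 * d : ℕ) : ℂ) by push_cast; ring, Complex.cpow_natCast]
    have := pow_ne_zero (2 * d) ht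
    field_simp
  rw [hmom] at hP
  have hci := circleInt_eq_integral e hg hκ hκ0 hκ1 (q := 2 * d) (by linarith) (by linarith) hsN hf hF
  have hinv := integral_norm_pow_mul_angFourier
    (sectionSchwartz e (contDiff_weight hg hη p) (hasCompactSupport_weight hg hη p)) d
  rw [coe_sectionSchwartz, hP, finrank_euclideanSpace_fin] at hinv
  have hcast : ((2 * d : ℝ) : ℂ) = ((2 * d : ℕ) : ℂ) := by push_cast; ring
  rw [hcast] at hci
  simp_rw [Complex.cpow_natCast] at hci
  rw [hci, hinv]
  have hs' : (s : ℂ) ≠ 0 := by exact_mod_cast hs.ne'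
  have hpi : (Real.pi : ℂ) ≠ 0 := by exact_mod_cast Real.pi_ne_zero
  have h1 : ((-1 : ℂ) ^ d) * (-1) ^ d = 1 := by rw [← mul_pow]; norm_num
  push_cast
  field_simp
  linear_combination (-(4 : ℂ) * (((Laplacian.laplacian (F := Euc 2 → ℝ))^[d] (gaugeSection g e p) 0 : ℝ) : ℂ)) * h1

end LaplacianFormula

end BusemannPetty

end

/-! ### Assembly of both parts. -/

open BusemannPetty

theorem mainTheorem4 (n : ℕ) (D : ConvexBody (BusemannPetty.Euc (2 * n)))
    (hD_int : (interior (D : Set (BusemannPetty.Euc (2 * n)))).Nonempty)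
    (hD_symm : ∀ x ∈ D, -x ∈ D)
    (hD_smooth : BusemannPetty.IsInfinitelySmooth D)
    (H : Submodule ℝ (BusemannPetty.Euc (2 * n)))
    (hH : finrank ℝ H + 2 = 2 * n)
    (e : OrthonormalBasis (Fin 2) ℝ Hᗮ) :
    (∀ q p : ℝ, -2 < q → q < 2 * n - 2 → 0 ≤ p → p ≤ 2 * n - q - 3 →
      (∃ G : ℂ → ℂ, BusemannPetty.IsRegularizedAction
        (BusemannPetty.sectionFun D H e p) (2 * n - p - 3) G) ∧
      (∃ F : BusemannPetty.Euc (2 * n) → ℂ, BusemannPetty.IsFourierTransform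
        (BusemannPetty.normPower D (2 * n - q - p - 2) p) F) ∧
      ∀ (G : ℂ → ℂ) (F : BusemannPetty.Euc (2 * n) → ℂ),
        BusemannPetty.IsRegularizedAction
          (BusemannPetty.sectionFun D H e p) (2 * n - p - 3) G →
        BusemannPetty.IsFourierTransform
          (BusemannPetty.normPower D (2 * n - q - p - 2) p) F →
        G (q : ℂ) =
          (((2 : ℝ) ^ (-q - 2) /
            (Real.pi * Real.Gamma ((q + 2) / 2) * (2 * n - q - p - 2)) : ℝ) : ℂ) *
            BusemannPetty.circleInt e F) ∧
    (∀ (d : ℕ) (p : ℝ), d + 1 < n → 0 ≤ p → p ≤ 2 * n - 2 * d - 3 →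
      ContDiffAt ℝ (2 * d : ℕ) (BusemannPetty.sectionFun D H e p) 0 ∧
      (∃ F : BusemannPetty.Euc (2 * n) → ℂ, BusemannPetty.IsFourierTransform
        (BusemannPetty.normPower D (2 * n - 2 * d - p - 2) p) F) ∧
      ∀ F : BusemannPetty.Euc (2 * n) → ℂ,
        BusemannPetty.IsFourierTransform
          (BusemannPetty.normPower D (2 * n - 2 * d - p - 2) p) F →
        ((((Laplacian.laplacian (F := BusemannPetty.Euc 2 → ℝ))^[d]
            (BusemannPetty.sectionFun D H e p) 0 : ℝ)) : ℂ) =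
          (((-1 : ℝ) ^ d / (4 * Real.pi ^ 2 * (2 * n - 2 * d - p - 2)) : ℝ) : ℂ) *
            BusemannPetty.circleInt e F) := by
  have hg := isSmoothGauge_gauge D hD_int hD_symm hD_smooth
  have hm : (finrank ℝ H : ℝ) = 2 * n - 2 := by
    have : (finrank ℝ H : ℝ) + 2 = 2 * n := by exact_mod_cast hH
    linarith
  refine ⟨fun q p hq hq' hp hpq => ⟨?_, ?_, fun G F hG hF => ?_⟩, fun d p hd hp hpd => ?_⟩
  · rw [sectionFun_eq_gaugeSection e D hD_int hD_symm]
    exact exists_isRegularizedAction e hg hp (by linarith)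
  · exact exists_isFourierTransform D hg (by linarith) (by linarith)
  · exact regularizedAction_eq_circleInt D hD_int hD_symm hD_smooth hH e hq hq' hp hpq hG hF
  have hd0 : (0 : ℝ) ≤ d := d.cast_nonneg
  -- Polar coordinates in H need dim H > 0, and d + 1 < n forces n ≥ 2. Part (1) also covers n = 1,
  -- where H = 0.
  have : Nontrivial H := nontrivial_of_finrank_pos (R := ℝ) (by omega)
  have hdn : (d : ℝ) + 1 < n := by exact_mod_cast hd
  rw [sectionFun_eq_gaugeSection e D hD_int hD_symm]
  refine ⟨contDiffAt_gaugeSection e hg hp (by rw [hm]; push_cast; linarith),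
    exists_isFourierTransform D hg (by linarith) (by linarith), fun F hF => ?_⟩
  exact laplacian_iterate_eq_circleInt hH e hg hp (by linarith) (by push_cast; ring)
    (fun x => rfl) hF
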